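/- **Theorem (First order blow-up rate).** Let $N\ge 2$, $p>1$, $-1<\alpha<p-1$, $\sigma>p-2$, and let $B\subset\mathbb R^N$ be an open ball of radius $1$, with $d(x)=\operatorname{dist}(x,\partial B)$ and $\Phi_p(z)=|z|^{p-2}z$. Let $f\in C^1([0,\infty))$ be nondecreasing, positive on $(0,\infty)$, and regularly varying at infinity with index $\sigma+1$, i.e. $\lim_{u\to\infty} f(\xi u)/f(u)=\xi^{\sigma+1}$ for every $\xi>0$. Put $F(t)=\int_0^t f(s)\,ds$ and $q=p/(p-1)$. Let $k$ be in the class $\mathcal K$: for some $\nu>0$, $k$ is positive and monotone (nondecreasing or nonincreasing) on $(0,\nu)$, $k\in L^1(0,\nu)\cap C^1(0,\nu)$, the integral $K(t)=\int_0^t s^{-\alpha/2}k(s)\,ds$ is finite for $0<t<\nu$, and the finite limits $$l_0=\lim_{t\to0+}\frac{K(t)}{t^{-\alpha/2}k(t)},\qquad l_1=\lim_{t\to0+}\left(\frac{K(t)}{t^{-\alpha/2}k(t)}\right)'$$ exist. Let $b\in C(B)$ be positive in $B$ and such that, with constants $b_1,b_2\in(0,\infty)$, $$b_1=\liminf_{d(x)\to0}\frac{b(x)}{d(x)^{\alpha-\alpha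 p/2}\,k(d(x))^p},\qquad b_2=\limsup_{d(x)\to0}\frac{b(x)}{d(x)^{\alpha-\alpha p/2}\,k(d(x))^p}.$$ For all small $t>0$ the equation $$\int_{\phi(t)}^\infty\frac{ds}{(qF(s))^{1/p}}=t$$ has a solution $\phi(t)>0$, and this defines $\phi$ near $0+$. Let $u\in W^{1,p}_{\rm loc}(B)\cap C(B)$, $u\ge0$, be a local weak large solution of $\operatorname{div}(d^\alpha\Phi_p(\nabla u))=b\,f(u)$ in $B$, that is, $$\int_B d^\alpha\,\Phi_p(\nabla u)\cdot\nabla\eta\,dx+\int_B b\,f(u)\,\eta\,dx=0$$ for all $\eta\in W^{1,p}(B)$ with compact support in $B$, and $u(x)\to\infty$ as $d(x)\to0$. Then $$\xi_2\le\liminf_{d(x)\to0}\frac{u(x)}{\phi(K(d(x)))}\le\limsup_{d(x)\to0}\frac{u(x)}{\phi(K(d(x)))}\le\xi_1,\qquad \xi_i=\left(\frac{p+l_1\left(1-\frac{\alpha}{p-1}\right)(2+\sigma-p)}{b_i\,(2+\sigma)}\right)^{\frac1{2+\sigma-p}}\quad(i=1,2).$$ In particular, if $b_1=b_2=c$, then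 $$\lim_{d(x)\to0}\frac{u(x)}{\phi(K(d(x)))}=\xi_0:=\left(\frac{p+l_1\left(1-\frac{\alpha}{p-1}\right)(2+\sigma-p)}{c\,(2+\sigma)}\right)^{\frac1{2+\sigma-p}}.$$ -/

import Mathlib

open Real Set Filter Topology MeasureTheory
open scoped ENNReal ContDiff

noncomputable section

/-- A function on `(0,∞)`, positive and measurable there, is regularly varying at infinity with
index `ρ` if `f (ξ u) / f u → ξ ^ ρ` as `u → ∞`, for every `ξ > 0`. -/
structure IsRegularlyVarying (f : ℝ → ℝ) (ρ : ℝ) : Prop where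
  pos : ∀ u, 0 < u → 0 < f u
  meas : Measurable ((Ioi (0 : ℝ)).domRestrict f)
  lim : ∀ ξ : ℝ, 0 < ξ → Tendsto (fun u => f (ξ * u) / f u) atTop (𝓝 (ξ ^ ρ))

/-- The primitive `F t = ∫₀ᵗ f`. -/
def primitiveF (f : ℝ → ℝ) (t : ℝ) : ℝ := ∫ s in (0 : ℝ)..t, f s

/-- `φ` is (for small `t > 0`) the function given by `∫_{φ(t)}^∞ (q F(s))^{-1/p} ds = t`, where
`q = p / (p - 1)`. As `t > 0`, the equation forces the integral to converge. -/
def IsProfile (p : ℝ) (f φ : ℝ → ℝ) : Prop :=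
  ∀ᶠ t in 𝓝[>] (0 : ℝ),
    0 < φ t ∧ ∫ s in Ioi (φ t), (p / (p - 1) * primitiveF f s) ^ (-(1 / p)) = t

/-- `K t = ∫₀ᵗ s^{-α/2} k(s) ds`. -/
def weightK (α : ℝ) (k : ℝ → ℝ) (t : ℝ) : ℝ := ∫ s in (0 : ℝ)..t, s ^ (-α / 2) * k s

/-- The quotient `K(t) / (t^{-α/2} k(t))`. -/
def quotK (α : ℝ) (k : ℝ → ℝ) (t : ℝ) : ℝ := weightK α k t / (t ^ (-α / 2) * k t)

/-- `k` belongs to the class `𝒦` (for the exponent `α`), with constant `l₁`: on some interval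
`(0,ν)` it is positive, monotone (in either direction), integrable and `C¹`, the integral defining
`K` converges, and `K / (t^{-α/2} k)` and its derivative have finite limits at `0+`, the second
one being `l₁`. -/
structure MemClassK (α : ℝ) (k : ℝ → ℝ) (l₁ : ℝ) : Prop where
  exists_interval : ∃ ν : ℝ, 0 < ν ∧
    (∀ t ∈ Ioo 0 ν, 0 < k t) ∧
    (MonotoneOn k (Ioo 0 ν) ∨ AntitoneOn k (Ioo 0 ν)) ∧
    IntegrableOn k (Ioo 0 ν) ∧
    ContDiffOn ℝ 1 k (Ioo 0 ν) ∧
    IntegrableOn (fun s => s ^ (-α / 2) * k s) (Ioo 0 ν)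
  lim_zero : ∃ l₀ : ℝ, Tendsto (quotK α k) (𝓝[>] 0) (𝓝 l₀)
  lim_one : Tendsto (deriv (quotK α k)) (𝓝[>] 0) (𝓝 l₁)

/-- The distance `d(x)` to the boundary of the open unit ball centred at `x₀`. -/
def bdist {N : ℕ} (x₀ x : EuclideanSpace ℝ (Fin N)) : ℝ :=
  Metric.infDist x (frontier (Metric.ball x₀ 1))

/-- The filter "`x` in the open unit ball, `d(x) → 0`". -/
def toBoundary {N : ℕ} (x₀ : EuclideanSpace ℝ (Fin N)) : Filter (EuclideanSpace ℝ (Fin N)) :=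
  comap (bdist x₀) (𝓝 0) ⊓ 𝓟 (Metric.ball x₀ 1)

/-- `G` is the weak (distributional) gradient of `u` in the open set `U`. -/
structure HasWeakGradientOn {N : ℕ} (U : Set (EuclideanSpace ℝ (Fin N)))
    (u : EuclideanSpace ℝ (Fin N) → ℝ)
    (G : EuclideanSpace ℝ (Fin N) → EuclideanSpace ℝ (Fin N)) : Prop where
  locInt_fun : LocallyIntegrableOn u U
  locInt_grad : LocallyIntegrableOn G U
  parts : ∀ η : EuclideanSpace ℝ (Fin N) → ℝ, ContDiff ℝ ∞ η → HasCompactSupport η →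
    tsupport η ⊆ U → ∀ v : EuclideanSpace ℝ (Fin N),
      ∫ x in U, u x * fderiv ℝ η x v = - ∫ x in U, inner ℝ (G x) v * η x

/-- `u ∈ W^{1,p}_loc(U)`, with weak gradient `G`. -/
structure MemW1pLoc {N : ℕ} (p : ℝ) (U : Set (EuclideanSpace ℝ (Fin N)))
    (u : EuclideanSpace ℝ (Fin N) → ℝ)
    (G : EuclideanSpace ℝ (Fin N) → EuclideanSpace ℝ (Fin N)) : Prop where
  grad : HasWeakGradientOn U u G
  memLp_fun : ∀ C ⊆ U, IsCompact C → MemLp u (ENNReal.ofReal p) (volume.restrict C)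
  memLp_grad : ∀ C ⊆ U, IsCompact C → MemLp G (ENNReal.ofReal p) (volume.restrict C)

/-- `η ∈ W^{1,p}_c(U)` (Sobolev functions with compact support in `U`), with weak gradient `H`. -/
structure MemW1pCompact {N : ℕ} (p : ℝ) (U : Set (EuclideanSpace ℝ (Fin N)))
    (η : EuclideanSpace ℝ (Fin N) → ℝ)
    (H : EuclideanSpace ℝ (Fin N) → EuclideanSpace ℝ (Fin N)) : Prop where
  grad : HasWeakGradientOn U η H
  compact : HasCompactSupport η
  support : tsupport η ⊆ U
  memLp_fun : MemLp η (ENNReal.ofReal p) (volume.restrict U)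
  memLp_grad : MemLp H (ENNReal.ofReal p) (volume.restrict U)

/-- `Φ_p(z) = |z|^{p-2} z`. -/
def PhiP {N : ℕ} (p : ℝ) (z : EuclideanSpace ℝ (Fin N)) : EuclideanSpace ℝ (Fin N) :=
  ‖z‖ ^ (p - 2) • z

/-- `u ∈ W^{1,p}_loc(B) ∩ C(B)` is a local weak solution of `div (d^α Φ_p(∇u)) = b f(u)` in the
open unit ball `B` centred at `x₀`. -/
def IsWeakSolution {N : ℕ} (x₀ : EuclideanSpace ℝ (Fin N)) (p α : ℝ)
    (b : EuclideanSpace ℝ (Fin N) → ℝ) (f : ℝ → ℝ) (u : EuclideanSpace ℝ (Fin N) → ℝ) : Prop :=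
  ContinuousOn u (Metric.ball x₀ 1) ∧
  ∃ G : EuclideanSpace ℝ (Fin N) → EuclideanSpace ℝ (Fin N),
    MemW1pLoc p (Metric.ball x₀ 1) u G ∧
    ∀ (η : EuclideanSpace ℝ (Fin N) → ℝ)
      (H : EuclideanSpace ℝ (Fin N) → EuclideanSpace ℝ (Fin N)),
      MemW1pCompact p (Metric.ball x₀ 1) η H →
        (∫ x in Metric.ball x₀ 1, inner ℝ (PhiP p (G x)) (H x) * bdist x₀ x ^ α) +
          ∫ x in Metric.ball x₀ 1, b x * f (u x) * η x = 0

/-- A local weak large solution: a nonnegative local weak solution with `u(x) → ∞` as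
`d(x) → 0`. -/
structure IsLargeSolution {N : ℕ} (x₀ : EuclideanSpace ℝ (Fin N)) (p α : ℝ)
    (b : EuclideanSpace ℝ (Fin N) → ℝ) (f : ℝ → ℝ) (u : EuclideanSpace ℝ (Fin N) → ℝ) :
    Prop where
  sol : IsWeakSolution x₀ p α b f u
  nonneg : ∀ x ∈ Metric.ball x₀ 1, 0 ≤ u x
  blowup : Tendsto u (toBoundary x₀) atTop

/-- The quotient `b(x) / (d(x)^{α-αp/2} k(d(x))^p)`, as an extended real. -/
def quotB {N : ℕ} (x₀ : EuclideanSpace ℝ (Fin N)) (p α : ℝ) (k : ℝ → ℝ)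
    (b : EuclideanSpace ℝ (Fin N) → ℝ) (x : EuclideanSpace ℝ (Fin N)) : EReal :=
  ((b x / (bdist x₀ x ^ (α - α * p / 2) * k (bdist x₀ x) ^ p) : ℝ) : EReal)

/-- The blow-up constant
`((p + l₁ (1 - α/(p-1)) (2+σ-p)) / (c (2+σ)))^{1/(2+σ-p)}`. -/
def xiConst (p α σ l₁ c : ℝ) : ℝ :=
  ((p + l₁ * (1 - α / (p - 1)) * (2 + σ - p)) / (c * (2 + σ))) ^ (1 / (2 + σ - p))

end

/-! Write D = K' = t^{-α/2} k, so that b is measured against d^α D^p, and V = ξ φ(K(t)). On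
functions of t = d(x) the operator is P' - (N-1)/(1-t) P, with flux P = t^α |V'|^{p-2} V'.
Differentiating the equation for φ gives P' = ξ^{p-1} f(φ(K)) t^α D^p times the bracket 1 - R (α
K/(D t) + (p-1) K D'/D²), where R = (qF(φ(K)))^{(p-1)/p} / (f(φ(K)) K). The class 𝒦 forces K/(D t) →
l₁ and K D'/D² → 1 - l₁ (`MemClassK.exists_classKOn`), and Karamata's theorem forces R →
(2+σ-p)/((p-1)(2+σ)) (`tendsto_profile_ratio`). Hence the bracket tends to A = (p +
l₁(1-α/(p-1))(2+σ-p))/(2+σ). As f(ξφ)/f(φ) → ξ^{σ+1}, V is near the boundary a strict supersolution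
for the weight β d^α D^p when ξ^{p-1} A < β ξ^{σ+1}, and a strict subsolution when the inequality is
reversed. Equality at β = b_i defines ξ_i, so ξ > ξ₁ leaves room for some β < b₁, and 0 < ξ < ξ₂ for
some β > b₂.

Both u and V are infinite on the boundary, so the singularity of V is first moved: inwards for the
upper bound, where u is then finite, and outwards for the lower bound, where V is then finite. The
shift is T = (t^μ - s)^{1/μ}. It preserves the strict inequalities when (1-μ)(p-1) ≥ α and t^{1-μ} D
is nondecreasing; for μ = 1 this would ask for α ≤ 0 and D nondecreasing, whereas α < p-1 and l₁ < ∞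
always allow a small μ (`exists_shift_exponent`, `ClassKOn.exists_monotoneOn`, `shiftFluxDeriv_lt`,
`lt_shiftFluxDeriv`). A constant added to or subtracted from V settles the inner edge of the annulus
and is harmless because f is nondecreasing. Letting s → 0 gives u ≤ V + C, respectively V - C ≤ u
(`IsLargeSolution.exists_le_add`, `IsLargeSolution.exists_sub_le`), and division by φ(K(d)) → ∞
removes C.

The comparison itself (`weak_comparison`) tests the equation with a smooth increasing function of u
- W that vanishes where u ≤ W, and uses the monotonicity of Φ_p. Admissibility of this test function
is a chain rule for weak gradients of continuous functions, obtained by mollification. -/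

/-! ### Mollification by a normalized bump -/

section Mollification

variable {E : Type*} [NormedAddCommGroup E] [InnerProductSpace ℝ E] [FiniteDimensional ℝ E]
  [MeasurableSpace E] [BorelSpace E]

/-- The mollification of `g` by the normalized bump function `ρ`. -/
noncomputable def mollify (ρ : ContDiffBump (0 : E)) (g : E → ℝ) (x : E) : ℝ :=
  ∫ y, ρ.normed volume (x - y) * g y

theorem mollify_eq_convolution (ρ : ContDiffBump (0 : E)) (g : E → ℝ) :
    mollify ρ g =
      convolution (ρ.normed volume) g (ContinuousLinearMap.lsmul ℝ ℝ) volume := by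
  ext x
  rw [convolution_eq_swap]
  rfl

theorem contDiff_mollify (ρ : ContDiffBump (0 : E)) {g : E → ℝ}
    (hg : LocallyIntegrable g volume) : ContDiff ℝ 1 (mollify ρ g) := by
  rw [mollify_eq_convolution]
  exact HasCompactSupport.contDiff_convolution_left (n := 1) _ ρ.hasCompactSupport_normed
    ρ.contDiff_normed hg

theorem fderiv_mollify (ρ : ContDiffBump (0 : E)) {g : E → ℝ}
    (hg : LocallyIntegrable g volume) (x v : E) :
    fderiv ℝ (mollify ρ g) x v = ∫ y, fderiv ℝ (ρ.normed volume) (x - y) v * g y := by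
  rw [mollify_eq_convolution]
  have hc : ContDiff ℝ 1 (ρ.normed (volume : Measure E)) := ρ.contDiff_normed
  have h := HasCompactSupport.hasFDerivAt_convolution_left (ContinuousLinearMap.lsmul ℝ ℝ)
    (ρ.hasCompactSupport_normed (μ := (volume : Measure E))) hc hg x
  rw [h.fderiv, convolution_eq_swap, ContinuousLinearMap.integral_apply]
  · rfl
  · have := (HasCompactSupport.convolutionExists_left
      (ContinuousLinearMap.precompL E (ContinuousLinearMap.lsmul ℝ ℝ))
      (ρ.hasCompactSupport_normed (μ := (volume : Measure E)) |>.fderiv ℝ)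
      (hc.continuous_fderiv one_ne_zero) hg x).integrable_swap
    exact this

theorem integrable_normed_sub (ρ : ContDiffBump (0 : E)) (x : E) :
    Integrable (fun y => ρ.normed (volume : Measure E) (x - y)) :=
  (ρ.integrable_normed (μ := (volume : Measure E))).comp_sub_left x

theorem integral_normed_sub (ρ : ContDiffBump (0 : E)) (x : E) :
    ∫ y, ρ.normed (volume : Measure E) (x - y) = 1 := by
  rw [integral_sub_left_eq_self (fun y => ρ.normed (volume : Measure E) y) volume x]
  exact ρ.integral_normed

theorem abs_mollify_le (ρ : ContDiffBump (0 : E)) {g : E → ℝ} {M : ℝ}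
    (hM : ∀ y, |g y| ≤ M) (x : E) : |mollify ρ g x| ≤ M := by
  have h : ‖mollify ρ g x‖ ≤ ∫ y, ρ.normed (volume : Measure E) (x - y) * M := by
    refine norm_integral_le_of_norm_le ((integrable_normed_sub ρ x).mul_const M) ?_
    refine Eventually.of_forall fun y => ?_
    rw [norm_mul, Real.norm_of_nonneg (ρ.nonneg_normed _)]
    exact mul_le_mul_of_nonneg_left (hM y) (ρ.nonneg_normed _)
  rwa [integral_mul_const, integral_normed_sub, one_mul] at h

/-- The limit is taken jointly in the index and the point. In this form the statement can be
iterated: the functions mollified in the chain rule depend on n and already contain a mollification.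
-/
theorem tendsto_mollify {ρ : ℕ → ContDiffBump (0 : E)}
    (hρ : Tendsto (fun n => (ρ n).rOut) atTop (𝓝 0)) {g : ℕ → E → ℝ}
    (hg : ∀ n, AEStronglyMeasurable (g n) volume) {x : E} {z : ℝ}
    (h : Tendsto (fun q : ℕ × E => g q.1 q.2) (atTop ×ˢ 𝓝 x) (𝓝 z)) :
    Tendsto (fun q : ℕ × E => mollify (ρ q.1) (g q.1) q.2) (atTop ×ˢ 𝓝 x) (𝓝 z) := by
  simp only [mollify_eq_convolution]
  refine ContDiffBump.convolution_tendsto_right (φ := fun q : ℕ × E => ρ q.1)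
    (g := fun q : ℕ × E => g q.1) (k := fun q => q.2) (x₀ := x) (hρ.comp tendsto_fst)
    (Eventually.of_forall fun q => hg q.1) ?_ tendsto_snd
  exact h.comp ((tendsto_fst.comp tendsto_fst).prodMk tendsto_snd)

/-- Fubini together with the evenness of the bump. This lets the mollification be moved from a
merely integrable derivative to a bounded continuous factor. -/
theorem integral_mul_mollify (ρ : ContDiffBump (0 : E)) {ψ h : E → ℝ}
    (hψ : Integrable ψ) (hh : Integrable h) :
    ∫ x, ψ x * mollify ρ h x = ∫ y, h y * mollify ρ ψ y := by
  have hint : Integrable (Function.uncurry fun x y : E =>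
      ρ.normed volume (x - y) * (ψ x * h y)) (volume.prod volume) := by
    obtain ⟨c, hc⟩ := (ρ.hasCompactSupport_normed (μ := (volume : Measure E))).exists_bound_of_continuous
      ρ.continuous_normed
    refine (hψ.mul_prod hh).bdd_mul (c := c) ?_ (Eventually.of_forall fun q => hc _)
    exact (ρ.continuous_normed.comp (continuous_fst.sub continuous_snd)).aestronglyMeasurable
  have h1 := integral_integral_swap hint
  calc ∫ x, ψ x * mollify ρ h x
      = ∫ x, ∫ y, ρ.normed volume (x - y) * (ψ x * h y) := by
        refine integral_congr_ae (Eventually.of_forall fun x => ?_)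
        simp only [mollify]
        rw [← integral_const_mul]
        exact integral_congr_ae (Eventually.of_forall fun y => by ring)
    _ = ∫ y, ∫ x, ρ.normed volume (x - y) * (ψ x * h y) := h1
    _ = ∫ y, h y * mollify ρ ψ y := by
        refine integral_congr_ae (Eventually.of_forall fun y => ?_)
        simp only [mollify]
        rw [← integral_const_mul]
        refine integral_congr_ae (Eventually.of_forall fun x => ?_)
        simp only []
        rw [← ρ.normed_neg (y - x), neg_sub]
        ring

theorem integral_mul_fderiv_of_compact {f ζ : E → ℝ} (hf : ContDiff ℝ 1 f)
    (hζ : ContDiff ℝ 1 ζ) (hc : HasCompactSupport ζ) (v : E) :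
    ∫ x, f x * fderiv ℝ ζ x v = - ∫ x, fderiv ℝ f x v * ζ x := by
  have h1 : Continuous fun x => fderiv ℝ f x v :=
    (hf.continuous_fderiv one_ne_zero).clm_apply continuous_const
  have h2 : Continuous fun x => fderiv ℝ ζ x v :=
    (hζ.continuous_fderiv one_ne_zero).clm_apply continuous_const
  have h3 : HasCompactSupport fun x => fderiv ℝ ζ x v := hc.fderiv_apply ℝ v
  refine integral_mul_fderiv_eq_neg_fderiv_mul_of_integrable ?_ ?_ ?_
    (fun x _ => hf.differentiable one_ne_zero x) (fun x _ => hζ.differentiable one_ne_zero x)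
  · exact (h1.mul hζ.continuous).integrable_of_hasCompactSupport hc.mul_left
  · exact (hf.continuous.mul h2).integrable_of_hasCompactSupport h3.mul_left
  · exact (hf.continuous.mul hζ.continuous).integrable_of_hasCompactSupport hc.mul_left

end Mollification

/-! ### Chain rule by approximation -/

section ChainRule

variable {E : Type*} [NormedAddCommGroup E] [InnerProductSpace ℝ E] [FiniteDimensional ℝ E]
  [MeasurableSpace E] [BorelSpace E]

/-- The integrated chain rule, for a function `g` whose mollifications have the mollifications of
`h` as directional derivatives on the support of the test function `ζ`. -/
theorem chain_rule_of_mollify {g h ζ : E → ℝ} {F : ℝ → ℝ} {M r : ℝ} {v : E}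
    (hF : ContDiff ℝ 1 F) (hζ : ContDiff ℝ 1 ζ) (hc : HasCompactSupport ζ)
    (hgM : ∀ x, |g x| ≤ M) (hgi : Integrable g)
    (hgc : ∀ x ∈ tsupport ζ, ContinuousAt g x) (hh : Integrable h) (hr : 0 < r)
    (hm : ∀ ρ : ContDiffBump (0 : E), ρ.rOut < r → ∀ x ∈ tsupport ζ,
      ∫ y, fderiv ℝ (ρ.normed volume) (x - y) v * g y = mollify ρ h x) :
    ∫ x, F (g x) * fderiv ℝ ζ x v = - ∫ x, h x * (deriv F (g x) * ζ x) := by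
  -- All radii stay below r, so `hm` applies to every member, and they tend to 0.
  let ρ : ℕ → ContDiffBump (0 : E) := fun n =>
    ⟨r / (n + 3), r / (n + 2), by positivity, by gcongr; norm_num⟩
  have hρr : ∀ n, (ρ n).rOut < r := fun n => by
    change r / (n + 2) < r
    rw [div_lt_iff₀ (by positivity)]
    nlinarith [(Nat.cast_nonneg n : (0 : ℝ) ≤ n)]
  have hρ : Tendsto (fun n => (ρ n).rOut) atTop (𝓝 0) := by
    change Tendsto (fun n : ℕ => r / ((n : ℝ) + 2)) atTop (𝓝 0)
    exact Tendsto.div_atTop tendsto_const_nhds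
      (tendsto_atTop_add_const_right _ _ tendsto_natCast_atTop_atTop)
  let gn : ℕ → E → ℝ := fun n => mollify (ρ n) g
  let ψ : ℕ → E → ℝ := fun n x => deriv F (gn n x) * ζ x
  have hgn : ∀ n, ContDiff ℝ 1 (gn n) := fun n => contDiff_mollify _ hgi.locallyIntegrable
  have hF' : Continuous (deriv F) := hF.continuous_deriv le_rfl
  have hψ : ∀ n, Continuous (ψ n) := fun n =>
    (hF'.comp (hgn n).continuous).mul hζ.continuous
  have hψc : ∀ n, HasCompactSupport (ψ n) := fun n => hc.mul_left
  have hψi : ∀ n, Integrable (ψ n) := fun n =>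
    (hψ n).integrable_of_hasCompactSupport (hψc n)
  -- The classical chain rule for the smooth g_n, with the mollification then taken off h. No
  -- convergence of mollifications of h is needed afterwards.
  have hid : ∀ n, ∫ x, F (gn n x) * fderiv ℝ ζ x v = - ∫ x, h x * mollify (ρ n) (ψ n) x := by
    intro n
    have h1 := integral_mul_fderiv_of_compact (hF.comp (hgn n)) hζ hc v
    rw [← integral_mul_mollify (ρ n) (hψi n) hh]
    refine h1.trans (congrArg Neg.neg (integral_congr_ae (Eventually.of_forall fun x => ?_)))
    by_cases hx : x ∈ tsupport ζ
    · simp only [ψ]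
      rw [← hm (ρ n) (hρr n) x hx, ← fderiv_mollify _ hgi.locallyIntegrable]
      have : HasFDerivAt (F ∘ gn n) (deriv F (gn n x) • fderiv ℝ (gn n) x) x :=
        HasDerivAt.comp_hasFDerivAt x
          (hF.differentiable one_ne_zero _).hasDerivAt
          ((hgn n).differentiable one_ne_zero x).hasFDerivAt
      rw [this.fderiv]
      simp only [smul_apply, smul_eq_mul, gn]
      ring
    · simp [ψ, image_eq_zero_of_notMem_tsupport hx]
  have hjoint : ∀ x ∈ tsupport ζ,
      Tendsto (fun q : ℕ × E => gn q.1 q.2) (atTop ×ˢ 𝓝 x) (𝓝 (g x)) := by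
    intro x hx
    exact tendsto_mollify hρ (g := fun _ => g) (fun _ => hgi.aestronglyMeasurable)
      (show Tendsto (fun q : ℕ × E => g q.2) _ _ from (hgc x hx).tendsto.comp tendsto_snd)
  have hpt : ∀ x : E, Tendsto (fun n : ℕ => (n, x)) atTop (atTop ×ˢ 𝓝 x) := fun x =>
    tendsto_id.prodMk (tendsto_const_nhds (x := x))
  -- Joint convergence is what allows ψ_n to be mollified once more in the limit.
  have hψj : ∀ x, Tendsto (fun q : ℕ × E => ψ q.1 q.2) (atTop ×ˢ 𝓝 x)
      (𝓝 (deriv F (g x) * ζ x)) := by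
    intro x
    by_cases hx : x ∈ tsupport ζ
    · exact ((hF'.tendsto _).comp (hjoint x hx)).mul
        ((hζ.continuous.tendsto x).comp tendsto_snd)
    · rw [image_eq_zero_of_notMem_tsupport hx, mul_zero]
      refine tendsto_const_nhds.congr' ?_
      have : ∀ᶠ y in 𝓝 x, y ∈ (tsupport ζ)ᶜ :=
        (isClosed_tsupport ζ).isOpen_compl.mem_nhds hx
      filter_upwards [tendsto_snd.eventually this] with q hq
      simp [ψ, image_eq_zero_of_notMem_tsupport hq]
  obtain ⟨D, hD⟩ : ∃ D, ∀ s ∈ Icc (-M) M, ‖deriv F s‖ ≤ D :=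
    isCompact_Icc.exists_bound_of_continuousOn hF'.continuousOn
  obtain ⟨D₀, hD₀⟩ : ∃ D, ∀ s ∈ Icc (-M) M, ‖F s‖ ≤ D :=
    isCompact_Icc.exists_bound_of_continuousOn hF.continuous.continuousOn
  obtain ⟨Z, hZ⟩ := hc.exists_bound_of_continuous hζ.continuous
  have hgnM : ∀ n x, gn n x ∈ Icc (-M) M := fun n x => abs_le.1 (abs_mollify_le _ hgM x)
  have hψM : ∀ n x, |ψ n x| ≤ D * Z := fun n x => by
    simp only [ψ, abs_mul]
    exact mul_le_mul (hD _ (hgnM n x)) (hZ x) (abs_nonneg _)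
      ((norm_nonneg _).trans (hD _ (hgnM n x)))
  have hζ' : Continuous fun x => fderiv ℝ ζ x v :=
    (hζ.continuous_fderiv one_ne_zero).clm_apply continuous_const
  have hζ'i : Integrable fun x => fderiv ℝ ζ x v :=
    hζ'.integrable_of_hasCompactSupport (hc.fderiv_apply ℝ v)
  have hl : Tendsto (fun n => ∫ x, F (gn n x) * fderiv ℝ ζ x v) atTop
      (𝓝 (∫ x, F (g x) * fderiv ℝ ζ x v)) := by
    refine tendsto_integral_of_dominated_convergence (fun x => D₀ * ‖fderiv ℝ ζ x v‖)
      (fun n => ((hF.continuous.comp (hgn n).continuous).mul hζ').aestronglyMeasurable)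
      (hζ'i.norm.const_mul D₀) (fun n => Eventually.of_forall fun x => ?_)
      (Eventually.of_forall fun x => ?_)
    · rw [norm_mul]
      exact mul_le_mul_of_nonneg_right (hD₀ _ (hgnM n x)) (norm_nonneg _)
    · by_cases hx : x ∈ tsupport ζ
      · exact (((hF.continuous.tendsto _).comp (hjoint x hx)).comp (hpt x)).mul_const _
      · have : fderiv ℝ ζ x = 0 := image_eq_zero_of_notMem_tsupport
          (fun h => hx (tsupport_fderiv_subset ℝ h))
        simp [this]
  -- The mollified ψ_n are bounded by D * Z uniformly in n, so a multiple of ‖h‖ dominates.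
  have hr' : Tendsto (fun n => ∫ x, h x * mollify (ρ n) (ψ n) x) atTop
      (𝓝 (∫ x, h x * (deriv F (g x) * ζ x))) := by
    refine tendsto_integral_of_dominated_convergence (fun x => ‖h x‖ * (D * Z))
      (fun n => hh.aestronglyMeasurable.mul
        (contDiff_mollify _ (hψi n).locallyIntegrable).continuous.aestronglyMeasurable)
      (hh.norm.mul_const _) (fun n => Eventually.of_forall fun x => ?_)
      (Eventually.of_forall fun x => ?_)
    · rw [norm_mul]
      exact mul_le_mul_of_nonneg_left (abs_mollify_le _ (hψM n) x) (norm_nonneg _)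
    · exact ((tendsto_mollify hρ (fun n => (hψ n).aestronglyMeasurable)
        (hψj x)).comp (hpt x)).const_mul _
  exact tendsto_nhds_unique hl ((hr'.neg).congr fun n => (hid n).symm)

end ChainRule

/-! ### Calculus of weak gradients -/

section WeakGradient

theorem integrable_mul_of_tsupport_subset {E : Type*} [NormedAddCommGroup E]
    [MeasurableSpace E] [BorelSpace E] {μ : Measure E} [IsFiniteMeasureOnCompacts μ]
    {U : Set E} {a ζ : E → ℝ} (ha : ContinuousOn a U) (hζ : Continuous ζ)
    (hc : HasCompactSupport ζ) (hs : tsupport ζ ⊆ U) : Integrable (fun x => a x * ζ x) μ := by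
  have h1 : IntegrableOn (fun x => a x * ζ x) (tsupport ζ) μ :=
    ((ha.mono hs).mul hζ.continuousOn).integrableOn_compact hc
  refine (integrableOn_iff_integrable_of_support_subset fun x hx => ?_).1 h1
  exact subset_tsupport _ (right_ne_zero_of_mul hx)

theorem setIntegral_mul_of_tsupport_subset {E : Type*} [NormedAddCommGroup E]
    [MeasurableSpace E] {μ : Measure E} {U : Set E} {a ζ : E → ℝ} (hs : tsupport ζ ⊆ U) :
    ∫ x in U, a x * ζ x ∂μ = ∫ x, a x * ζ x ∂μ :=
  setIntegral_eq_integral_of_forall_compl_eq_zero fun x hx => by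
    rw [image_eq_zero_of_notMem_tsupport fun h => hx (hs h), mul_zero]

variable {N : ℕ}

theorem HasWeakGradientOn.mono {U A : Set (EuclideanSpace ℝ (Fin N))}
    {u : EuclideanSpace ℝ (Fin N) → ℝ}
    {G : EuclideanSpace ℝ (Fin N) → EuclideanSpace ℝ (Fin N)}
    (h : HasWeakGradientOn U u G) (hA : A ⊆ U) : HasWeakGradientOn A u G where
  locInt_fun := h.locInt_fun.mono_set hA
  locInt_grad := h.locInt_grad.mono_set hA
  parts η hη hc hs v := by
    have h1 := h.parts η hη hc (hs.trans hA) v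
    have hs' := (tsupport_fderiv_apply_subset ℝ v (f := η)).trans hs
    rwa [setIntegral_mul_of_tsupport_subset (hs.trans hA),
      setIntegral_mul_of_tsupport_subset (ζ := fun x => fderiv ℝ η x v) (hs'.trans hA),
      ← setIntegral_mul_of_tsupport_subset hs,
      ← setIntegral_mul_of_tsupport_subset (ζ := fun x => fderiv ℝ η x v) hs'] at h1

theorem hasWeakGradientOn_of_hasGradientAt {A : Set (EuclideanSpace ℝ (Fin N))} (hA : IsOpen A)
    {W : EuclideanSpace ℝ (Fin N) → ℝ}
    {X : EuclideanSpace ℝ (Fin N) → EuclideanSpace ℝ (Fin N)}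
    (hW : ∀ x ∈ A, HasGradientAt W (X x) x) (hX : ContinuousOn X A) :
    HasWeakGradientOn A W X where
  locInt_fun := ContinuousOn.locallyIntegrableOn
    (fun x hx => (hW x hx).continuousAt.continuousWithinAt) hA.measurableSet
  locInt_grad := hX.locallyIntegrableOn hA.measurableSet
  parts η hη hc hs v := by
    have hWc : ContinuousOn W A := fun x hx => (hW x hx).continuousAt.continuousWithinAt
    have hη' : Continuous fun x => fderiv ℝ η x v :=
      (hη.continuous_fderiv (by simp)).clm_apply continuous_const
    have hs' : tsupport (fun x => fderiv ℝ η x v) ⊆ A :=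
      (tsupport_fderiv_apply_subset ℝ v).trans hs
    have hXv : ∀ x ∈ A, fderiv ℝ W x v = inner ℝ (X x) v := fun x hx => by
      rw [(hW x hx).hasFDerivAt.fderiv]
      rfl
    have h1 : Integrable fun x => inner ℝ (X x) v * η x :=
      integrable_mul_of_tsupport_subset (hX.inner continuousOn_const) hη.continuous hc hs
    have heq : ∀ x, fderiv ℝ W x v * η x = inner ℝ (X x) v * η x := fun x => by
      by_cases hx : x ∈ A
      · rw [hXv x hx]
      · rw [image_eq_zero_of_notMem_tsupport fun h => hx (hs h), mul_zero, mul_zero]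
    rw [setIntegral_mul_of_tsupport_subset hs,
      setIntegral_mul_of_tsupport_subset (ζ := fun x => fderiv ℝ η x v) hs']
    simp only [← heq] at h1 ⊢
    refine integral_mul_fderiv_eq_neg_fderiv_mul_of_integrable h1 ?_ ?_
      (fun x hx => (hW x (hs hx)).differentiableAt)
      (fun x _ => hη.differentiable (by simp) x)
    · exact integrable_mul_of_tsupport_subset hWc hη' (hc.fderiv_apply ℝ v) hs'
    · exact integrable_mul_of_tsupport_subset hWc hη.continuous hc hs

theorem HasWeakGradientOn.sub {A : Set (EuclideanSpace ℝ (Fin N))} (hA : IsOpen A)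
    {u w : EuclideanSpace ℝ (Fin N) → ℝ}
    {G X : EuclideanSpace ℝ (Fin N) → EuclideanSpace ℝ (Fin N)}
    (hu : HasWeakGradientOn A u G) (hw : HasWeakGradientOn A w X) :
    HasWeakGradientOn A (fun x => u x - w x) (fun x => G x - X x) where
  locInt_fun := hu.locInt_fun.sub hw.locInt_fun
  locInt_grad := hu.locInt_grad.sub hw.locInt_grad
  parts η hη hc hs v := by
    have hη' : Continuous fun x => fderiv ℝ η x v :=
      (hη.continuous_fderiv (by simp)).clm_apply continuous_const
    have hs' : tsupport (fun x => fderiv ℝ η x v) ⊆ A :=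
      (tsupport_fderiv_apply_subset ℝ v).trans hs
    have key : ∀ {a ζ : EuclideanSpace ℝ (Fin N) → ℝ}, LocallyIntegrableOn a A →
        Continuous ζ → HasCompactSupport ζ → tsupport ζ ⊆ A →
        IntegrableOn (fun x => a x * ζ x) A := by
      intro a ζ ha hζ hcζ hsζ
      refine IntegrableOn.of_forall_sdiff_eq_zero (s := tsupport ζ) ?_ hA.measurableSet ?_
      · exact (ha.integrableOn_compact_subset hsζ hcζ).mul_continuousOn hζ.continuousOn hcζ
      · intro x hx
        rw [image_eq_zero_of_notMem_tsupport hx.2, mul_zero]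
    have hGi : ∀ {Y : EuclideanSpace ℝ (Fin N) → EuclideanSpace ℝ (Fin N)},
        LocallyIntegrableOn Y A → LocallyIntegrableOn (fun x => inner ℝ (Y x) v) A := by
      intro Y hY x hx
      obtain ⟨t, ht, hYt⟩ := hY x hx
      exact ⟨t, ht, Integrable.inner_const hYt v⟩
    have e1 := hu.parts η hη hc hs v
    have e2 := hw.parts η hη hc hs v
    simp only [sub_mul, inner_sub_left]
    rw [integral_sub (key hu.locInt_fun hη' (hc.fderiv_apply ℝ v) hs')
      (key hw.locInt_fun hη' (hc.fderiv_apply ℝ v) hs'),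
      integral_sub (key (hGi hu.locInt_grad) hη.continuous hc hs)
      (key (hGi hw.locInt_grad) hη.continuous hc hs), e1, e2]
    ring

/-- The chain rule for weak gradients, tested against compactly supported `C¹` functions. -/
theorem HasWeakGradientOn.chain_rule {A : Set (EuclideanSpace ℝ (Fin N))} (hA : IsOpen A)
    {g : EuclideanSpace ℝ (Fin N) → ℝ}
    {G : EuclideanSpace ℝ (Fin N) → EuclideanSpace ℝ (Fin N)}
    (hg : ContinuousOn g A) (hG : HasWeakGradientOn A g G) {F : ℝ → ℝ} (hF : ContDiff ℝ 1 F)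
    {ζ : EuclideanSpace ℝ (Fin N) → ℝ} (hζ : ContDiff ℝ 1 ζ) (hc : HasCompactSupport ζ)
    (hs : tsupport ζ ⊆ A) (v : EuclideanSpace ℝ (Fin N)) :
    ∫ x in A, F (g x) * fderiv ℝ ζ x v =
      - ∫ x in A, inner ℝ (G x) v * (deriv F (g x) * ζ x) := by
  -- A margin r around the support of ζ: kernels of radius below r centred there only see K, so
  -- cutting g and its derivative off outside K changes nothing.
  obtain ⟨r, hr, hrA⟩ := IsCompact.exists_cthickening_subset_open hc hA hs
  set K := Metric.cthickening r (tsupport ζ) with hK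
  have hKc : IsCompact K := IsCompact.cthickening hc
  have hζK : tsupport ζ ⊆ K := Metric.self_subset_cthickening _
  have hball : ∀ x ∈ tsupport ζ, Metric.closedBall x r ⊆ K := fun x hx =>
    Metric.closedBall_subset_cthickening hx r
  obtain ⟨M, hM⟩ := hKc.exists_bound_of_continuousOn (hg.mono hrA)
  have hmK : MeasurableSet K := hKc.measurableSet
  have hgi : Integrable (K.indicator g) :=
    (integrable_indicator_iff hmK).2 ((hg.mono hrA).integrableOn_compact hKc)
  have hhi : Integrable (K.indicator fun x => inner ℝ (G x) v) :=
    (integrable_indicator_iff hmK).2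
      (Integrable.inner_const (hG.locInt_grad.integrableOn_compact_subset hrA hKc) v)
  have hmain := chain_rule_of_mollify (g := K.indicator g)
    (h := K.indicator fun x => inner ℝ (G x) v) (M := max M 0) (r := r) (v := v) hF hζ hc
    ?_ hgi ?_ hhi hr ?_
  · rw [setIntegral_eq_integral_of_forall_compl_eq_zero,
      setIntegral_eq_integral_of_forall_compl_eq_zero]
    · refine Eq.trans ?_ (hmain.trans (congrArg Neg.neg ?_))
      · refine integral_congr_ae (Eventually.of_forall fun x => ?_)
        by_cases hx : x ∈ tsupport ζ
        · simp [indicator_of_mem (hζK hx)]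
        · have : fderiv ℝ ζ x = 0 := image_eq_zero_of_notMem_tsupport
            (fun h => hx (tsupport_fderiv_subset ℝ h))
          simp [this]
      · refine integral_congr_ae (Eventually.of_forall fun x => ?_)
        by_cases hx : x ∈ tsupport ζ
        · simp [indicator_of_mem (hζK hx)]
        · simp [image_eq_zero_of_notMem_tsupport hx]
    · intro x hx
      simp [image_eq_zero_of_notMem_tsupport fun h => hx (hs h)]
    · intro x hx
      have : fderiv ℝ ζ x = 0 := image_eq_zero_of_notMem_tsupport
        (fun h => hx (hs (tsupport_fderiv_subset ℝ h)))
      simp [this]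
  · intro x
    by_cases hx : x ∈ K
    · rw [indicator_of_mem hx]
      exact (hM x hx).trans (le_max_left _ _)
    · simp [indicator_of_notMem hx]
  · intro x hx
    have hxK : K ∈ 𝓝 x := mem_of_superset (Metric.closedBall_mem_nhds x hr) (hball x hx)
    refine ((hg.mono hrA).continuousAt hxK).congr ?_
    filter_upwards [hxK] with y hy using (indicator_of_mem hy g).symm
  -- The translated kernel y ↦ ρ(x - y) is itself a test function in A. Integration by parts against
  -- it is the required identity; the sign cancels against the inner derivative -1.
  · intro ρ hρ x hx
    set η : EuclideanSpace ℝ (Fin N) → ℝ := fun y => ρ.normed volume (x - y) with hη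
    have hρs : ContDiff ℝ ∞ (ρ.normed (volume : Measure (EuclideanSpace ℝ (Fin N)))) :=
      ρ.contDiff_normed
    have hηs : ContDiff ℝ ∞ η := hρs.comp (contDiff_const.sub contDiff_id)
    have hηz : ∀ y ∉ Metric.closedBall x ρ.rOut, η y = 0 := fun y hy => by
      have : x - y ∉ Function.support
          (ρ.normed (volume : Measure (EuclideanSpace ℝ (Fin N)))) := by
        rw [ρ.support_normed_eq, mem_ball_zero_iff, ← dist_eq_norm, dist_comm]
        intro h
        exact hy (Metric.ball_subset_closedBall h)
      simpa using this
    have hηt : tsupport η ⊆ Metric.closedBall x ρ.rOut :=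
      closure_minimal (fun y hy => by
        by_contra h
        exact hy (hηz y h)) Metric.isClosed_closedBall
    have hηc : HasCompactSupport η := (isCompact_closedBall x ρ.rOut).of_isClosed_subset
      (isClosed_tsupport _) hηt
    have hηK : tsupport η ⊆ K :=
      hηt.trans ((Metric.closedBall_subset_closedBall hρ.le).trans (hball x hx))
    have hη' : ∀ y, fderiv ℝ η y v = - fderiv ℝ (ρ.normed volume) (x - y) v := fun y => by
      have h1 : HasFDerivAt (fun y : EuclideanSpace ℝ (Fin N) => x - y)
          (-ContinuousLinearMap.id ℝ _) y := (hasFDerivAt_id y).const_sub x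
      have h2 := ((hρs.differentiable (by simp) (x - y)).hasFDerivAt).comp y h1
      have h3 : HasFDerivAt η _ y := h2
      rw [h3.fderiv]
      simp
    have hp := hG.parts η hηs hηc (hηK.trans hrA) v
    rw [setIntegral_mul_of_tsupport_subset (hηK.trans hrA),
      setIntegral_mul_of_tsupport_subset (ζ := fun x => fderiv ℝ η x v)
        ((tsupport_fderiv_apply_subset ℝ v).trans (hηK.trans hrA))] at hp
    calc _ = - ∫ y, g y * fderiv ℝ η y v := by
          rw [← integral_neg]
          refine integral_congr_ae (Eventually.of_forall fun y => ?_)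
          simp only []
          by_cases hy : y ∈ tsupport η
          · rw [indicator_of_mem (hηK hy), hη']
            ring
          · have h0 : fderiv ℝ η y = 0 := image_eq_zero_of_notMem_tsupport
              (fun h => hy (tsupport_fderiv_subset ℝ h))
            have h1 := hη' y
            rw [h0, zero_apply, eq_comm, neg_eq_zero] at h1
            rw [h0, h1]
            simp
      _ = _ := by
          rw [hp, neg_neg]
          refine integral_congr_ae (Eventually.of_forall fun y => ?_)
          simp only []
          by_cases hy : y ∈ tsupport η
          · rw [indicator_of_mem (hηK hy), mul_comm]
          · change _ = η y * _
            rw [image_eq_zero_of_notMem_tsupport hy, mul_zero, zero_mul]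

end WeakGradient

/-! ### Admissible test functions F ∘ g -/

section TestFunctions

variable {N : ℕ}

/-- The chain rule for weak gradients when `F ∘ g` lives on a compact set: the test function need
not have compact support. -/
theorem HasWeakGradientOn.chain_rule_of_compact {A K : Set (EuclideanSpace ℝ (Fin N))}
    (hA : IsOpen A) (hK : IsCompact K) (hKA : K ⊆ A) {g : EuclideanSpace ℝ (Fin N) → ℝ}
    {G : EuclideanSpace ℝ (Fin N) → EuclideanSpace ℝ (Fin N)}
    (hg : ContinuousOn g A) (hG : HasWeakGradientOn A g G) {F : ℝ → ℝ} (hF : ContDiff ℝ 1 F)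
    (h0 : ∀ x ∈ A, x ∉ K → F (g x) = 0 ∧ deriv F (g x) = 0)
    {ζ : EuclideanSpace ℝ (Fin N) → ℝ} (hζ : ContDiffOn ℝ 1 ζ A)
    (v : EuclideanSpace ℝ (Fin N)) :
    ∫ x in A, F (g x) * fderiv ℝ ζ x v =
      - ∫ x in A, inner ℝ (G x) v * (deriv F (g x) * ζ x) := by
  obtain ⟨r, hr, hrA⟩ := hK.exists_cthickening_subset_open hA hKA
  set T := Metric.cthickening r K with hT
  have hTc : IsCompact T := hK.cthickening
  have hKT : K ⊆ interior T := (Metric.self_subset_thickening hr K).trans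
    (interior_maximal (Metric.thickening_subset_cthickening r K) Metric.isOpen_thickening)
  -- A cutoff equal to 1 near K: χζ has compact support in A and agrees with ζ, derivative included,
  -- on K, while both integrands vanish off K.
  obtain ⟨χ, hχ1, hχ0, -⟩ := exists_contMDiffMap_one_nhds_of_subset_interior
    (modelWithCornersSelf ℝ (EuclideanSpace ℝ (Fin N))) (n := 1) hK.isClosed hKT
  have hχs : ContDiff ℝ 1 χ := χ.contMDiff.contDiff
  have hχT : tsupport χ ⊆ T := closure_minimal (fun x hx => by
    by_contra h
    exact hx (hχ0 x h)) hTc.isClosed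
  have hp : tsupport (fun x => χ x * ζ x) ⊆ T := (tsupport_mul_subset_left).trans hχT
  have hpc : HasCompactSupport fun x => χ x * ζ x :=
    hTc.of_isClosed_subset (isClosed_tsupport _) hp
  have hps : ContDiff ℝ 1 fun x => χ x * ζ x := by
    rw [contDiff_iff_contDiffAt]
    intro x
    by_cases hx : x ∈ A
    · exact hχs.contDiffAt.mul ((hζ x hx).contDiffAt (hA.mem_nhds hx))
    · have : (fun x => χ x * ζ x) =ᶠ[𝓝 x] fun _ => 0 := by
        filter_upwards [hTc.isClosed.isOpen_compl.mem_nhds fun h => hx (hrA h)] with y hy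
        rw [hχ0 y hy, zero_mul]
      exact contDiffAt_const.congr_of_eventuallyEq this
  have hloc : ∀ x ∈ K, (fun x => χ x * ζ x) =ᶠ[𝓝 x] ζ := fun x hx => by
    filter_upwards [hχ1.filter_mono (nhds_le_nhdsSet hx)] with y hy
    rw [hy, one_mul]
  have hmain := hG.chain_rule hA hg hF hps hpc (hp.trans hrA) v
  refine Eq.trans ?_ (hmain.trans (congrArg Neg.neg ?_))
  · refine setIntegral_congr_fun hA.measurableSet fun x hx => ?_
    by_cases hxK : x ∈ K
    · simp only [(hloc x hxK).fderiv_eq]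
    · simp only [(h0 x hx hxK).1, zero_mul]
  · refine setIntegral_congr_fun hA.measurableSet fun x hx => ?_
    by_cases hxK : x ∈ K
    · simp only [(hloc x hxK).eq_of_nhds]
    · simp only [(h0 x hx hxK).2, zero_mul]

/-- Because F ∘ g and F' ∘ g vanish on A outside K, extension by zero from A is the same as
extension by zero from the compact K. This yields continuity across the edge of A and compact
support; boundedness of F' ∘ g on K yields p-integrability of the gradient. -/
theorem memW1pCompact_indicator_comp {p : ℝ} (hp : 1 ≤ p)
    {U A K : Set (EuclideanSpace ℝ (Fin N))}
    (hA : IsOpen A) (hAU : A ⊆ U) (hK : IsCompact K) (hKA : K ⊆ A)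
    {g : EuclideanSpace ℝ (Fin N) → ℝ}
    {G : EuclideanSpace ℝ (Fin N) → EuclideanSpace ℝ (Fin N)}
    (hg : ContinuousOn g A) (hG : HasWeakGradientOn A g G)
    (hGp : MemLp G (ENNReal.ofReal p) (volume.restrict K)) {F : ℝ → ℝ} (hF : ContDiff ℝ 1 F)
    (h0 : ∀ x ∈ A, x ∉ K → F (g x) = 0 ∧ deriv F (g x) = 0) :
    MemW1pCompact p U (A.indicator fun x => F (g x))
      (A.indicator fun x => deriv F (g x) • G x) := by
  have hF' : Continuous (deriv F) := hF.continuous_deriv le_rfl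
  have hind1 : (A.indicator fun x => F (g x)) = K.indicator fun x => F (g x) := by
    ext x
    by_cases hx : x ∈ K
    · rw [indicator_of_mem hx, indicator_of_mem (hKA hx)]
    · rw [indicator_of_notMem hx]
      by_cases hxA : x ∈ A
      · rw [indicator_of_mem hxA, (h0 x hxA hx).1]
      · rw [indicator_of_notMem hxA]
  have hind2 : (A.indicator fun x => deriv F (g x) • G x) =
      K.indicator fun x => deriv F (g x) • G x := by
    ext1 x
    by_cases hx : x ∈ K
    · rw [indicator_of_mem hx, indicator_of_mem (hKA hx)]
    · rw [indicator_of_notMem hx]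
      by_cases hxA : x ∈ A
      · rw [indicator_of_mem hxA, (h0 x hxA hx).2, zero_smul]
      · rw [indicator_of_notMem hxA]
  have hsupp : tsupport (A.indicator fun x => F (g x)) ⊆ K := by
    rw [hind1]
    exact closure_minimal support_indicator_subset hK.isClosed
  have hcs : HasCompactSupport (A.indicator fun x => F (g x)) :=
    hK.of_isClosed_subset (isClosed_tsupport _) hsupp
  have hcont : Continuous (A.indicator fun x => F (g x)) := by
    rw [continuous_iff_continuousAt]
    intro x
    by_cases hx : x ∈ A
    · have : ContinuousAt (fun x => F (g x)) x :=
        hF.continuous.continuousAt.comp (hg.continuousAt (hA.mem_nhds hx))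
      refine this.congr ?_
      filter_upwards [hA.mem_nhds hx] with y hy using (indicator_of_mem hy (fun x => F (g x))).symm
    · rw [hind1]
      refine (continuousAt_const (y := (0 : ℝ))).congr ?_
      filter_upwards [hK.isClosed.isOpen_compl.mem_nhds fun h : x ∈ K => hx (hKA h)] with y hy
      exact (indicator_of_notMem hy (fun x => F (g x))).symm
  have hHp : MemLp (A.indicator fun x => deriv F (g x) • G x) (ENNReal.ofReal p) volume := by
    rw [hind2, memLp_indicator_iff_restrict hK.measurableSet]
    obtain ⟨D, hD⟩ := hK.exists_bound_of_continuousOn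
      (hF'.comp_continuousOn (hg.mono hKA))
    refine hGp.of_le_mul (c := D) ?_ ?_
    · exact ((hF'.comp_continuousOn (hg.mono hKA)).aestronglyMeasurable
        hK.measurableSet).smul hGp.aestronglyMeasurable
    · filter_upwards [ae_restrict_mem hK.measurableSet] with x hx
      rw [norm_smul]
      exact mul_le_mul_of_nonneg_right (hD x hx) (norm_nonneg _)
  have h1p : (1 : ℝ≥0∞) ≤ ENNReal.ofReal p := by
    rw [← ENNReal.ofReal_one]
    exact ENNReal.ofReal_le_ofReal hp
  refine ⟨⟨hcont.locallyIntegrable.locallyIntegrableOn _,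
    (hHp.locallyIntegrable h1p).locallyIntegrableOn _, fun ζ hζ hζc hζs v => ?_⟩, hcs,
    hsupp.trans (hKA.trans hAU), ?_, hHp.restrict U⟩
  · have hmain := hG.chain_rule_of_compact hA hK hKA hg hF h0 (ζ := ζ)
      (hζ.of_le (by simp)).contDiffOn v
    have e1 : ∀ x, (A.indicator (fun x => F (g x)) x) * fderiv ℝ ζ x v =
        A.indicator (fun x => F (g x) * fderiv ℝ ζ x v) x := fun x => by
      by_cases hx : x ∈ A <;> simp [hx]
    have e2 : ∀ x, inner ℝ (A.indicator (fun x => deriv F (g x) • G x) x) v * ζ x =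
        A.indicator (fun x => inner ℝ (G x) v * (deriv F (g x) * ζ x)) x := fun x => by
      by_cases hx : x ∈ A
      · simp only [indicator_of_mem hx, inner_smul_left]
        simp
        ring
      · simp [hx]
    simp only [e1, e2]
    rw [setIntegral_indicator hA.measurableSet, setIntegral_indicator hA.measurableSet,
      inter_eq_self_of_subset_right hAU]
    exact hmain
  · exact (hcont.memLp_of_hasCompactSupport hcs).restrict U

end TestFunctions

/-! ### Weak comparison principle -/

section WeakComparison

variable {N : ℕ}

theorem norm_PhiP {p : ℝ} (hp : 1 < p) (z : EuclideanSpace ℝ (Fin N)) :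
    ‖PhiP p z‖ = ‖z‖ ^ (p - 1) := by
  rw [PhiP, norm_smul, Real.norm_of_nonneg (rpow_nonneg (norm_nonneg _) _)]
  rcases (norm_nonneg z).eq_or_lt with h | h
  · rw [← h, mul_zero, zero_rpow (by linarith)]
  · rw [← rpow_add_one h.ne']
    congr 1
    ring

/-- The inner product equals (|a|^{p-1} - |b|^{p-1})(|a| - |b|) + (|a|^{p-2} + |b|^{p-2})(|a||b| -
⟨a,b⟩). The first term is nonnegative by monotonicity of the power, the second by Cauchy–Schwarz. -/
theorem inner_PhiP_sub_nonneg {p : ℝ} (hp : 1 < p) (a b : EuclideanSpace ℝ (Fin N)) :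
    0 ≤ inner ℝ (PhiP p a - PhiP p b) (a - b) := by
  have h1 : ∀ z : EuclideanSpace ℝ (Fin N), ‖z‖ ^ (p - 2) * ‖z‖ = ‖z‖ ^ (p - 1) := fun z => by
    rw [← norm_PhiP hp, PhiP, norm_smul, Real.norm_of_nonneg (rpow_nonneg (norm_nonneg _) _)]
  have h2 : 0 ≤ (‖a‖ ^ (p - 1) - ‖b‖ ^ (p - 1)) * (‖a‖ - ‖b‖) := by
    rcases le_total ‖a‖ ‖b‖ with h | h
    · exact mul_nonneg_of_nonpos_of_nonpos
        (sub_nonpos.2 (rpow_le_rpow (norm_nonneg _) h (by linarith))) (sub_nonpos.2 h)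
    · exact mul_nonneg
        (sub_nonneg.2 (rpow_le_rpow (norm_nonneg _) h (by linarith))) (sub_nonneg.2 h)
  have h3 := real_inner_le_norm a b
  have h4 : 0 ≤ ‖a‖ ^ (p - 2) + ‖b‖ ^ (p - 2) :=
    add_nonneg (rpow_nonneg (norm_nonneg _) _) (rpow_nonneg (norm_nonneg _) _)
  rw [← h1, ← h1] at h2
  simp only [PhiP, inner_sub_left, inner_sub_right, real_inner_smul_left,
    real_inner_self_eq_norm_sq, real_inner_comm a b]
  nlinarith [mul_nonneg h4 (sub_nonneg.2 h3)]

theorem measurable_PhiP (p : ℝ) : Measurable (PhiP p : EuclideanSpace ℝ (Fin N) → _) :=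
  (measurable_norm.pow_const _).smul measurable_id

theorem HasWeakGradientOn.const_smul {A : Set (EuclideanSpace ℝ (Fin N))}
    {u : EuclideanSpace ℝ (Fin N) → ℝ}
    {G : EuclideanSpace ℝ (Fin N) → EuclideanSpace ℝ (Fin N)}
    (hu : HasWeakGradientOn A u G) (c : ℝ) :
    HasWeakGradientOn A (fun x => c * u x) (fun x => c • G x) where
  locInt_fun := hu.locInt_fun.smul c
  locInt_grad := hu.locInt_grad.smul c
  parts η hη hc hs v := by
    simp only [real_inner_smul_left, mul_assoc]
    rw [integral_const_mul, integral_const_mul, hu.parts η hη hc hs v]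
    ring

/-- Comparison of a weak solution with a strict classical sub- or supersolution `W` with flux
`X = ρ Φ_p(∇W)`; the sign `ε` distinguishes the two cases. -/
theorem weak_comparison {p : ℝ} (hp : 1 < p) {U A K : Set (EuclideanSpace ℝ (Fin N))}
    (hA : IsOpen A) (hAU : A ⊆ U) (hK : IsCompact K) (hKA : K ⊆ A)
    {u : EuclideanSpace ℝ (Fin N) → ℝ}
    {G : EuclideanSpace ℝ (Fin N) → EuclideanSpace ℝ (Fin N)}
    (hu : MemW1pLoc p U u G) (huc : ContinuousOn u U)
    {ρ c : EuclideanSpace ℝ (Fin N) → ℝ} (hρ : ContinuousOn ρ A) (hρ0 : ∀ x ∈ A, 0 ≤ ρ x)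
    (hc : ContinuousOn c A)
    (heq : ∀ (η : EuclideanSpace ℝ (Fin N) → ℝ)
      (H : EuclideanSpace ℝ (Fin N) → EuclideanSpace ℝ (Fin N)), MemW1pCompact p U η H →
        (∫ x in U, inner ℝ (PhiP p (G x)) (H x) * ρ x) + ∫ x in U, c x * η x = 0)
    {W : EuclideanSpace ℝ (Fin N) → ℝ}
    {X Y : EuclideanSpace ℝ (Fin N) → EuclideanSpace ℝ (Fin N)}
    (hW : ∀ x ∈ A, HasGradientAt W (Y x) x) (hY : ContinuousOn Y A)
    (hXY : ∀ x ∈ A, X x = ρ x • PhiP p (Y x))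
    (hX : ∀ i, ContDiffOn ℝ 1 (fun x => X x i) A)
    {ε : ℝ} (hε : ε * ε = 1)
    (hneg : ∀ x ∈ A, x ∉ K → ε * (u x - W x) ≤ 0)
    (hstrict : ∀ x ∈ A, 0 < ε * (u x - W x) →
      0 < ε * (c x - ∑ i, fderiv ℝ (fun y => X y i) x (EuclideanSpace.single i 1))) :
    ∀ x ∈ A, ε * (u x - W x) ≤ 0 := by
  set g : EuclideanSpace ℝ (Fin N) → ℝ := fun x => ε * (u x - W x) with hg
  set J : EuclideanSpace ℝ (Fin N) → EuclideanSpace ℝ (Fin N) := fun x => ε • (G x - Y x) with hJ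
  set D : EuclideanSpace ℝ (Fin N) → ℝ :=
    fun x => ∑ i, fderiv ℝ (fun y => X y i) x (EuclideanSpace.single i 1) with hD
  -- A smooth substitute for the positive part: nondecreasing, zero on s ≤ 0, positive on s > 0.
  -- Being C¹, it needs only the smooth chain rule.
  have hF : ContDiff ℝ 1 expNegInvGlue := expNegInvGlue.contDiff (n := 1)
  have hF' : Continuous (deriv expNegInvGlue) := hF.continuous_deriv le_rfl
  have hF'0 : ∀ s, 0 ≤ deriv expNegInvGlue s := fun s => expNegInvGlue.monotone.deriv_nonneg
  have hFz : ∀ s ≤ 0, expNegInvGlue s = 0 ∧ deriv expNegInvGlue s = 0 := fun s hs => by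
    refine ⟨expNegInvGlue.zero_of_nonpos hs, ?_⟩
    refine IsLocalMin.deriv_eq_zero (Eventually.of_forall fun y => ?_)
    rw [expNegInvGlue.zero_of_nonpos hs]
    exact expNegInvGlue.nonneg y
  have h0 : ∀ x ∈ A, x ∉ K → expNegInvGlue (g x) = 0 ∧ deriv expNegInvGlue (g x) = 0 :=
    fun x hx hxK => hFz _ (hneg x hx hxK)
  have hWc : ContinuousOn W A := fun x hx => (hW x hx).continuousAt.continuousWithinAt
  have hgc : ContinuousOn g A := ((huc.mono hAU).sub hWc).const_smul ε
  have hgJ : HasWeakGradientOn A g J :=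
    ((hu.grad.mono hAU).sub hA (hasWeakGradientOn_of_hasGradientAt hA hW hY)).const_smul ε
  have hGK : MemLp G (ENNReal.ofReal p) (volume.restrict K) :=
    hu.memLp_grad K (hKA.trans hAU) hK
  have : IsFiniteMeasure (volume.restrict K) := ⟨by simpa using hK.measure_lt_top⟩
  have hmK := hK.measurableSet
  obtain ⟨CY, hCY⟩ := hK.exists_bound_of_continuousOn (hY.mono hKA)
  have hYK : MemLp Y (ENNReal.ofReal p) (volume.restrict K) := by
    refine MemLp.of_bound ((hY.mono hKA).aestronglyMeasurable hmK) CY ?_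
    filter_upwards [ae_restrict_mem hmK] with x hx using hCY x hx
  have hJK : MemLp J (ENNReal.ofReal p) (volume.restrict K) := (hGK.sub hYK).const_smul ε
  have htest := memW1pCompact_indicator_comp hp.le hA hAU hK hKA hgc hgJ hJK
    hF h0
  have hE := heq _ _ htest
  -- everything as integrals over `A`
  have e1 : ∀ x, inner ℝ (PhiP p (G x))
      (A.indicator (fun x => deriv expNegInvGlue (g x) • J x) x) * ρ x =
      A.indicator (fun x => ε * (deriv expNegInvGlue (g x) * ρ x *
        inner ℝ (PhiP p (G x)) (G x - Y x))) x := fun x => by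
    by_cases hx : x ∈ A
    · simp only [indicator_of_mem hx, hJ, real_inner_smul_right]
      ring
    · simp [hx]
  have e2 : ∀ x, c x * A.indicator (fun x => expNegInvGlue (g x)) x =
      A.indicator (fun x => c x * expNegInvGlue (g x)) x := fun x => by
    by_cases hx : x ∈ A <;> simp [hx]
  simp only [e1, e2] at hE
  rw [setIntegral_indicator hA.measurableSet, setIntegral_indicator hA.measurableSet,
    inter_eq_self_of_subset_right hAU] at hE
  -- functions vanishing off `K`
  have hext : ∀ {a : EuclideanSpace ℝ (Fin N) → ℝ}, IntegrableOn a K →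
      (∀ x ∈ A, x ∉ K → a x = 0) → IntegrableOn a A := fun ha hz =>
    IntegrableOn.of_forall_sdiff_eq_zero ha hA.measurableSet fun x hx => hz x hx.1 hx.2
  have hFgc : ContinuousOn (fun x => expNegInvGlue (g x)) A := hF.continuous.comp_continuousOn hgc
  have hF'gc : ContinuousOn (fun x => deriv expNegInvGlue (g x)) A := hF'.comp_continuousOn hgc
  have hdX : ∀ i, ContinuousOn (fun x => fderiv ℝ (fun y => X y i) x
      (EuclideanSpace.single i 1)) A := fun i =>
    ((hX i).continuousOn_fderiv_of_isOpen hA le_rfl).clm_apply continuousOn_const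
  have hDc : ContinuousOn D A := continuousOn_finsetSum _ fun i _ => hdX i
  have hJi : IntegrableOn J K :=
    hJK.integrable (by rw [← ENNReal.ofReal_one]; exact ENNReal.ofReal_le_ofReal hp.le)
  -- the flux identity for `X`
  have hX1 : ∫ x in A, expNegInvGlue (g x) * D x =
      - ∫ x in A, ε * (deriv expNegInvGlue (g x) * ρ x *
        inner ℝ (PhiP p (Y x)) (G x - Y x)) := by
    have hi : ∀ i, ∫ x in A, expNegInvGlue (g x) *
        fderiv ℝ (fun y => X y i) x (EuclideanSpace.single i 1) =
        - ∫ x in A, J x i * (deriv expNegInvGlue (g x) * X x i) := fun i => by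
      have := hgJ.chain_rule_of_compact hA hK hKA hgc hF h0 (hX i) (EuclideanSpace.single i 1)
      simpa [EuclideanSpace.inner_single_right] using this
    have hint1 : ∀ i, IntegrableOn (fun x => expNegInvGlue (g x) *
        fderiv ℝ (fun y => X y i) x (EuclideanSpace.single i 1)) A := fun i =>
      hext (((hFgc.mul (hdX i)).mono hKA).integrableOn_compact hK)
        fun x hx hxK => by rw [(h0 x hx hxK).1, zero_mul]
    have hint2 : ∀ i, IntegrableOn (fun x => J x i * (deriv expNegInvGlue (g x) * X x i)) A :=
      fun i => by
        refine hext ?_ fun x hx hxK => by rw [(h0 x hx hxK).2, zero_mul, mul_zero]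
        have hJi' : IntegrableOn (fun x => J x i) K :=
          (EuclideanSpace.proj i : EuclideanSpace ℝ (Fin N) →L[ℝ] ℝ).integrable_comp hJi
        exact hJi'.mul_continuousOn ((hF'gc.mul (hX i).continuousOn).mono hKA) hK
    simp only [hD, Finset.mul_sum]
    rw [integral_finsetSum _ fun i _ => hint1 i, Finset.sum_congr rfl fun i _ => hi i,
      Finset.sum_neg_distrib, ← integral_finsetSum _ fun i _ => hint2 i]
    refine congrArg Neg.neg (setIntegral_congr_fun hA.measurableSet fun x hx => ?_)
    have hsum : ∑ i, J x i * X x i = ε * (ρ x * inner ℝ (PhiP p (Y x)) (G x - Y x)) := by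
      have : ∑ i, J x i * X x i = inner ℝ (X x) (J x) := by
        simp [PiLp.inner_apply]
      rw [this, hXY x hx, hJ, real_inner_smul_left, real_inner_smul_right]
      ring
    calc ∑ i, J x i * (deriv expNegInvGlue (g x) * X x i)
        = deriv expNegInvGlue (g x) * ∑ i, J x i * X x i := by
          rw [Finset.mul_sum]
          exact Finset.sum_congr rfl fun i _ => by ring
      _ = _ := by
          rw [hsum]
          ring
  have hGJ : ∀ {Z : EuclideanSpace ℝ (Fin N) → EuclideanSpace ℝ (Fin N)},
      MemLp Z (ENNReal.ofReal p) (volume.restrict K) → IntegrableOn (fun x => ε *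
        (deriv expNegInvGlue (g x) * ρ x * inner ℝ (PhiP p (Z x)) (G x - Y x))) A := by
    intro Z hZ
    refine hext ?_ fun x hx hxK => by rw [(h0 x hx hxK).2]; ring
    have hb : IntegrableOn (fun x => inner ℝ (PhiP p (Z x)) (G x - Y x)) K := by
      have hpp : ENNReal.ofReal p ≠ 0 := by simp; linarith
      have hZp : IntegrableOn (fun x => ‖Z x‖ ^ p) K := by
        have := hZ.integrable_norm_rpow hpp ENNReal.ofReal_ne_top
        rwa [ENNReal.toReal_ofReal (by linarith)] at this
      have hDp : IntegrableOn (fun x => ‖G x - Y x‖ ^ p) K := by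
        have := (hGK.sub hYK).integrable_norm_rpow hpp ENNReal.ofReal_ne_top
        rwa [ENNReal.toReal_ofReal (by linarith)] at this
      refine Integrable.mono' (hZp.add hDp) ?_ (Eventually.of_forall fun x => ?_)
      · exact ((measurable_PhiP p).comp_aemeasurable
          hZ.aestronglyMeasurable.aemeasurable).aestronglyMeasurable.inner
          (hGK.aestronglyMeasurable.sub hYK.aestronglyMeasurable)
      · refine (norm_inner_le_norm _ _).trans ?_
        rw [norm_PhiP hp]
        simp only [Pi.add_apply]
        -- A crude Young inequality, by comparing s with t; it makes the product of flux and
        -- gradient integrable on K.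
        have hr : ∀ s t : ℝ, 0 ≤ s → 0 ≤ t → s ^ (p - 1) * t ≤ s ^ p + t ^ p := by
          intro s t hs ht
          have hsucc : ∀ r : ℝ, 0 ≤ r → r ^ (p - 1) * r = r ^ p := fun r hr => by
            rcases hr.eq_or_lt with h | h
            · rw [← h, mul_zero, zero_rpow (by linarith)]
            · rw [← rpow_add_one h.ne', sub_add_cancel]
          rcases le_total s t with h | h
          · have := mul_le_mul_of_nonneg_right
              (rpow_le_rpow hs h (by linarith : (0 : ℝ) ≤ p - 1)) ht
            rw [hsucc t ht] at this
            linarith [rpow_nonneg hs p]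
          · have := mul_le_mul_of_nonneg_left h (rpow_nonneg hs (p - 1))
            rw [hsucc s hs] at this
            linarith [rpow_nonneg ht p]
        exact hr _ _ (norm_nonneg _) (norm_nonneg _)
    exact (hb.continuousOn_mul ((hF'gc.mul hρ).mono hKA) hK).const_mul ε
  have hcF : IntegrableOn (fun x => c x * expNegInvGlue (g x)) A :=
    hext (((hc.mul hFgc).mono hKA).integrableOn_compact hK)
      fun x hx hxK => by rw [(h0 x hx hxK).1, mul_zero]
  have hDF : IntegrableOn (fun x => expNegInvGlue (g x) * D x) A :=
    hext (((hFgc.mul hDc).mono hKA).integrableOn_compact hK)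
      fun x hx hxK => by rw [(h0 x hx hxK).1, zero_mul]
  -- The weak equation minus the flux identity for X, with ε² = 1. The first integrand is
  -- nonnegative by monotonicity of Φ_p, and the second is positive wherever g > 0.
  have hsum : (∫ x in A, deriv expNegInvGlue (g x) * ρ x *
      inner ℝ (PhiP p (G x) - PhiP p (Y x)) (G x - Y x)) +
      ∫ x in A, ε * (c x - D x) * expNegInvGlue (g x) = 0 := by
    have i1 : ∫ x in A, deriv expNegInvGlue (g x) * ρ x *
        inner ℝ (PhiP p (G x) - PhiP p (Y x)) (G x - Y x) =
        ε * ((∫ x in A, ε * (deriv expNegInvGlue (g x) * ρ x *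
          inner ℝ (PhiP p (G x)) (G x - Y x))) - ∫ x in A, ε * (deriv expNegInvGlue (g x) * ρ x *
          inner ℝ (PhiP p (Y x)) (G x - Y x))) := by
      rw [← integral_sub (hGJ hGK) (hGJ hYK), ← integral_const_mul]
      refine integral_congr_ae (Eventually.of_forall fun x => ?_)
      simp only [inner_sub_left]
      linear_combination (-(deriv expNegInvGlue (g x) * ρ x *
        (inner ℝ (PhiP p (G x)) (G x - Y x) - inner ℝ (PhiP p (Y x)) (G x - Y x)))) * hε
    have i2 : ∫ x in A, ε * (c x - D x) * expNegInvGlue (g x) =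
        ε * ((∫ x in A, c x * expNegInvGlue (g x)) - ∫ x in A, expNegInvGlue (g x) * D x) := by
      rw [← integral_sub hcF hDF, ← integral_const_mul]
      exact integral_congr_ae (Eventually.of_forall fun x => by ring)
    rw [i1, i2, hX1]
    linear_combination ε * hE
  have hn1 : 0 ≤ ∫ x in A, deriv expNegInvGlue (g x) * ρ x *
      inner ℝ (PhiP p (G x) - PhiP p (Y x)) (G x - Y x) :=
    setIntegral_nonneg hA.measurableSet fun x hx =>
      mul_nonneg (mul_nonneg (hF'0 _) (hρ0 x hx)) (inner_PhiP_sub_nonneg hp _ _)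
  by_contra! hcon
  obtain ⟨x₁, hx₁A, hx₁⟩ := hcon
  have hn2 : 0 < ∫ x in A, ε * (c x - D x) * expNegInvGlue (g x) := by
    rw [setIntegral_pos_iff_support_of_nonneg_ae]
    · have hopen : IsOpen (A ∩ g ⁻¹' Ioi 0) := hgc.isOpen_inter_preimage hA isOpen_Ioi
      -- By continuity {g > 0} is open, so a single point in it already gives positive measure and
      -- makes the sum of the two integrals positive.
      refine (hopen.measure_pos volume ⟨x₁, hx₁A, hx₁⟩).trans_le (measure_mono ?_)
      rintro x ⟨hxA, hx⟩
      exact ⟨(mul_pos (hstrict x hxA hx) (expNegInvGlue.pos_of_pos hx)).ne', hxA⟩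
    · filter_upwards [ae_restrict_mem hA.measurableSet] with x hx
      rcases le_or_gt (g x) 0 with h | h
      · simp [expNegInvGlue.zero_of_nonpos h]
      · exact (mul_pos (hstrict x hx h) (expNegInvGlue.pos_of_pos h)).le
    · refine hext (((continuousOn_const.mul (hc.sub hDc)).mul hFgc).mono hKA
        |>.integrableOn_compact hK) fun x hx hxK => by rw [(h0 x hx hxK).1, mul_zero]
  linarith

end WeakComparison

/-! ### Functions of the distance to the boundary -/

section Radial

variable {N : ℕ}

theorem bdist_eq (hN : 2 ≤ N) {x₀ x : EuclideanSpace ℝ (Fin N)} (hx : x ∈ Metric.ball x₀ 1) :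
    bdist x₀ x = 1 - ‖x - x₀‖ := by
  have : Nontrivial (EuclideanSpace ℝ (Fin N)) := by
    have : Nonempty (Fin N) := ⟨⟨0, by omega⟩⟩
    infer_instance
  rw [mem_ball_iff_norm] at hx
  rw [bdist, frontier_ball x₀ one_ne_zero]
  refine le_antisymm ?_ ?_
  · rcases eq_or_ne x x₀ with rfl | hne
    · obtain ⟨y, hy⟩ : (Metric.sphere x (1 : ℝ)).Nonempty :=
        NormedSpace.sphere_nonempty.2 zero_le_one
      refine (Metric.infDist_le_dist_of_mem hy).trans ?_
      rw [Metric.mem_sphere, dist_comm] at hy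
      simp [hy]
    · have hr : 0 < ‖x - x₀‖ := norm_pos_iff.2 (sub_ne_zero.2 hne)
      have hy : x₀ + ‖x - x₀‖⁻¹ • (x - x₀) ∈ Metric.sphere x₀ (1 : ℝ) := by
        rw [mem_sphere_iff_norm, add_sub_cancel_left, norm_smul, norm_inv, norm_norm,
          inv_mul_cancel₀ hr.ne']
      refine (Metric.infDist_le_dist_of_mem hy).trans (le_of_eq ?_)
      have : x - (x₀ + ‖x - x₀‖⁻¹ • (x - x₀)) = (1 - ‖x - x₀‖⁻¹) • (x - x₀) := by
        rw [sub_smul, one_smul]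
        abel
      rw [dist_eq_norm, this, norm_smul, Real.norm_eq_abs, abs_sub_comm,
        abs_of_nonneg (sub_nonneg.2 ((one_le_inv₀ hr).2 hx.le)), sub_mul,
        inv_mul_cancel₀ hr.ne', one_mul]
  · refine (Metric.le_infDist (NormedSpace.sphere_nonempty.2 zero_le_one)).2 fun y hy => ?_
    rw [mem_sphere_iff_norm] at hy
    have := norm_sub_norm_le (y - x₀) (x - x₀)
    rwa [sub_sub_sub_cancel_right, hy, ← dist_eq_norm y, dist_comm y] at this

theorem hasFDerivAt_norm_sub {E : Type*} [NormedAddCommGroup E] [InnerProductSpace ℝ E]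
    {x₀ x : E} (hx : 0 < ‖x - x₀‖) :
    HasFDerivAt (fun y => ‖y - x₀‖) (innerSL ℝ (‖x - x₀‖⁻¹ • (x - x₀))) x := by
  have h1 := ((hasFDerivAt_id x).sub_const x₀).norm_sq.sqrt (by simpa using hx.ne')
  have h2 : (fun y : E => √(‖id y - x₀‖ ^ 2)) = fun y => ‖y - x₀‖ := by
    ext y
    simp [Real.sqrt_sq]
  rw [h2] at h1
  refine h1.congr_fderiv ?_
  ext v
  simp only [id, Real.sqrt_sq hx.le, map_smul, smul_apply,
    ContinuousLinearMap.comp_apply, innerSL_apply_apply, smul_eq_mul,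
    ContinuousLinearMap.id_apply, nsmul_eq_mul]
  simp only [Nat.cast_ofNat]
  field_simp

/-- Comparison of a local weak solution on an annulus `a < d(x) < b` with a function of `d(x)`. -/
theorem radial_comparison (hN : 2 ≤ N) {x₀ : EuclideanSpace ℝ (Fin N)} {p α : ℝ} (hp : 1 < p)
    {b : EuclideanSpace ℝ (Fin N) → ℝ} (hb : ContinuousOn b (Metric.ball x₀ 1)) {f : ℝ → ℝ}
    (hf : ContinuousOn f (Ici 0)) {u : EuclideanSpace ℝ (Fin N) → ℝ}
    (hu : IsWeakSolution x₀ p α b f u) (hu0 : ∀ x ∈ Metric.ball x₀ 1, 0 ≤ u x)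
    {a lo hi c : ℝ} (ha : 0 ≤ a) (hlo : a < lo) (hhi : hi < c) (hc : c ≤ 1)
    {W W' P P' : ℝ → ℝ} (hW : ∀ t ∈ Ioo a c, HasDerivAt W (W' t) t)
    (hW' : ContinuousOn W' (Ioo a c))
    (hP : ∀ t ∈ Ioo a c, P t = t ^ α * (|W' t| ^ (p - 2) * W' t))
    (hPd : ∀ t ∈ Ioo a c, HasDerivAt P (P' t) t) (hP' : ContinuousOn P' (Ioo a c))
    {ε : ℝ} (hε : ε * ε = 1)
    (hneg : ∀ x ∈ Metric.ball x₀ 1, bdist x₀ x ∈ Ioo a c → bdist x₀ x ∉ Icc lo hi →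
      ε * (u x - W (bdist x₀ x)) ≤ 0)
    (hstrict : ∀ x ∈ Metric.ball x₀ 1, bdist x₀ x ∈ Ioo a c →
      0 < ε * (u x - W (bdist x₀ x)) → 0 < ε * (b x * f (u x) -
        (P' (bdist x₀ x) - (N - 1) / (1 - bdist x₀ x) * P (bdist x₀ x)))) :
    ∀ x ∈ Metric.ball x₀ 1, bdist x₀ x ∈ Ioo a c → ε * (u x - W (bdist x₀ x)) ≤ 0 := by
  obtain ⟨huc, G, hG, heq⟩ := hu
  set A : Set (EuclideanSpace ℝ (Fin N)) := {x | 1 - ‖x - x₀‖ ∈ Ioo a c} with hAdef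
  set K : Set (EuclideanSpace ℝ (Fin N)) := {x | 1 - ‖x - x₀‖ ∈ Icc lo hi} with hKdef
  have hcn : Continuous fun x : EuclideanSpace ℝ (Fin N) => 1 - ‖x - x₀‖ :=
    continuous_const.sub (continuous_id.sub continuous_const).norm
  have hA : IsOpen A := isOpen_Ioo.preimage hcn
  have hAB : A ⊆ Metric.ball x₀ 1 := fun x hx => by
    rw [mem_ball_iff_norm]
    linarith [hx.1]
  have hKA : K ⊆ A := fun x hx => ⟨hlo.trans_le hx.1, hx.2.trans_lt hhi⟩
  have hK : IsCompact K := by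
    refine (isCompact_closedBall x₀ 1).of_isClosed_subset (isClosed_Icc.preimage hcn) ?_
    exact (hKA.trans hAB).trans Metric.ball_subset_closedBall
  have hd : ∀ x ∈ A, bdist x₀ x = 1 - ‖x - x₀‖ := fun x hx => bdist_eq hN (hAB hx)
  have hr : ∀ x ∈ A, 0 < ‖x - x₀‖ := fun x hx => by linarith [hx.2]
  have hdc : ContinuousOn (bdist x₀) A := hcn.continuousOn.congr hd
  -- Since d = 1 - ‖x - x₀‖, the gradient of W(d) is -W'(d) times the radial unit vector; X below is
  -- the corresponding flux, written as a scalar multiple of x - x₀ to ease differentiation.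
  set Y : EuclideanSpace ℝ (Fin N) → EuclideanSpace ℝ (Fin N) :=
    fun x => (-W' (1 - ‖x - x₀‖)) • (‖x - x₀‖⁻¹ • (x - x₀)) with hYdef
  set φ : ℝ → ℝ := fun r => -(P (1 - r) / r) with hφ
  set X : EuclideanSpace ℝ (Fin N) → EuclideanSpace ℝ (Fin N) :=
    fun x => φ ‖x - x₀‖ • (x - x₀) with hXdef
  have hderiv : ∀ {V V' : ℝ → ℝ}, (∀ t ∈ Ioo a c, HasDerivAt V (V' t) t) → ∀ r,
      1 - r ∈ Ioo a c → HasDerivAt (fun r => V (1 - r)) (-V' (1 - r)) r := by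
    intro V V' hV r hr
    have := (hV _ hr).comp r ((hasDerivAt_id r).const_sub 1)
    rw [mul_neg_one] at this
    exact this
  have hφd : ∀ r, 0 < r → 1 - r ∈ Ioo a c →
      HasDerivAt φ (P' (1 - r) / r + P (1 - r) / r ^ 2) r := by
    intro r hr0 hr
    have := ((hderiv hPd r hr).div (hasDerivAt_id r) hr0.ne').neg
    refine this.congr_deriv ?_
    simp only [id]
    field_simp
    ring
  have hncont : ContinuousOn (fun x : EuclideanSpace ℝ (Fin N) => ‖x - x₀‖) A :=
    (continuous_id.sub continuous_const).norm.continuousOn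
  have hmain := weak_comparison (ε := ε) (W := fun x => W (1 - ‖x - x₀‖)) (X := X) (Y := Y)
    (ρ := fun x => bdist x₀ x ^ α) (c := fun x => b x * f (u x)) hp hA hAB hK hKA hG huc
    ?_ ?_ ?_ heq ?_ ?_ ?_ ?_ hε ?_ ?_
  · intro x hx hxd
    have hxA : x ∈ A := by
      rw [bdist_eq hN hx] at hxd
      exact hxd
    have := hmain x hxA
    rwa [bdist_eq hN hx]
  · refine hdc.rpow_const fun x hx => Or.inl ?_
    rw [hd x hx]
    exact (ha.trans_lt hx.1).ne'
  · intro x hx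
    refine rpow_nonneg ?_ _
    rw [hd x hx]
    exact ha.trans hx.1.le
  · exact (hb.mono hAB).mul (hf.comp (huc.mono hAB) fun x hx => hu0 x (hAB hx))
  · intro x hx
    rw [hasGradientAt_iff_hasFDerivAt]
    have := (hderiv hW _ hx).comp_hasFDerivAt x (hasFDerivAt_norm_sub (hr x hx))
    refine this.congr_fderiv ?_
    ext v
    simp [hYdef, InnerProductSpace.toDual_apply_apply]
  · refine ContinuousOn.smul (hW'.comp hcn.continuousOn fun x hx => hx).neg ?_
    exact (hncont.inv₀ fun x hx => (hr x hx).ne').smul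
      (continuous_id.sub continuous_const).continuousOn
  · intro x hx
    have hYn : ‖Y x‖ = |W' (1 - ‖x - x₀‖)| := by
      rw [hYdef]
      simp only [norm_smul, norm_neg, norm_inv, Real.norm_eq_abs, abs_norm]
      rw [inv_mul_cancel₀ (hr x hx).ne', mul_one]
    rw [PhiP, hYn, hd x hx]
    simp only [hXdef, hYdef, hφ, hP _ hx, smul_smul]
    congr 1
    have := (hr x hx).ne'
    field_simp
  · intro i
    have hφc : ContDiffOn ℝ 1 φ {r | 0 < r ∧ 1 - r ∈ Ioo a c} := by
      have ho : IsOpen {r : ℝ | 0 < r ∧ 1 - r ∈ Ioo a c} :=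
        isOpen_Ioi.inter (isOpen_Ioo.preimage (continuous_const.sub continuous_id))
      rw [show (1 : WithTop ℕ∞) = 0 + 1 from rfl, contDiffOn_succ_iff_deriv_of_isOpen ho]
      refine ⟨fun r hr => (hφd r hr.1 hr.2).differentiableAt.differentiableWithinAt, by simp,
        contDiffOn_zero.2 ?_⟩
      have hsub : ContinuousOn (fun r : ℝ => 1 - r) {r : ℝ | 0 < r ∧ 1 - r ∈ Ioo a c} :=
        (continuous_const.sub continuous_id).continuousOn
      have hPc : ContinuousOn P (Ioo a c) := fun t ht =>
        (hPd t ht).continuousAt.continuousWithinAt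
      refine ContinuousOn.congr (f := fun r => P' (1 - r) / r + P (1 - r) / r ^ 2) ?_
        fun r hr => (hφd r hr.1 hr.2).deriv
      exact ((hP'.comp hsub fun r hr => hr.2).div continuousOn_id fun r hr => hr.1.ne').add
        ((hPc.comp hsub fun r hr => hr.2).div (continuousOn_id.pow 2)
          fun r hr => pow_ne_zero 2 hr.1.ne')
    have hn : ContDiffOn ℝ 1 (fun x : EuclideanSpace ℝ (Fin N) => ‖x - x₀‖) A := fun x hx =>
      (ContDiffAt.norm ℝ (contDiffAt_id.sub contDiffAt_const)
        (norm_pos_iff.1 (hr x hx))).contDiffWithinAt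
    have hco : ContDiffOn ℝ 1 (fun x : EuclideanSpace ℝ (Fin N) => (x - x₀) i) A :=
      ((EuclideanSpace.proj i : EuclideanSpace ℝ (Fin N) →L[ℝ] ℝ).contDiff.comp
        (contDiff_id.sub contDiff_const)).contDiffOn
    exact (hφc.comp hn fun x hx => ⟨hr x hx, hx⟩).mul hco
  · intro x hx hxK
    have := hneg x (hAB hx)
    rw [hd x hx] at this
    exact this hx hxK
  · intro x hx hpos
    have hst := hstrict x (hAB hx)
    rw [hd x hx] at hst
    convert hst hx hpos using 3
    have hrx := hr x hx
    set r := ‖x - x₀‖ with hrdef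
    have hi : ∀ i, fderiv ℝ (fun y => X y i) x (EuclideanSpace.single i 1) =
        φ r + (P' (1 - r) / r + P (1 - r) / r ^ 2) * (r⁻¹ * ((x - x₀) i * (x - x₀) i)) := by
      intro i
      have h1 := (hφd r hrx hx).comp_hasFDerivAt x (hasFDerivAt_norm_sub hrx)
      have h2 : HasFDerivAt (fun y : EuclideanSpace ℝ (Fin N) => (y - x₀) i)
          (EuclideanSpace.proj i : EuclideanSpace ℝ (Fin N) →L[ℝ] ℝ) x := by
        have := (EuclideanSpace.proj i : EuclideanSpace ℝ (Fin N) →L[ℝ] ℝ).hasFDerivAt.comp x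
          ((hasFDerivAt_id x).sub_const x₀)
        exact this
      have h3 : HasFDerivAt (fun y => X y i) _ x := h1.mul h2
      rw [h3.fderiv]
      simp [EuclideanSpace.inner_single_right]
      ring
    have hs : ∑ i, (x - x₀) i * (x - x₀) i = r ^ 2 := by
      rw [hrdef, ← real_inner_self_eq_norm_sq, PiLp.inner_apply]
      simp [pow_two]
    -- The divergence of φ(r)(x - x₀) is N φ + r φ'. With φ(r) = -P(1-r)/r this is P' - (N-1)/r · P,
    -- evaluated at 1 - r.
    rw [Finset.sum_congr rfl fun i _ => hi i, Finset.sum_add_distrib, ← Finset.mul_sum,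
      ← Finset.mul_sum, hs]
    simp only [Finset.sum_const, Finset.card_univ, Fintype.card_fin, nsmul_eq_mul, hφ,
      sub_sub_cancel]
    have := hrx.ne'
    field_simp
    ring

theorem eventually_toBoundary_mem_ball (x₀ : EuclideanSpace ℝ (Fin N)) :
    ∀ᶠ x in toBoundary x₀, x ∈ Metric.ball x₀ 1 :=
  (show (toBoundary x₀) ≤ 𝓟 (Metric.ball x₀ 1) from inf_le_right) (mem_principal_self _)

theorem tendsto_bdist (hN : 2 ≤ N) (x₀ : EuclideanSpace ℝ (Fin N)) :
    Tendsto (bdist x₀) (toBoundary x₀) (𝓝[>] 0) := by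
  refine tendsto_nhdsWithin_iff.2 ⟨tendsto_comap.mono_left inf_le_left, ?_⟩
  filter_upwards [eventually_toBoundary_mem_ball x₀] with x hx
  rw [bdist_eq hN hx]
  rw [mem_ball_iff_norm] at hx
  exact sub_pos.2 hx

theorem eventually_toBoundary_iff {x₀ : EuclideanSpace ℝ (Fin N)}
    {Q : EuclideanSpace ℝ (Fin N) → Prop} :
    (∀ᶠ x in toBoundary x₀, Q x) ↔
      ∃ δ, 0 < δ ∧ ∀ x ∈ Metric.ball x₀ 1, bdist x₀ x < δ → Q x := by
  rw [toBoundary, eventually_inf_principal]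
  constructor
  · intro h
    obtain ⟨δ, hδ, h⟩ := ((Metric.nhds_basis_ball (x := (0 : ℝ))).comap (bdist x₀)).mem_iff.1 h
    refine ⟨δ, hδ, fun x hx hxd => h ?_ hx⟩
    rw [mem_preimage, mem_ball_zero_iff, Real.norm_of_nonneg]
    · exact hxd
    · exact Metric.infDist_nonneg
  · rintro ⟨δ, hδ, h⟩
    filter_upwards [preimage_mem_comap (Iio_mem_nhds hδ)] with x hx hxb using h x hxb hx

theorem toBoundary_neBot (hN : 2 ≤ N) (x₀ : EuclideanSpace ℝ (Fin N)) :
    (toBoundary x₀).NeBot := by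
  have : Nontrivial (EuclideanSpace ℝ (Fin N)) := by
    have : Nonempty (Fin N) := ⟨⟨0, by omega⟩⟩
    infer_instance
  rw [neBot_iff, Ne, ← eventually_false_iff_eq_bot, eventually_toBoundary_iff]
  rintro ⟨δ, hδ, h⟩
  have hs1 : 0 < min δ 1 := lt_min hδ one_pos
  obtain ⟨y, hy⟩ : (Metric.sphere x₀ (1 - min δ 1 / 2)).Nonempty :=
    NormedSpace.sphere_nonempty.2 (by linarith [min_le_right δ 1])
  rw [mem_sphere_iff_norm] at hy
  have hyb : y ∈ Metric.ball x₀ 1 := by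
    rw [mem_ball_iff_norm, hy]
    linarith
  refine h y hyb ?_
  rw [bdist_eq hN hyb, hy]
  linarith [min_le_left δ 1]

end Radial

/-! ### Regular variation and the tail integral of (qF)^{-1/p} -/

section RegularVariation

variable {f : ℝ → ℝ}

theorem hasDerivAt_primitiveF (hf : ContinuousOn f (Ici 0)) {w : ℝ} (hw : 0 < w) :
    HasDerivAt (primitiveF f) (f w) w := by
  refine intervalIntegral.integral_hasDerivAt_right ?_ ?_ (hf.continuousAt (Ici_mem_nhds hw))
  · refine (hf.mono ?_).intervalIntegrable
    rw [uIcc_of_le hw.le]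
    exact fun x hx => hx.1
  · exact (hf.mono Ioi_subset_Ici_self).stronglyMeasurableAtFilter isOpen_Ioi w hw

theorem primitiveF_pos (hf : ContinuousOn f (Ici 0)) (hpos : ∀ u, 0 < u → 0 < f u) {w : ℝ}
    (hw : 0 < w) : 0 < primitiveF f w := by
  refine intervalIntegral.intervalIntegral_pos_of_pos_on ?_ (fun x hx => hpos x hx.1) hw
  refine (hf.mono ?_).intervalIntegrable
  rw [uIcc_of_le hw.le]
  exact fun x hx => hx.1

theorem continuousOn_primitiveF (hf : ContinuousOn f (Ici 0)) :
    ContinuousOn (primitiveF f) (Ioi 0) := fun _ hw =>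
  (hasDerivAt_primitiveF hf hw).continuousAt.continuousWithinAt

/-- Karamata's theorem for monotone regularly varying functions. -/
theorem tendsto_primitiveF_div (hf : ContinuousOn f (Ici 0)) (hmono : MonotoneOn f (Ici 0))
    {σ : ℝ} (hσ : -1 < σ + 1) (hrv : IsRegularlyVarying f (σ + 1)) :
    Tendsto (fun w => primitiveF f w / (w * f w)) atTop (𝓝 (1 / (σ + 2))) := by
  -- After scaling, F(w)/(w f(w)) is the integral of f(sw)/f(w) over 0 < s ≤ 1. Monotonicity of f
  -- bounds the integrand by 1, so dominated convergence applies.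
  have h1 : Tendsto (fun w => ∫ s in (0 : ℝ)..1, f (s * w) / f w) atTop
      (𝓝 (∫ s in (0 : ℝ)..1, s ^ (σ + 1))) := by
    refine intervalIntegral.tendsto_integral_filter_of_dominated_convergence (fun _ => 1)
      ?_ ?_ intervalIntegrable_const ?_
    · filter_upwards [eventually_gt_atTop 0] with w hw
      refine ContinuousOn.aestronglyMeasurable ?_ measurableSet_uIoc
      refine ContinuousOn.div_const (hf.comp (continuous_id.mul continuous_const).continuousOn
        fun s hs => ?_) _
      rw [uIoc_of_le zero_le_one] at hs
      exact mul_nonneg hs.1.le hw.le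
    · filter_upwards [eventually_gt_atTop 0] with w hw
      refine Eventually.of_forall fun s hs => ?_
      rw [uIoc_of_le zero_le_one] at hs
      have hsw : 0 < s * w := mul_pos hs.1 hw
      rw [Real.norm_of_nonneg (div_nonneg (hrv.pos _ hsw).le (hrv.pos _ hw).le),
        div_le_one (hrv.pos _ hw)]
      exact hmono hsw.le hw.le (mul_le_of_le_one_left hw.le hs.2)
    · refine Eventually.of_forall fun s hs => ?_
      rw [uIoc_of_le zero_le_one] at hs
      exact hrv.lim s hs.1
  rw [integral_rpow (Or.inl hσ), one_rpow, zero_rpow (by linarith), sub_zero,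
    show σ + 1 + 1 = σ + 2 by ring] at h1
  refine h1.congr' ?_
  filter_upwards [eventually_gt_atTop 0] with w hw
  have h2 := intervalIntegral.mul_integral_comp_mul_left (a := 0) (b := 1) (f := f) w
  rw [mul_zero, mul_one] at h2
  rw [intervalIntegral.integral_div, primitiveF, ← h2]
  have := (hrv.pos w hw).ne'
  simp only [mul_comm w (_ : ℝ)]
  field_simp
  simp only [mul_comm]

/-- The integrand `(q F)^{-1/p}` of the profile equation. -/
noncomputable def profileIntegrand (p : ℝ) (f : ℝ → ℝ) (s : ℝ) : ℝ :=
  (p / (p - 1) * primitiveF f s) ^ (-(1 / p))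

/-- `∫_w^∞ (q F)^{-1/p}`. -/
noncomputable def profileIntegral (p : ℝ) (f : ℝ → ℝ) (w : ℝ) : ℝ :=
  ∫ s in Ioi w, profileIntegrand p f s

theorem tendsto_profileIntegral (p : ℝ) (f : ℝ → ℝ) :
    Tendsto (profileIntegral p f) atTop (𝓝 0) :=
  tendsto_integral_Ioi_zero tendsto_id

variable {p σ : ℝ} (hp : 1 < p) (hσ : p - 2 < σ) (hf : ContinuousOn f (Ici 0))
  (hmono : MonotoneOn f (Ici 0)) (hrv : IsRegularlyVarying f (σ + 1))

include hp hf hrv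

theorem qF_pos {w : ℝ} (hw : 0 < w) : 0 < p / (p - 1) * primitiveF f w :=
  mul_pos (div_pos (by linarith) (by linarith)) (primitiveF_pos hf hrv.pos hw)

theorem profileIntegrand_pos {w : ℝ} (hw : 0 < w) : 0 < profileIntegrand p f w :=
  rpow_pos_of_pos (qF_pos hp hf hrv hw) _

theorem hasDerivAt_profileIntegrand {w : ℝ} (hw : 0 < w) :
    HasDerivAt (profileIntegrand p f)
      (-(1 / p) * profileIntegrand p f w * (f w / primitiveF f w)) w := by
  have hq := qF_pos hp hf hrv hw
  have hF := primitiveF_pos hf hrv.pos hw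
  have h1 := ((hasDerivAt_primitiveF hf hw).const_mul (p / (p - 1))).rpow_const
    (p := -(1 / p)) (Or.inl hq.ne')
  refine h1.congr_deriv ?_
  rw [rpow_sub_one hq.ne', profileIntegrand]
  have : p - 1 ≠ 0 := by linarith
  field_simp

theorem continuousOn_profileIntegrand : ContinuousOn (profileIntegrand p f) (Ioi 0) :=
  fun _ hw => (hasDerivAt_profileIntegrand hp hf hrv hw).continuousAt.continuousWithinAt

theorem antitoneOn_profileIntegrand : AntitoneOn (profileIntegrand p f) (Ioi 0) := by
  refine antitoneOn_of_deriv_nonpos (convex_Ioi 0) (continuousOn_profileIntegrand hp hf hrv)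
    ?_ ?_
  · rw [interior_Ioi]
    exact fun w hw => (hasDerivAt_profileIntegrand hp hf hrv hw).differentiableAt
      |>.differentiableWithinAt
  · rw [interior_Ioi]
    intro w hw
    rw [(hasDerivAt_profileIntegrand hp hf hrv hw).deriv]
    have h1 := (profileIntegrand_pos hp hf hrv hw).le
    have h2 := div_nonneg (hrv.pos w hw).le (primitiveF_pos hf hrv.pos hw).le
    have h3 : 0 ≤ 1 / p := by positivity
    have := mul_nonneg (mul_nonneg h3 h1) h2
    linarith

theorem hasDerivAt_mul_profileIntegrand {w : ℝ} (hw : 0 < w) :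
    HasDerivAt (fun w => w * profileIntegrand p f w)
      (profileIntegrand p f w * (1 - 1 / p * (w * f w / primitiveF f w))) w := by
  refine ((hasDerivAt_id w).mul (hasDerivAt_profileIntegrand hp hf hrv hw)).congr_deriv ?_
  simp only [id]
  ring

include hσ hmono

theorem tendsto_mul_div_primitiveF :
    Tendsto (fun w => w * f w / primitiveF f w) atTop (𝓝 (σ + 2)) := by
  have := (tendsto_primitiveF_div hf hmono (by linarith) hrv).inv₀
    (one_div_ne_zero (by linarith))
  simpa using this

/-- With G the integrand and J = w G, one has -J' = G (w f/(p F) - 1). As w f/F → σ + 2 > p,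
eventually -J' ≥ (m/p - 1) G for m midway between p and σ + 2. Integrating bounds ∫ G over [a, b] by
J(a)/(m/p - 1), uniformly in b. -/
theorem integrableOn_profileIntegrand {w : ℝ} (hw : 0 < w) :
    IntegrableOn (profileIntegrand p f) (Ioi w) := by
  have hlim := tendsto_mul_div_primitiveF hp hσ hf hmono hrv
  set m := (p + (σ + 2)) / 2 with hm
  have hpm : p < m := by linarith
  obtain ⟨w₀, hw₀⟩ := eventually_atTop.1
    (hlim.eventually (lt_mem_nhds (show m < σ + 2 by linarith)))
  set a := max w₀ w with ha
  have haw : w ≤ a := le_max_right _ _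
  have ha0 : 0 < a := hw.trans_le haw
  have hcont := continuousOn_profileIntegrand hp hf hrv
  set J := fun w => w * profileIntegrand p f w with hJ
  have hκ : 0 < m / p - 1 := by
    rw [sub_pos, one_lt_div (by linarith)]
    exact hpm
  have hIoc : ∀ c d, 0 < c → IntegrableOn (profileIntegrand p f) (Ioc c d) := fun c d hc =>
    ((hcont.mono fun x hx => hc.trans_le hx.1).integrableOn_Icc).mono_set Ioc_subset_Icc_self
  have hmain : IntegrableOn (profileIntegrand p f) (Ioi a) := by
    refine integrableOn_Ioi_of_intervalIntegral_norm_bounded (J a / (m / p - 1)) a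
      (b := fun b : ℝ => b) (l := atTop) (fun b => hIoc a b ha0) tendsto_id ?_
    filter_upwards [eventually_ge_atTop a] with b hb
    have hsub : ∀ x ∈ uIcc a b, 0 < x := fun x hx => by
      rw [uIcc_of_le hb] at hx
      exact ha0.trans_le hx.1
    have hFTC := intervalIntegral.integral_eq_sub_of_hasDerivAt (a := a) (b := b) (f := J)
      (f' := fun w => profileIntegrand p f w * (1 - 1 / p * (w * f w / primitiveF f w)))
      (fun x hx => hasDerivAt_mul_profileIntegrand hp hf hrv (hsub x hx)) (by
        refine ContinuousOn.intervalIntegrable ?_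
        refine (hcont.mono hsub).mul (continuousOn_const.sub (continuousOn_const.mul ?_))
        exact (continuousOn_id.mul (hf.mono fun x hx => (hsub x hx).le)).div
          ((continuousOn_primitiveF hf).mono hsub)
          fun x hx => (primitiveF_pos hf hrv.pos (hsub x hx)).ne')
    have hle : ∫ x in a..b, (m / p - 1) * ‖profileIntegrand p f x‖ ≤
        ∫ x in a..b, -(profileIntegrand p f x * (1 - 1 / p * (x * f x / primitiveF f x))) := by
      refine intervalIntegral.integral_mono_on hb ?_ ?_ fun x hx => ?_
      · exact (continuousOn_const.mul (hcont.mono hsub).norm).intervalIntegrable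
      · refine ContinuousOn.intervalIntegrable (ContinuousOn.neg ?_)
        refine (hcont.mono hsub).mul (continuousOn_const.sub (continuousOn_const.mul ?_))
        exact (continuousOn_id.mul (hf.mono fun x hx => (hsub x hx).le)).div
          ((continuousOn_primitiveF hf).mono hsub)
          fun x hx => (primitiveF_pos hf hrv.pos (hsub x hx)).ne'
      · have hx0 : 0 < x := ha0.trans_le hx.1
        have hg := profileIntegrand_pos hp hf hrv hx0
        rw [Real.norm_of_nonneg hg.le]
        have h1 := hw₀ x ((le_max_left _ _).trans hx.1)
        have h2 : m / p ≤ 1 / p * (x * f x / primitiveF f x) := by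
          rw [div_eq_inv_mul, one_div]
          exact mul_le_mul_of_nonneg_left h1.le (inv_nonneg.2 (by linarith))
        nlinarith
    rw [intervalIntegral.integral_const_mul, intervalIntegral.integral_neg, hFTC] at hle
    rw [le_div_iff₀ hκ]
    have hJb : 0 ≤ J b := mul_nonneg (ha0.trans_le hb).le
      (profileIntegrand_pos hp hf hrv (ha0.trans_le hb)).le
    linarith
  rw [← Ioc_union_Ioi_eq_Ioi haw]
  exact (hIoc w a hw).union hmain

theorem hasDerivAt_profileIntegral {w : ℝ} (hw : 0 < w) :
    HasDerivAt (profileIntegral p f) (-profileIntegrand p f w) w := by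
  have hI : ∀ {x}, 0 < x → IntegrableOn (profileIntegrand p f) (Ioi x) :=
    fun hx => integrableOn_profileIntegrand hp hσ hf hmono hrv hx
  have hcont := continuousOn_profileIntegrand hp hf hrv
  have h1 : HasDerivAt (fun x => profileIntegral p f w -
      ∫ s in w..x, profileIntegrand p f s) (-profileIntegrand p f w) w := by
    refine HasDerivAt.const_sub _ (intervalIntegral.integral_hasDerivAt_right
      (IntervalIntegrable.refl) ?_ (hcont.continuousAt (Ioi_mem_nhds hw)))
    exact hcont.stronglyMeasurableAtFilter isOpen_Ioi w hw
  refine h1.congr_of_eventuallyEq ?_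
  filter_upwards [Ioi_mem_nhds hw] with x hx
  have := intervalIntegral.integral_interval_add_Ioi (hI hw) (hI hx)
  simp only [profileIntegral]
  linarith

theorem strictAntiOn_profileIntegral : StrictAntiOn (profileIntegral p f) (Ioi 0) := by
  refine strictAntiOn_of_deriv_neg (convex_Ioi 0) (fun w hw =>
    (hasDerivAt_profileIntegral hp hσ hf hmono hrv hw).continuousAt.continuousWithinAt) ?_
  rw [interior_Ioi]
  intro w hw
  rw [(hasDerivAt_profileIntegral hp hσ hf hmono hrv hw).deriv]
  linarith [profileIntegrand_pos hp hf hrv hw]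

theorem profileIntegral_pos {w : ℝ} (hw : 0 < w) : 0 < profileIntegral p f w := by
  have h := strictAntiOn_profileIntegral hp hσ hf hmono hrv hw
    (show w + 1 ∈ Ioi (0 : ℝ) from by simp; linarith) (by linarith)
  refine lt_of_le_of_lt ?_ h
  refine setIntegral_nonneg measurableSet_Ioi fun x hx => ?_
  exact (profileIntegrand_pos hp hf hrv (by linarith [mem_Ioi.1 hx])).le

/-- The integrand G is nonincreasing, so w G(w) is at most twice its integral over [w/2, w], hence
at most twice the tail from w/2. -/
theorem tendsto_mul_profileIntegrand :
    Tendsto (fun w => w * profileIntegrand p f w) atTop (𝓝 0) := by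
  have h1 : Tendsto (fun w => 2 * profileIntegral p f (w / 2)) atTop (𝓝 0) := by
    have := ((tendsto_profileIntegral p f).comp
      (tendsto_id.atTop_div_const (show (0 : ℝ) < 2 by norm_num))).const_mul 2
    simpa using this
  refine tendsto_of_tendsto_of_tendsto_of_le_of_le' tendsto_const_nhds h1 ?_ ?_
  · filter_upwards [eventually_gt_atTop 0] with w hw
    exact mul_nonneg hw.le (profileIntegrand_pos hp hf hrv hw).le
  · filter_upwards [eventually_gt_atTop 0] with w hw
    have hw2 : 0 < w / 2 := by linarith
    have hadd := intervalIntegral.integral_interval_add_Ioi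
      (integrableOn_profileIntegrand hp hσ hf hmono hrv hw2)
      (integrableOn_profileIntegrand hp hσ hf hmono hrv hw)
    have hpos := profileIntegral_pos hp hσ hf hmono hrv hw
    have hge : ∫ _ in (w / 2)..w, profileIntegrand p f w ≤
        ∫ s in (w / 2)..w, profileIntegrand p f s := by
      refine intervalIntegral.integral_mono_on (by linarith) intervalIntegrable_const ?_ ?_
      · refine ((continuousOn_profileIntegrand hp hf hrv).mono ?_).intervalIntegrable
        rw [uIcc_of_le (by linarith)]
        exact fun x hx => hw2.trans_le hx.1
      · exact fun x hx => antitoneOn_profileIntegrand hp hf hrv (hw2.trans_le hx.1) hw hx.2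
    rw [intervalIntegral.integral_const, smul_eq_mul] at hge
    simp only [profileIntegral] at hpos ⊢
    linarith

/-- L'Hôpital for 0/0: the quotient of derivatives is w f/(p F) - 1, whose limit is Karamata's. -/
theorem tendsto_mul_profileIntegrand_div :
    Tendsto (fun w => w * profileIntegrand p f w / profileIntegral p f w) atTop
      (𝓝 ((σ + 2) / p - 1)) := by
  refine HasDerivAt.lhopital_zero_atTop
    (f' := fun w => profileIntegrand p f w * (1 - 1 / p * (w * f w / primitiveF f w)))
    (g' := fun w => -profileIntegrand p f w) ?_ ?_ ?_
    (tendsto_mul_profileIntegrand hp hσ hf hmono hrv)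
    (tendsto_profileIntegral p f) ?_
  · filter_upwards [eventually_gt_atTop 0] with w hw
    exact hasDerivAt_mul_profileIntegrand hp hf hrv hw
  · filter_upwards [eventually_gt_atTop 0] with w hw
    exact hasDerivAt_profileIntegral hp hσ hf hmono hrv hw
  · filter_upwards [eventually_gt_atTop 0] with w hw
    exact neg_ne_zero.2 (profileIntegrand_pos hp hf hrv hw).ne'
  · have h1 := ((tendsto_mul_div_primitiveF hp hσ hf hmono hrv).const_mul (1 / p)).sub_const 1
    rw [one_div_mul_eq_div] at h1
    refine h1.congr' ?_
    filter_upwards [eventually_gt_atTop 0] with w hw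
    have := (profileIntegrand_pos hp hf hrv hw).ne'
    rw [eq_div_iff (neg_ne_zero.2 this)]
    ring

end RegularVariation

/-! ### The profile φ as inverse of the tail integral -/

section Profile

variable {f : ℝ → ℝ} {p σ : ℝ} (hp : 1 < p) (hσ : p - 2 < σ) (hf : ContinuousOn f (Ici 0))
  (hmono : MonotoneOn f (Ici 0)) (hrv : IsRegularlyVarying f (σ + 1))

theorem IsProfile.exists_spec {p : ℝ} {f φ : ℝ → ℝ} (hφ : IsProfile p f φ) :
    ∃ δ, 0 < δ ∧ ∀ t ∈ Ioo 0 δ, 0 < φ t ∧ profileIntegral p f (φ t) = t := by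
  obtain ⟨δ, hδ, h⟩ := mem_nhdsGT_iff_exists_Ioo_subset.1 hφ
  exact ⟨δ, hδ, fun t ht => h ht⟩

include hp hσ hf hmono hrv

theorem exists_isProfile : ∃ φ, IsProfile p f φ := by
  have key : ∀ᶠ t in 𝓝[>] (0 : ℝ), ∃ w, 0 < w ∧ profileIntegral p f w = t := by
    have h1 := profileIntegral_pos hp hσ hf hmono hrv one_pos
    filter_upwards [Ioo_mem_nhdsGT h1] with t ht
    obtain ⟨M, hM1, hM⟩ := ((eventually_ge_atTop (1 : ℝ)).and
      ((tendsto_profileIntegral p f).eventually (gt_mem_nhds ht.1))).exists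
    have hcont : ContinuousOn (profileIntegral p f) (Icc 1 M) := fun w hw =>
      (hasDerivAt_profileIntegral hp hσ hf hmono hrv
        (one_pos.trans_le hw.1)).continuousAt.continuousWithinAt
    obtain ⟨w, hw, hwt⟩ := intermediate_value_Icc' hM1 hcont ⟨hM.le, ht.2.le⟩
    exact ⟨w, one_pos.trans_le hw.1, hwt⟩
  classical
  refine ⟨fun t => if h : ∃ w, 0 < w ∧ profileIntegral p f w = t then h.choose else 1, ?_⟩
  filter_upwards [key] with t ht
  simp only [dif_pos ht]
  exact ht.choose_spec

variable {φ : ℝ → ℝ} {δ : ℝ}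
  (hφ : ∀ t ∈ Ioo 0 δ, 0 < φ t ∧ profileIntegral p f (φ t) = t)

include hφ

/-- φ inverts a strictly decreasing function. This equivalence and the next one turn continuity and
divergence of φ into statements about `profileIntegral`. -/
theorem profile_lt_iff {t : ℝ} (ht : t ∈ Ioo 0 δ) {w : ℝ} (hw : 0 < w) :
    φ t < w ↔ profileIntegral p f w < t := by
  have := (strictAntiOn_profileIntegral hp hσ hf hmono hrv).lt_iff_gt hw (hφ t ht).1
  rw [(hφ t ht).2] at this
  exact this.symm

theorem lt_profile_iff {t : ℝ} (ht : t ∈ Ioo 0 δ) {w : ℝ} (hw : 0 < w) :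
    w < φ t ↔ t < profileIntegral p f w := by
  have := (strictAntiOn_profileIntegral hp hσ hf hmono hrv).lt_iff_gt (hφ t ht).1 hw
  rw [(hφ t ht).2] at this
  exact this.symm

theorem continuousOn_profile : ContinuousOn φ (Ioo 0 δ) := by
  intro t ht
  refine ContinuousAt.continuousWithinAt ?_
  rw [ContinuousAt, tendsto_order]
  have hnb : ∀ᶠ s in 𝓝 t, s ∈ Ioo 0 δ := Ioo_mem_nhds ht.1 ht.2
  constructor
  · intro a ha
    rcases le_or_gt a 0 with h | h
    · filter_upwards [hnb] with s hs using h.trans_lt (hφ s hs).1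
    · filter_upwards [hnb, gt_mem_nhds ((lt_profile_iff hp hσ hf hmono hrv hφ ht h).1 ha)]
        with s hs hs2
      exact (lt_profile_iff hp hσ hf hmono hrv hφ hs h).2 hs2
  · intro a ha
    have h : 0 < a := (hφ t ht).1.trans ha
    filter_upwards [hnb, lt_mem_nhds ((profile_lt_iff hp hσ hf hmono hrv hφ ht h).1 ha)]
      with s hs hs2
    exact (profile_lt_iff hp hσ hf hmono hrv hφ hs h).2 hs2

theorem hasDerivAt_profile {t : ℝ} (ht : t ∈ Ioo 0 δ) :
    HasDerivAt φ (-(p / (p - 1) * primitiveF f (φ t)) ^ (1 / p)) t := by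
  have hq := qF_pos hp hf hrv (hφ t ht).1
  have h := HasDerivAt.of_local_left_inverse
    ((continuousOn_profile hp hσ hf hmono hrv hφ).continuousAt (Ioo_mem_nhds ht.1 ht.2))
    (hasDerivAt_profileIntegral hp hσ hf hmono hrv (hφ t ht).1)
    (neg_ne_zero.2 (profileIntegrand_pos hp hf hrv (hφ t ht).1).ne')
    (by filter_upwards [Ioo_mem_nhds ht.1 ht.2] with s hs using (hφ s hs).2)
  refine h.congr_deriv ?_
  rw [profileIntegrand, rpow_neg hq.le, ← neg_inv, inv_inv]

omit hφ in
theorem tendsto_profile (hδ : 0 < δ)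
    (hφ : ∀ t ∈ Ioo 0 δ, 0 < φ t ∧ profileIntegral p f (φ t) = t) :
    Tendsto φ (𝓝[>] 0) atTop := by
  refine tendsto_atTop.2 fun M => ?_
  have hM : 0 < max M 1 := lt_max_of_lt_right one_pos
  filter_upwards [Ioo_mem_nhdsGT hδ,
    Ioo_mem_nhdsGT (profileIntegral_pos hp hσ hf hmono hrv hM)] with t ht ht2
  exact (le_max_left _ _).trans ((lt_profile_iff hp hσ hf hmono hrv hφ ht hM).2 ht2.2).le

omit hφ in
-- At w = φ(s) one has s = ∫_w^∞ G and (qF)^{(p-1)/p} = qF · G with G = (qF)^{-1/p}. So the ratio is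
-- q · (F/(w f)) · (w G/∫_w^∞ G), a product of two known limits.
theorem tendsto_profile_ratio (hδ : 0 < δ)
    (hφ : ∀ t ∈ Ioo 0 δ, 0 < φ t ∧ profileIntegral p f (φ t) = t) :
    Tendsto (fun s => (p / (p - 1) * primitiveF f (φ s)) ^ ((p - 1) / p) / (f (φ s) * s))
      (𝓝[>] 0) (𝓝 ((2 + σ - p) / ((p - 1) * (2 + σ)))) := by
  have h1 := ((tendsto_primitiveF_div hf hmono (by linarith) hrv).mul
    (tendsto_mul_profileIntegrand_div hp hσ hf hmono hrv)).const_mul (p / (p - 1))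
  have h2 : p / (p - 1) * (1 / (σ + 2) * ((σ + 2) / p - 1)) =
      (2 + σ - p) / ((p - 1) * (2 + σ)) := by
    have e1 : p - 1 ≠ 0 := by linarith
    have e2 : σ + 2 ≠ 0 := by linarith
    have e3 : 2 + σ ≠ 0 := by linarith
    have e4 : p ≠ 0 := by linarith
    field_simp
    ring
  rw [h2] at h1
  refine (h1.comp (tendsto_profile hp hσ hf hmono hrv hδ hφ)).congr' ?_
  filter_upwards [Ioo_mem_nhdsGT hδ] with s hs
  obtain ⟨hφ0, hI⟩ := hφ s hs
  have hq := qF_pos hp hf hrv hφ0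
  simp only [Function.comp, hI, profileIntegrand]
  have hrp : (p / (p - 1) * primitiveF f (φ s)) ^ ((p - 1) / p) =
      (p / (p - 1) * primitiveF f (φ s)) * (p / (p - 1) * primitiveF f (φ s)) ^ (-(1 / p)) := by
    nth_rewrite 2 [← rpow_one (p / (p - 1) * primitiveF f (φ s))]
    rw [← rpow_add hq]
    congr 1
    have : p ≠ 0 := by linarith
    field_simp
    ring
  rw [hrp]
  have e1 := (hrv.pos _ hφ0).ne'
  have e2 := hs.1.ne'
  field_simp

end Profile

/-! ### The class 𝒦 -/

section ClassK

/-- The derivative `t^{-α/2} k(t)` of `weightK`. -/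
noncomputable def weightD (α : ℝ) (k : ℝ → ℝ) (t : ℝ) : ℝ := t ^ (-α / 2) * k t

/-- The analytic content of the class `𝒦` on an interval `(0,ν)`. -/
structure ClassKOn (α : ℝ) (k : ℝ → ℝ) (l₁ ν : ℝ) : Prop where
  pos : 0 < ν
  k_pos : ∀ t ∈ Ioo 0 ν, 0 < k t
  weightD_pos : ∀ t ∈ Ioo 0 ν, 0 < weightD α k t
  weightK_pos : ∀ t ∈ Ioo 0 ν, 0 < weightK α k t
  hasDerivAt_weightK : ∀ t ∈ Ioo 0 ν, HasDerivAt (weightK α k) (weightD α k t) t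
  hasDerivAt_weightD : ∀ t ∈ Ioo 0 ν, HasDerivAt (weightD α k) (deriv (weightD α k) t) t
  continuousOn_deriv : ContinuousOn (deriv (weightD α k)) (Ioo 0 ν)
  tendsto_weightK : Tendsto (weightK α k) (𝓝[>] 0) (𝓝[>] 0)
  tendsto_quot_div : Tendsto (fun t => weightK α k t / weightD α k t / t) (𝓝[>] 0) (𝓝 l₁)
  tendsto_deriv : Tendsto (fun t => weightK α k t * deriv (weightD α k) t / weightD α k t ^ 2)
    (𝓝[>] 0) (𝓝 (1 - l₁))

/-- Everything is read off Q = K/D. The limit of K D'/D² comes from Q' = 1 - K D'/D², and that of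
Q/t from L'Hôpital, which requires Q → 0, that is l₀ = 0. -/
theorem MemClassK.exists_classKOn {α : ℝ} {k : ℝ → ℝ} {l₁ : ℝ} (hk : MemClassK α k l₁) :
    ∃ ν, ClassKOn α k l₁ ν := by
  obtain ⟨ν, hν, hkpos, -, -, hkC, hint⟩ := hk.exists_interval
  obtain ⟨l₀, hl₀⟩ := hk.lim_zero
  have hDC : ContDiffOn ℝ 1 (weightD α k) (Ioo 0 ν) := by
    refine ContDiffOn.mul ?_ hkC
    exact fun t ht => (contDiffAt_rpow_const_of_ne ht.1.ne').contDiffWithinAt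
  have hDpos : ∀ t ∈ Ioo 0 ν, 0 < weightD α k t := fun t ht =>
    mul_pos (rpow_pos_of_pos ht.1 _) (hkpos t ht)
  have hDd : ∀ t ∈ Ioo 0 ν, HasDerivAt (weightD α k) (deriv (weightD α k) t) t := fun t ht =>
    ((hDC.differentiableOn one_ne_zero t ht).differentiableAt
      (Ioo_mem_nhds ht.1 ht.2)).hasDerivAt
  have hII : ∀ t ∈ Ioo 0 ν, IntervalIntegrable (weightD α k) volume 0 t := fun t ht => by
    rw [intervalIntegrable_iff_integrableOn_Ioo_of_le ht.1.le]
    exact hint.mono_set (Ioo_subset_Ioo_right ht.2.le)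
  have hKd : ∀ t ∈ Ioo 0 ν, HasDerivAt (weightK α k) (weightD α k t) t := fun t ht =>
    intervalIntegral.integral_hasDerivAt_right (hII t ht)
      (hDC.continuousOn.stronglyMeasurableAtFilter isOpen_Ioo t ht) (hDd t ht).continuousAt
  have hKpos : ∀ t ∈ Ioo 0 ν, 0 < weightK α k t := fun t ht =>
    intervalIntegral.intervalIntegral_pos_of_pos_on (hII t ht)
      (fun s hs => hDpos s ⟨hs.1, hs.2.trans ht.2⟩) ht.1
  have hν0 : ∀ᶠ t in 𝓝[>] (0 : ℝ), t ∈ Ioo 0 ν := Ioo_mem_nhdsGT hν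
  have hK0 : Tendsto (weightK α k) (𝓝[>] 0) (𝓝 0) := by
    have hν2 : ν / 2 ∈ Ioo 0 ν := ⟨by linarith, by linarith⟩
    have hc := intervalIntegral.continuousOn_primitive_interval'
      (hII _ hν2) left_mem_uIcc 0 left_mem_uIcc
    rw [ContinuousWithinAt, intervalIntegral.integral_same] at hc
    refine hc.mono_left ?_
    rw [uIcc_of_le hν2.1.le]
    exact (nhdsWithin_mono _ Ioc_subset_Icc_self).trans' (nhdsWithin_Ioc_eq_nhdsGT hν2.1).ge
  have hQ : Tendsto (fun t => weightK α k t / weightD α k t) (𝓝[>] 0) (𝓝 l₀) := hl₀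
  -- A Grönwall argument: if l₀ > 0, then K' < (2/l₀) K near 0, so K exp(-2t/l₀) is nonincreasing.
  -- It tends to 0 at 0+, which would force K ≤ 0.
  have hl₀0 : l₀ = 0 := by
    have hge : 0 ≤ l₀ := ge_of_tendsto hQ (by
      filter_upwards [hν0] with t ht using (div_pos (hKpos t ht) (hDpos t ht)).le)
    by_contra hne
    have hl : 0 < l₀ := lt_of_le_of_ne hge (Ne.symm hne)
    obtain ⟨ε, hε, hεs⟩ := mem_nhdsGT_iff_exists_Ioo_subset.1
      ((hQ.eventually (lt_mem_nhds (show l₀ / 2 < l₀ by linarith))).and hν0)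
    have hεd : ∀ t ∈ Ioo 0 ε, HasDerivAt (fun t => weightK α k t * exp (-(2 / l₀) * t))
        ((weightD α k t - 2 / l₀ * weightK α k t) * exp (-(2 / l₀) * t)) t := by
      intro t ht
      have h1 : HasDerivAt (fun t => exp (-(2 / l₀) * t))
          (exp (-(2 / l₀) * t) * (-(2 / l₀) * 1)) t := ((hasDerivAt_id t).const_mul _).exp
      refine ((hKd t (hεs ht).2).mul h1).congr_deriv ?_
      ring
    have hanti : AntitoneOn (fun t => weightK α k t * exp (-(2 / l₀) * t)) (Ioo 0 ε) := by
      refine antitoneOn_of_deriv_nonpos (convex_Ioo 0 ε)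
        (fun t ht => (hεd t ht).continuousAt.continuousWithinAt) ?_ ?_
      · rw [interior_Ioo]
        exact fun t ht => (hεd t ht).differentiableAt.differentiableWithinAt
      · rw [interior_Ioo]
        intro t ht
        rw [(hεd t ht).deriv]
        refine mul_nonpos_of_nonpos_of_nonneg ?_ (exp_pos _).le
        have h1 : l₀ / 2 < weightK α k t / weightD α k t := (hεs ht).1
        rw [lt_div_iff₀ (hDpos t (hεs ht).2)] at h1
        have : weightD α k t < 2 / l₀ * weightK α k t := by
          rw [div_mul_eq_mul_div, lt_div_iff₀ hl]
          linarith
        linarith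
    have hε0 : 0 < ε := hε
    have hε2 : ε / 2 ∈ Ioo 0 ε := ⟨by linarith, by linarith⟩
    have hlim : Tendsto (fun t => weightK α k t * exp (-(2 / l₀) * t)) (𝓝[>] 0) (𝓝 0) := by
      have h2 : Tendsto (fun t => exp (-(2 / l₀) * t)) (𝓝[>] 0) (𝓝 (exp (-(2 / l₀) * 0))) :=
        (Continuous.tendsto (by fun_prop) 0).mono_left nhdsWithin_le_nhds
      simpa using hK0.mul h2
    have : weightK α k (ε / 2) * exp (-(2 / l₀) * (ε / 2)) ≤ 0 := ge_of_tendsto hlim (by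
      filter_upwards [Ioo_mem_nhdsGT hε2.1] with t ht
      exact hanti ⟨ht.1, ht.2.trans hε2.2⟩ hε2 ht.2.le)
    exact absurd (mul_pos (hKpos _ (hεs hε2).2) (exp_pos _)) (not_lt.2 this)
  rw [hl₀0] at hQ
  have hQd : ∀ t ∈ Ioo 0 ν, HasDerivAt (quotK α k)
      (1 - weightK α k t * deriv (weightD α k) t / weightD α k t ^ 2) t := fun t ht => by
    have := (hKd t ht).div (hDd t ht) (hDpos t ht).ne'
    refine this.congr_deriv ?_
    have := (hDpos t ht).ne'
    field_simp
  have hQl : Tendsto (fun t => weightK α k t / weightD α k t / t) (𝓝[>] 0) (𝓝 l₁) := by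
    refine HasDerivAt.lhopital_zero_nhdsGT (f' := deriv (quotK α k)) (g' := fun _ => 1)
      ?_ ?_ ?_ hQ ?_ ?_
    · filter_upwards [hν0] with t ht using (hQd t ht).differentiableAt.hasDerivAt
    · exact Eventually.of_forall fun t => hasDerivAt_id t
    · exact Eventually.of_forall fun t => one_ne_zero
    · exact tendsto_nhdsWithin_of_tendsto_nhds tendsto_id
    · simpa using hk.lim_one
  refine ⟨ν, hν, hkpos, hDpos, hKpos, hKd, hDd, hDC.continuousOn_deriv_of_isOpen isOpen_Ioo
    le_rfl, tendsto_nhdsWithin_iff.2 ⟨hK0, ?_⟩, hQl, ?_⟩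
  · filter_upwards [hν0] with t ht using hKpos t ht
  · refine (hk.lim_one.const_sub 1).congr' ?_
    filter_upwards [hν0] with t ht
    rw [(hQd t ht).deriv]
    ring

namespace ClassKOn

variable {α : ℝ} {k : ℝ → ℝ} {l₁ ν : ℝ} (hK : ClassKOn α k l₁ ν)

include hK

theorem eventually_mem : ∀ᶠ t in 𝓝[>] (0 : ℝ), t ∈ Ioo 0 ν := Ioo_mem_nhdsGT hK.pos

theorem l₁_nonneg : 0 ≤ l₁ := ge_of_tendsto hK.tendsto_quot_div (by
  filter_upwards [hK.eventually_mem] with t ht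
  exact (div_pos (div_pos (hK.weightK_pos t ht) (hK.weightD_pos t ht)) ht.1).le)

/-- The logarithmic derivative of t^{1-μ} D, multiplied by K/D > 0, is (1-μ) K/(D t) + K D'/D²,
which tends to (1-μ) l₁ + 1 - l₁ = 1 - μ l₁ > 0. -/
theorem exists_monotoneOn {μ : ℝ} (hμl : μ * l₁ < 1) :
    ∃ δ, 0 < δ ∧ δ ≤ ν ∧ MonotoneOn (fun t => t ^ (1 - μ) * weightD α k t) (Ioo 0 δ) := by
  have hlim := (hK.tendsto_quot_div.const_mul (1 - μ)).add hK.tendsto_deriv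
  obtain ⟨δ, hδ, hs⟩ := mem_nhdsGT_iff_exists_Ioo_subset.1
    ((hlim.eventually (lt_mem_nhds (show 0 < (1 - μ) * l₁ + (1 - l₁) by linarith))).and
      hK.eventually_mem)
  have hd : ∀ t ∈ Ioo 0 δ, HasDerivAt (fun t => t ^ (1 - μ) * weightD α k t)
      (t ^ (1 - μ) * (weightD α k t ^ 2 / weightK α k t) *
        ((1 - μ) * (weightK α k t / weightD α k t / t) +
          weightK α k t * deriv (weightD α k) t / weightD α k t ^ 2)) t := fun t ht => by
    have htν := (hs ht).2
    have := (hasDerivAt_rpow_const (p := 1 - μ) (Or.inl ht.1.ne')).mul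
      (hK.hasDerivAt_weightD t htν)
    refine this.congr_deriv ?_
    rw [rpow_sub_one ht.1.ne']
    have e1 := (hK.weightD_pos t htν).ne'
    have e2 := (hK.weightK_pos t htν).ne'
    have e3 := ht.1.ne'
    field_simp
  refine ⟨min δ ν, lt_min hδ hK.pos, min_le_right _ _, ?_⟩
  refine MonotoneOn.mono ?_ (Ioo_subset_Ioo_right (min_le_left _ _))
  refine monotoneOn_of_deriv_nonneg (convex_Ioo 0 δ)
    (fun t ht => (hd t ht).continuousAt.continuousWithinAt) ?_ ?_
  · rw [interior_Ioo]
    exact fun t ht => (hd t ht).differentiableAt.differentiableWithinAt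
  · rw [interior_Ioo]
    intro t ht
    rw [(hd t ht).deriv]
    have htν := (hs ht).2
    have h1 := hK.weightK_pos t htν
    have h2 := hK.weightD_pos t htν
    exact mul_nonneg (mul_nonneg (rpow_nonneg ht.1.le _) (by positivity)) (hs ht).1.le

end ClassKOn

end ClassK

/-! ### Shifts in the variable t^μ -/

section Shift

/-- The shift by `s` in the variable `t ^ μ`. -/
noncomputable def powShift (μ s t : ℝ) : ℝ := (t ^ μ - s) ^ (1 / μ)

variable {μ s t : ℝ}

theorem powShift_pos (hs : s < t ^ μ) : 0 < powShift μ s t :=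
  rpow_pos_of_pos (sub_pos.2 hs) _

theorem powShift_rpow (hμ : 0 < μ) (hs : s < t ^ μ) : powShift μ s t ^ μ = t ^ μ - s := by
  rw [powShift, ← rpow_mul (sub_pos.2 hs).le, one_div_mul_cancel hμ.ne', rpow_one]

/-- From T^μ = t^μ - s, differentiation gives T^{μ-1} T' = t^{μ-1}. -/
theorem hasDerivAt_powShift (hμ : 0 < μ) (ht : 0 < t) (hs : s < t ^ μ) :
    HasDerivAt (powShift μ s) ((powShift μ s t / t) ^ (1 - μ)) t := by
  have h0 := sub_pos.2 hs
  have h := ((hasDerivAt_rpow_const (p := μ) (Or.inl ht.ne')).sub_const s).rpow_const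
    (p := 1 / μ) (Or.inl h0.ne')
  refine h.congr_deriv ?_
  rw [div_rpow (powShift_pos hs).le ht.le, powShift, ← rpow_mul h0.le,
    show 1 / μ * (1 - μ) = 1 / μ - 1 by field_simp, show μ - 1 = -(1 - μ) by ring,
    rpow_neg ht.le]
  field_simp

theorem powShift_le_self (hμ : 0 < μ) (ht : 0 < t) (hs0 : 0 ≤ s) (hs : s < t ^ μ) :
    powShift μ s t ≤ t := by
  rw [← rpow_le_rpow_iff (powShift_pos hs).le ht.le hμ, powShift_rpow hμ hs]
  linarith

theorem self_le_powShift (hμ : 0 < μ) (ht : 0 < t) (hs0 : s ≤ 0) : t ≤ powShift μ s t := by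
  have hs : s < t ^ μ := hs0.trans_lt (rpow_pos_of_pos ht _)
  rw [← rpow_le_rpow_iff ht.le (powShift_pos hs).le hμ, powShift_rpow hμ hs]
  linarith

theorem powShift_mono (hμ : 0 < μ) {t' : ℝ} (ht : 0 ≤ t) (htt : t ≤ t') (hs : s ≤ t ^ μ) :
    powShift μ s t ≤ powShift μ s t' :=
  rpow_le_rpow (sub_nonneg.2 hs) (sub_le_sub_right (rpow_le_rpow ht htt hμ.le) s)
    (by positivity)

theorem tendsto_powShift_zero (hμ : 0 < μ) (t : ℝ) :
    Tendsto (fun s => powShift μ s t) (𝓝 0) (𝓝 (powShift μ 0 t)) := by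
  have h1 : Continuous fun s : ℝ => t ^ μ - s := by fun_prop
  exact (h1.rpow_const fun _ => Or.inr (by positivity)).tendsto 0

theorem powShift_zero (hμ : 0 < μ) (ht : 0 ≤ t) : powShift μ 0 t = t := by
  rw [powShift, sub_zero, ← rpow_mul ht, mul_one_div_cancel hμ.ne', rpow_one]

theorem hasDerivAt_powShift_div (hμ : 0 < μ) (ht : 0 < t) (hs : s < t ^ μ) :
    HasDerivAt (fun t => powShift μ s t / t)
      (powShift μ s t / t * ((powShift μ s t / t) ^ (-μ) - 1) / t) t := by
  have hρ : 0 < powShift μ s t / t := div_pos (powShift_pos hs) ht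
  refine ((hasDerivAt_powShift hμ ht hs).div (hasDerivAt_id t) ht.ne').congr_deriv ?_
  simp only [id]
  rw [sub_eq_add_neg 1 μ, rpow_add hρ, rpow_one]
  field_simp

variable {p α δ : ℝ} {V V' P P' : ℝ → ℝ}

/-- The flux of the shifted profile. -/
noncomputable def shiftFlux (μ s e : ℝ) (P : ℝ → ℝ) (t : ℝ) : ℝ :=
  (powShift μ s t / t) ^ e * P (powShift μ s t)

/-- The derivative of `shiftFlux`. -/
noncomputable def shiftFluxDeriv (μ s e : ℝ) (P P' : ℝ → ℝ) (t : ℝ) : ℝ :=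
  (powShift μ s t / t) ^ (e + (1 - μ)) * P' (powShift μ s t) +
    e * ((powShift μ s t / t) ^ e * ((powShift μ s t / t) ^ (-μ) - 1) / t) *
      P (powShift μ s t)

theorem hasDerivAt_shiftFlux (hμ : 0 < μ) (ht : 0 < t) (hs : s < t ^ μ) {e : ℝ}
    (hP : HasDerivAt P (P' (powShift μ s t)) (powShift μ s t)) :
    HasDerivAt (shiftFlux μ s e P) (shiftFluxDeriv μ s e P P' t) t := by
  have hρ : 0 < powShift μ s t / t := div_pos (powShift_pos hs) ht
  have h1 := (hasDerivAt_powShift_div hμ ht hs).rpow_const (p := e) (Or.inl hρ.ne')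
  have h2 := hP.comp t (hasDerivAt_powShift hμ ht hs)
  refine (h1.mul h2).congr_deriv ?_
  rw [shiftFluxDeriv, rpow_add hρ, rpow_sub_one hρ.ne']
  simp only [Function.comp]
  have h3 := hρ.ne'
  generalize powShift μ s t / t = ρ at *
  field_simp
  ring

/-- The chain-rule factor (T/t)^{1-μ} enters the flux with power p - 1, and replacing T^α by t^α
costs (T/t)^{-α}. This explains the exponent (1-μ)(p-1) - α. -/
theorem shiftFlux_eq (ht : 0 < t) (hs : s < t ^ μ)
    (hP : P (powShift μ s t) = powShift μ s t ^ α *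
      (|V' (powShift μ s t)| ^ (p - 2) * V' (powShift μ s t))) :
    shiftFlux μ s ((1 - μ) * (p - 1) - α) P t =
      t ^ α * (|V' (powShift μ s t) * (powShift μ s t / t) ^ (1 - μ)| ^ (p - 2) *
        (V' (powShift μ s t) * (powShift μ s t / t) ^ (1 - μ))) := by
  have hT := powShift_pos hs
  have hρ : 0 < powShift μ s t / t := div_pos hT ht
  have hρ1 : 0 < (powShift μ s t / t) ^ (1 - μ) := rpow_pos_of_pos hρ _
  rw [shiftFlux, hP, abs_mul, abs_of_pos hρ1, mul_rpow (abs_nonneg _) hρ1.le, rpow_sub hρ,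
    rpow_mul hρ.le, div_rpow hT.le ht.le α]
  have h1 : ((powShift μ s t / t) ^ (1 - μ)) ^ (p - 1) =
      ((powShift μ s t / t) ^ (1 - μ)) ^ (p - 2) * (powShift μ s t / t) ^ (1 - μ) := by
    rw [← rpow_add_one hρ1.ne']
    congr 1
    ring
  rw [h1]
  have h2 := (rpow_pos_of_pos hT α).ne'
  have h3 := (rpow_pos_of_pos ht α).ne'
  field_simp

theorem continuousOn_powShift (hμ : 0 < μ) {S : Set ℝ} (hS : ∀ t ∈ S, 0 < t ∧ s < t ^ μ) :
    ContinuousOn (powShift μ s) S := fun t ht =>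
  (hasDerivAt_powShift hμ (hS t ht).1 (hS t ht).2).continuousAt.continuousWithinAt

theorem continuousOn_powShift_div (hμ : 0 < μ) {S : Set ℝ} (hS : ∀ t ∈ S, 0 < t ∧ s < t ^ μ)
    (e : ℝ) : ContinuousOn (fun t => (powShift μ s t / t) ^ e) S :=
  ((continuousOn_powShift hμ hS).div continuousOn_id fun t ht => (hS t ht).1.ne').rpow_const
    fun t ht => Or.inl (div_pos (powShift_pos (hS t ht).2) (hS t ht).1).ne'

theorem continuousOn_shiftFluxDeriv (hμ : 0 < μ) {S U : Set ℝ}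
    (hS : ∀ t ∈ S, 0 < t ∧ s < t ^ μ) (hmap : MapsTo (powShift μ s) S U)
    (hP : ContinuousOn P U) (hP' : ContinuousOn P' U) {e : ℝ} :
    ContinuousOn (shiftFluxDeriv μ s e P P') S := by
  have hT := continuousOn_powShift hμ hS
  refine ((continuousOn_powShift_div hμ hS _).mul (hP'.comp hT hmap)).add
    (ContinuousOn.mul (continuousOn_const.mul (ContinuousOn.div ?_ continuousOn_id
      fun t ht => (hS t ht).1.ne')) (hP.comp hT hmap))
  exact (continuousOn_powShift_div hμ hS _).mul
    ((continuousOn_powShift_div hμ hS _).sub continuousOn_const)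

/-- Scaling of the weight `t ^ α D(t) ^ p` when `t ^ (1 - μ) D(t)` is known at two points. -/
theorem rpow_mul_weight {T : ℝ} (hT : 0 < T) (ht : 0 < t) {D : ℝ} (hD : 0 ≤ D) :
    (T / t) ^ ((1 - μ) * (p - 1) - α + (1 - μ)) * (T ^ α * D ^ p) =
      t ^ α * ((T ^ (1 - μ) * D) / t ^ (1 - μ)) ^ p := by
  have hρ : 0 < T / t := div_pos hT ht
  rw [show (1 - μ) * (p - 1) - α + (1 - μ) = (1 - μ) * p - α by ring, rpow_sub hρ,
    rpow_mul hρ.le, div_rpow hT.le ht.le α, mul_div_right_comm (T ^ (1 - μ)),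
    ← div_rpow hT.le ht.le (1 - μ), mul_rpow (rpow_nonneg hρ.le _) hD]
  have h2 := (rpow_pos_of_pos hT α).ne'
  have h3 := (rpow_pos_of_pos ht α).ne'
  field_simp

/-- The supersolution inequality is preserved by shifting inwards. -/
theorem shiftFluxDeriv_lt (hμ : 0 < μ) (hμ1 : μ ≤ 1) (he : 0 ≤ (1 - μ) * (p - 1) - α)
    (hp : 0 ≤ p) {D : ℝ → ℝ} {C c β Y : ℝ} (ht : 0 < t) (ht1 : t ≤ 1) (hs0 : 0 ≤ s)
    (hs : s < t ^ μ)
    (hD : ∀ r, r = t ∨ r = powShift μ s t → 0 ≤ D r)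
    (hmono : powShift μ s t ^ (1 - μ) * D (powShift μ s t) ≤ t ^ (1 - μ) * D t)
    (hβ : 0 ≤ β) (hY : 0 ≤ Y) (hc : c ≤ C) (hC : 0 ≤ C) (hP : P (powShift μ s t) ≤ 0)
    (hineq : P' (powShift μ s t) + C * powShift μ s t ^ (μ - 1) * (-P (powShift μ s t)) <
      β * (powShift μ s t ^ α * D (powShift μ s t) ^ p) * Y) :
    shiftFluxDeriv μ s ((1 - μ) * (p - 1) - α) P P' t -
      c * shiftFlux μ s ((1 - μ) * (p - 1) - α) P t < β * (t ^ α * D t ^ p) * Y := by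
  set T := powShift μ s t with hTdef
  have hT : 0 < T := powShift_pos hs
  have hTt : T ≤ t := powShift_le_self hμ ht hs0 hs
  set e := (1 - μ) * (p - 1) - α with he_def
  have hρ : 0 < T / t := div_pos hT ht
  have hρ1 : T / t ≤ 1 := (div_le_one ht).2 hTt
  have hρe : 0 < (T / t) ^ e := rpow_pos_of_pos hρ e
  have hρe' : 0 < (T / t) ^ (e + (1 - μ)) := rpow_pos_of_pos hρ _
  -- The extra term from differentiating (T/t)^e has the favourable sign, because e ≥ 0, T ≤ t and P
  -- ≤ 0.
  have h1 : e * ((T / t) ^ e * ((T / t) ^ (-μ) - 1) / t) * P T ≤ 0 := by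
    refine mul_nonpos_of_nonneg_of_nonpos (mul_nonneg he (div_nonneg (mul_nonneg hρe.le ?_) ht.le))
      hP
    rw [sub_nonneg]
    exact one_le_rpow_of_pos_of_le_one_of_nonpos hρ hρ1 (by linarith)
  -- Since (T/t)^{1-μ} T^{μ-1} = t^{μ-1} ≥ 1 for t ≤ 1, the weight T^{μ-1} in `hineq` pays for the
  -- shifted curvature term.
  have h2 : (T / t) ^ e ≤ (T / t) ^ (e + (1 - μ)) * T ^ (μ - 1) := by
    rw [rpow_add hρ, mul_assoc]
    refine le_mul_of_one_le_right hρe.le ?_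
    rw [div_rpow hT.le ht.le, show μ - 1 = -(1 - μ) by ring, rpow_neg hT.le]
    have e1 : T ^ (1 - μ) / t ^ (1 - μ) * (T ^ (1 - μ))⁻¹ = (t ^ (1 - μ))⁻¹ := by
      have := (rpow_pos_of_pos hT (1 - μ)).ne'
      field_simp
    rw [e1]
    exact (one_le_inv₀ (rpow_pos_of_pos ht _)).2 (rpow_le_one ht.le ht1 (by linarith))
  have h3 : c * ((T / t) ^ e * -P T) ≤
      C * ((T / t) ^ (e + (1 - μ)) * T ^ (μ - 1) * -P T) := by
    have hPn : 0 ≤ -P T := by linarith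
    calc c * ((T / t) ^ e * -P T) ≤ C * ((T / t) ^ e * -P T) :=
          mul_le_mul_of_nonneg_right hc (mul_nonneg hρe.le hPn)
      _ ≤ _ := mul_le_mul_of_nonneg_left (mul_le_mul_of_nonneg_right h2 hPn) hC
  have h4 := mul_lt_mul_of_pos_left hineq hρe'
  have h5 : (T / t) ^ (e + (1 - μ)) * (T ^ α * D T ^ p) ≤ t ^ α * D t ^ p := by
    rw [he_def, rpow_mul_weight hT ht (hD T (Or.inr rfl))]
    refine mul_le_mul_of_nonneg_left (rpow_le_rpow ?_ ?_ hp) (rpow_nonneg ht.le _)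
    · exact div_nonneg (mul_nonneg (rpow_nonneg hT.le _) (hD T (Or.inr rfl)))
        (rpow_nonneg ht.le _)
    · rw [div_le_iff₀' (rpow_pos_of_pos ht _)]
      exact hmono
  have h6 := mul_le_mul_of_nonneg_right (mul_le_mul_of_nonneg_left h5 hβ) hY
  simp only [shiftFluxDeriv, shiftFlux, ← hTdef]
  linarith

/-- The subsolution inequality is preserved by shifting outwards. -/
theorem lt_shiftFluxDeriv (hμ : 0 < μ) (he : 0 ≤ (1 - μ) * (p - 1) - α)
    (hp : 0 ≤ p) {D : ℝ → ℝ} {c β Y : ℝ} (ht : 0 < t) (hs0 : s ≤ 0)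
    (hD : ∀ r, r = t ∨ r = powShift μ s t → 0 ≤ D r)
    (hmono : t ^ (1 - μ) * D t ≤ powShift μ s t ^ (1 - μ) * D (powShift μ s t))
    (hβ : 0 ≤ β) (hY : 0 ≤ Y) (hc : 0 ≤ c) (hP : P (powShift μ s t) ≤ 0)
    (hineq : β * (powShift μ s t ^ α * D (powShift μ s t) ^ p) * Y <
      P' (powShift μ s t)) :
    β * (t ^ α * D t ^ p) * Y < shiftFluxDeriv μ s ((1 - μ) * (p - 1) - α) P P' t -
      c * shiftFlux μ s ((1 - μ) * (p - 1) - α) P t := by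
  have hs : s < t ^ μ := hs0.trans_lt (rpow_pos_of_pos ht _)
  set T := powShift μ s t with hTdef
  have hT : 0 < T := powShift_pos hs
  have hTt : t ≤ T := self_le_powShift hμ ht hs0
  set e := (1 - μ) * (p - 1) - α with he_def
  have hρ : 0 < T / t := div_pos hT ht
  have hρ1 : 1 ≤ T / t := (one_le_div ht).2 hTt
  have hρe : 0 < (T / t) ^ e := rpow_pos_of_pos hρ e
  have hρe' : 0 < (T / t) ^ (e + (1 - μ)) := rpow_pos_of_pos hρ _
  -- Now T ≥ t, so the extra term changes sign and again helps. The curvature term in `h3` helps as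
  -- well because P ≤ 0, so `hineq` need not mention it.
  have h1 : 0 ≤ e * ((T / t) ^ e * ((T / t) ^ (-μ) - 1) / t) * P T := by
    refine mul_nonneg_of_nonpos_of_nonpos (mul_nonpos_of_nonneg_of_nonpos he
      (div_nonpos_of_nonpos_of_nonneg (mul_nonpos_of_nonneg_of_nonpos hρe.le ?_) ht.le)) hP
    rw [sub_nonpos]
    exact rpow_le_one_of_one_le_of_nonpos hρ1 (by linarith)
  have h3 : 0 ≤ c * ((T / t) ^ e * -P T) :=
    mul_nonneg hc (mul_nonneg hρe.le (by linarith))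
  have h4 := mul_lt_mul_of_pos_left hineq hρe'
  have h5 : t ^ α * D t ^ p ≤ (T / t) ^ (e + (1 - μ)) * (T ^ α * D T ^ p) := by
    rw [he_def, rpow_mul_weight hT ht (hD T (Or.inr rfl))]
    refine mul_le_mul_of_nonneg_left (rpow_le_rpow (hD t (Or.inl rfl)) ?_ hp)
      (rpow_nonneg ht.le _)
    rw [le_div_iff₀' (rpow_pos_of_pos ht _)]
    exact hmono
  have h6 := mul_le_mul_of_nonneg_right (mul_le_mul_of_nonneg_left h5 hβ) hY
  simp only [shiftFluxDeriv, shiftFlux, ← hTdef]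
  linarith

end Shift

/-! ### The candidate ξ φ(K(t)) and its flux -/

section BlowUpProfile

/-- A positive decreasing function `V` on `(0,δ)`, infinite at `0`, with derivative `V'` and flux
`P = t^α |V'|^{p-2} V'`, the flux being `C¹` with derivative `P'`. -/
structure RadialProfileOn (p α δ : ℝ) (V V' P P' : ℝ → ℝ) : Prop where
  pos : ∀ t ∈ Ioo 0 δ, 0 < V t
  anti : AntitoneOn V (Ioo 0 δ)
  tendsto : Tendsto V (𝓝[>] 0) atTop
  hasDerivAt : ∀ t ∈ Ioo 0 δ, HasDerivAt V (V' t) t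
  continuousOn_deriv : ContinuousOn V' (Ioo 0 δ)
  flux_eq : ∀ t ∈ Ioo 0 δ, P t = t ^ α * (|V' t| ^ (p - 2) * V' t)
  flux_nonpos : ∀ t ∈ Ioo 0 δ, P t ≤ 0
  hasDerivAt_flux : ∀ t ∈ Ioo 0 δ, HasDerivAt P (P' t) t
  continuousOn_flux_deriv : ContinuousOn P' (Ioo 0 δ)

variable (p α : ℝ) (f k φ : ℝ → ℝ) (ξ : ℝ)

/-- The function `ξ φ(K(t))`. -/
noncomputable def blowV (t : ℝ) : ℝ := ξ * φ (weightK α k t)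

/-- The derivative of `blowV`. -/
noncomputable def blowVDeriv (t : ℝ) : ℝ :=
  -(ξ * ((p / (p - 1) * primitiveF f (φ (weightK α k t))) ^ (1 / p) * weightD α k t))

/-- The flux of `blowV`. -/
noncomputable def blowFlux (t : ℝ) : ℝ :=
  -(ξ ^ (p - 1) * ((p / (p - 1) * primitiveF f (φ (weightK α k t))) ^ ((p - 1) / p) *
    (t ^ α * weightD α k t ^ (p - 1))))

/-- The ratio `(q F(φ(s)))^{(p-1)/p} / (f(φ(s)) s)` at `s = K(t)`. -/
noncomputable def blowRatio (t : ℝ) : ℝ :=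
  (p / (p - 1) * primitiveF f (φ (weightK α k t))) ^ ((p - 1) / p) /
    (f (φ (weightK α k t)) * weightK α k t)

/-- The factor of `f(φ(K)) t^α K'^p` in the derivative of the flux. -/
noncomputable def blowBracket (t : ℝ) : ℝ :=
  1 - blowRatio p α f k φ t * (α * (weightK α k t / weightD α k t / t) +
    (p - 1) * (weightK α k t * deriv (weightD α k) t / weightD α k t ^ 2))

/-- The derivative of `blowFlux`. -/
noncomputable def blowFluxDeriv (t : ℝ) : ℝ :=
  ξ ^ (p - 1) * (f (φ (weightK α k t)) * (t ^ α * weightD α k t ^ p)) * blowBracket p α f k φ t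

variable {p α f k φ ξ} {σ l₁ ν δ : ℝ} (hp : 1 < p) (hσ : p - 2 < σ)
  (hf : ContinuousOn f (Ici 0)) (hmono : MonotoneOn f (Ici 0))
  (hrv : IsRegularlyVarying f (σ + 1)) (hK : ClassKOn α k l₁ ν)
  (hφ : ∀ t ∈ Ioo 0 δ, 0 < φ t ∧ profileIntegral p f (φ t) = t)

include hp hσ hf hmono hrv hK hφ

/-- Since φ' = -(qF(φ))^{1/p} and q (p-1)/p = 1, the derivative of (qF(φ))^{(p-1)/p} is exactly
-f(φ). This is the 1 in the bracket; the other two terms come from t^α and D^{p-1}. -/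
theorem hasDerivAt_blowFlux {t : ℝ} (htν : t ∈ Ioo 0 ν) (htδ : weightK α k t ∈ Ioo 0 δ) :
    HasDerivAt (blowFlux p α f k φ ξ) (blowFluxDeriv p α f k φ ξ t) t := by
  have hφ0 := (hφ _ htδ).1
  have hq := qF_pos hp hf hrv hφ0
  have hD := hK.weightD_pos t htν
  have hKp := hK.weightK_pos t htν
  have ht := htν.1
  have h1 := (hasDerivAt_profile hp hσ hf hmono hrv hφ htδ).comp t (hK.hasDerivAt_weightK t htν)
  have h2 := (hasDerivAt_primitiveF hf hφ0).comp t h1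
  have h3 := (h2.const_mul (p / (p - 1))).rpow_const (p := (p - 1) / p) (Or.inl hq.ne')
  have h4 := (hK.hasDerivAt_weightD t htν).rpow_const (p := p - 1) (Or.inl hD.ne')
  have h5 := (hasDerivAt_rpow_const (p := α) (Or.inl ht.ne')).mul h4
  refine (((h3.mul h5).const_mul (ξ ^ (p - 1))).neg).congr_deriv ?_
  have hp0 : p ≠ 0 := by linarith
  have hp1 : p - 1 ≠ 0 := by linarith
  have e1 : (p / (p - 1) * primitiveF f (φ (weightK α k t))) ^ ((p - 1) / p - 1) =
      ((p / (p - 1) * primitiveF f (φ (weightK α k t))) ^ (1 / p))⁻¹ := by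
    rw [← rpow_neg hq.le]
    congr 1
    field_simp
    ring
  have e2 : weightD α k t ^ p = weightD α k t ^ (p - 1) * weightD α k t := by
    rw [← rpow_add_one hD.ne', sub_add_cancel]
  simp only [blowFluxDeriv, blowBracket, blowRatio, Function.comp, Pi.mul_apply] at *
  rw [e1, e2, rpow_sub_one ht.ne', rpow_sub_one hD.ne' (p - 1)]
  have e3 := (rpow_pos_of_pos hq (1 / p)).ne'
  have e4 := (hrv.pos _ hφ0).ne'
  have e5 := hKp.ne'
  have e6 := hD.ne'
  have e7 := ht.ne'
  generalize (p / (p - 1) * primitiveF f (φ (weightK α k t))) ^ (1 / p) = a at *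
  generalize (p / (p - 1) * primitiveF f (φ (weightK α k t))) ^ ((p - 1) / p) = b at *
  generalize weightD α k t ^ (p - 1) = d at *
  field_simp
  ring

theorem exists_radialProfileOn (hδ : 0 < δ) (hξ : 0 < ξ) :
    ∃ δ', 0 < δ' ∧ δ' ≤ ν ∧ RadialProfileOn p α δ' (blowV α k φ ξ) (blowVDeriv p α f k φ ξ)
      (blowFlux p α f k φ ξ) (blowFluxDeriv p α f k φ ξ) := by
  obtain ⟨ε, hε, hεs⟩ := mem_nhdsGT_iff_exists_Ioo_subset.1
    (hK.tendsto_weightK.eventually (Ioo_mem_nhdsGT hδ))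
  have hmem : ∀ t ∈ Ioo 0 (min ε ν), t ∈ Ioo 0 ν ∧ weightK α k t ∈ Ioo 0 δ := fun t ht =>
    ⟨⟨ht.1, ht.2.trans_le (min_le_right _ _)⟩, hεs ⟨ht.1, ht.2.trans_le (min_le_left _ _)⟩⟩
  have hmap : MapsTo (weightK α k) (Ioo 0 (min ε ν)) (Ioo 0 δ) := fun t ht => (hmem t ht).2
  have hsub : Ioo 0 (min ε ν) ⊆ Ioo 0 ν := fun t ht => (hmem t ht).1
  have hKc : ContinuousOn (weightK α k) (Ioo 0 (min ε ν)) := fun t ht =>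
    (hK.hasDerivAt_weightK t (hsub ht)).continuousAt.continuousWithinAt
  have hDc : ContinuousOn (weightD α k) (Ioo 0 (min ε ν)) := fun t ht =>
    (hK.hasDerivAt_weightD t (hsub ht)).continuousAt.continuousWithinAt
  have hφK : ContinuousOn (fun t => φ (weightK α k t)) (Ioo 0 (min ε ν)) :=
    (continuousOn_profile hp hσ hf hmono hrv hφ).comp hKc hmap
  have hφKpos : ∀ t ∈ Ioo 0 (min ε ν), 0 < φ (weightK α k t) := fun t ht => (hφ _ (hmap ht)).1
  have hqF : ContinuousOn (fun t => p / (p - 1) * primitiveF f (φ (weightK α k t)))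
      (Ioo 0 (min ε ν)) :=
    continuousOn_const.mul ((continuousOn_primitiveF hf).comp hφK hφKpos)
  have hqFr : ∀ r : ℝ, ContinuousOn (fun t => (p / (p - 1) *
      primitiveF f (φ (weightK α k t))) ^ r) (Ioo 0 (min ε ν)) := fun r =>
    hqF.rpow_const fun t ht => Or.inl (qF_pos hp hf hrv (hφKpos t ht)).ne'
  have htr : ∀ r : ℝ, ContinuousOn (fun t : ℝ => t ^ r) (Ioo 0 (min ε ν)) := fun r =>
    continuousOn_id.rpow_const fun t ht => Or.inl ht.1.ne'
  have hDr : ∀ r : ℝ, ContinuousOn (fun t : ℝ => weightD α k t ^ r) (Ioo 0 (min ε ν)) :=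
    fun r => hDc.rpow_const fun t ht => Or.inl (hK.weightD_pos t (hsub ht)).ne'
  have hfφ : ContinuousOn (fun t => f (φ (weightK α k t))) (Ioo 0 (min ε ν)) :=
    hf.comp hφK fun t ht => (hφKpos t ht).le
  have hVd : ∀ t ∈ Ioo 0 (min ε ν), HasDerivAt (blowV α k φ ξ) (blowVDeriv p α f k φ ξ t) t := by
    intro t ht
    have := ((hasDerivAt_profile hp hσ hf hmono hrv hφ (hmap ht)).comp t
      (hK.hasDerivAt_weightK t (hsub ht))).const_mul ξ
    refine this.congr_deriv ?_
    rw [blowVDeriv]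
    ring
  have hVneg : ∀ t ∈ Ioo 0 (min ε ν), 0 < ξ * ((p / (p - 1) *
      primitiveF f (φ (weightK α k t))) ^ (1 / p) * weightD α k t) := fun t ht =>
    mul_pos hξ (mul_pos (rpow_pos_of_pos (qF_pos hp hf hrv (hφKpos t ht)) _)
      (hK.weightD_pos t (hsub ht)))
  refine ⟨min ε ν, lt_min hε hK.pos, min_le_right _ _, ?_, ?_, ?_, hVd, ?_, ?_, ?_, ?_, ?_⟩
  · exact fun t ht => mul_pos hξ (hφKpos t ht)
  · refine antitoneOn_of_deriv_nonpos (convex_Ioo _ _)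
      (fun t ht => (hVd t ht).continuousAt.continuousWithinAt) ?_ ?_
    · rw [interior_Ioo]
      exact fun t ht => (hVd t ht).differentiableAt.differentiableWithinAt
    · rw [interior_Ioo]
      intro t ht
      rw [(hVd t ht).deriv, blowVDeriv]
      exact neg_nonpos.2 (hVneg t ht).le
  · exact ((tendsto_profile hp hσ hf hmono hrv hδ hφ).comp hK.tendsto_weightK).const_mul_atTop hξ
  · exact (continuousOn_const.mul ((hqFr _).mul hDc)).neg
  · intro t ht
    have hq := qF_pos hp hf hrv (hφKpos t ht)
    have hD := hK.weightD_pos t (hsub ht)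
    have h0 := hVneg t ht
    rw [blowFlux, blowVDeriv, abs_neg, abs_of_pos h0, mul_neg, mul_neg]
    have h1 : ∀ y : ℝ, 0 < y → y ^ (p - 2) * y = y ^ (p - 1) := fun y hy => by
      rw [← rpow_add_one hy.ne']
      congr 1
      ring
    have hqr := rpow_pos_of_pos hq (1 / p)
    rw [h1 _ h0, mul_rpow hξ.le (mul_pos hqr hD).le, mul_rpow hqr.le hD.le, ← rpow_mul hq.le,
      one_div_mul_eq_div]
    ring
  · intro t ht
    have hq := qF_pos hp hf hrv (hφKpos t ht)
    have hD := hK.weightD_pos t (hsub ht)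
    exact neg_nonpos.2 (mul_nonneg (rpow_nonneg hξ.le _) (mul_nonneg (rpow_nonneg hq.le _)
      (mul_nonneg (rpow_nonneg ht.1.le _) (rpow_nonneg hD.le _))))
  · exact fun t ht => hasDerivAt_blowFlux hp hσ hf hmono hrv hK hφ (hsub ht) (hmap ht)
  · refine (continuousOn_const.mul (hfφ.mul ((htr α).mul (hDr p)))).mul
      (continuousOn_const.sub (ContinuousOn.mul ?_ ?_))
    · exact (hqFr _).div (hfφ.mul hKc) fun t ht =>
        (mul_pos (hrv.pos _ (hφKpos t ht)) (hmap ht).1).ne'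
    · refine (continuousOn_const.mul ((hKc.div hDc ?_).div continuousOn_id ?_)).add
        (continuousOn_const.mul ((hKc.mul (hK.continuousOn_deriv.mono hsub)).div (hDc.pow 2) ?_))
      · exact fun t ht => (hK.weightD_pos t (hsub ht)).ne'
      · exact fun t ht => ht.1.ne'
      · exact fun t ht => pow_ne_zero 2 (hK.weightD_pos t (hsub ht)).ne'

theorem tendsto_blowRatio (hδ : 0 < δ) : Tendsto (blowRatio p α f k φ) (𝓝[>] 0)
    (𝓝 ((2 + σ - p) / ((p - 1) * (2 + σ)))) :=
  (tendsto_profile_ratio hp hσ hf hmono hrv hδ hφ).comp hK.tendsto_weightK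

theorem tendsto_blowBracket (hδ : 0 < δ) : Tendsto (blowBracket p α f k φ) (𝓝[>] 0)
    (𝓝 ((p + l₁ * (1 - α / (p - 1)) * (2 + σ - p)) / (2 + σ))) := by
  have h := ((tendsto_blowRatio hp hσ hf hmono hrv hK hφ hδ).mul
    ((hK.tendsto_quot_div.const_mul α).add (hK.tendsto_deriv.const_mul (p - 1)))).const_sub 1
  have e1 : p - 1 ≠ 0 := by linarith
  have e2 : 2 + σ ≠ 0 := by linarith
  have e3 : (p + l₁ * (1 - α / (p - 1)) * (2 + σ - p)) / (2 + σ) =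
      1 - (2 + σ - p) / ((p - 1) * (2 + σ)) * (α * l₁ + (p - 1) * (1 - l₁)) := by
    field_simp
    ring
  rw [e3]
  exact h

/-- After division by f(φ(K)) t^α D^p the curvature term becomes C ξ^{p-1} R · K/(D t) · t^μ, which
tends to 0 despite the factor t^{μ-1}. The remaining limits are the two sides of `hβ`. -/
theorem eventually_blowFluxDeriv_lt (hδ : 0 < δ) (hξ : 0 < ξ) {μ : ℝ} (hμ : 0 < μ) (C : ℝ)
    {β : ℝ} (hβ : ξ ^ (p - 1) * ((p + l₁ * (1 - α / (p - 1)) * (2 + σ - p)) / (2 + σ)) <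
      β * ξ ^ (σ + 1)) :
    ∀ᶠ t in 𝓝[>] 0, blowFluxDeriv p α f k φ ξ t +
        C * t ^ (μ - 1) * (-blowFlux p α f k φ ξ t) <
      β * (t ^ α * weightD α k t ^ p) * f (blowV α k φ ξ t) := by
  have htμ : Tendsto (fun t : ℝ => t ^ μ) (𝓝[>] 0) (𝓝 0) := by
    have : ContinuousAt (fun t : ℝ => t ^ μ) 0 := continuousAt_rpow_const 0 μ (Or.inr hμ.le)
    have h := this.tendsto
    rw [zero_rpow hμ.ne'] at h
    exact h.mono_left nhdsWithin_le_nhds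
  have h1 := ((tendsto_blowBracket hp hσ hf hmono hrv hK hφ hδ).add
    ((((tendsto_blowRatio hp hσ hf hmono hrv hK hφ hδ).mul
      hK.tendsto_quot_div).mul htμ).const_mul C)).const_mul (ξ ^ (p - 1))
  rw [mul_zero, mul_zero, add_zero] at h1
  have h2 := ((hrv.lim ξ hξ).comp ((tendsto_profile hp hσ hf hmono hrv hδ hφ).comp
    hK.tendsto_weightK)).const_mul β
  filter_upwards [h1.eventually_lt h2 hβ, hK.eventually_mem,
    hK.tendsto_weightK.eventually (Ioo_mem_nhdsGT hδ)] with t ht htν htδ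
  have hφ0 := (hφ _ htδ).1
  have hfp := hrv.pos _ hφ0
  have hD := hK.weightD_pos t htν
  have hKp := hK.weightK_pos t htν
  have hB : 0 < f (φ (weightK α k t)) * (t ^ α * weightD α k t ^ p) :=
    mul_pos hfp (mul_pos (rpow_pos_of_pos htν.1 _) (rpow_pos_of_pos hD _))
  have h3 := mul_lt_mul_of_pos_right ht hB
  have e2 : weightD α k t ^ p = weightD α k t ^ (p - 1) * weightD α k t := by
    rw [← rpow_add_one hD.ne', sub_add_cancel]
  have e4 := hfp.ne'
  have e5 := hKp.ne'
  have e6 := hD.ne'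
  have e7 := htν.1.ne'
  refine lt_of_eq_of_lt ?_ (h3.trans_eq ?_)
  · simp only [blowFluxDeriv, blowFlux, blowRatio]
    rw [e2, rpow_sub_one e7]
    field_simp
  · simp only [Function.comp, blowV]
    field_simp

theorem eventually_lt_blowFluxDeriv (hδ : 0 < δ) (hξ : 0 < ξ)
    {β : ℝ} (hβ : β * ξ ^ (σ + 1) <
      ξ ^ (p - 1) * ((p + l₁ * (1 - α / (p - 1)) * (2 + σ - p)) / (2 + σ))) :
    ∀ᶠ t in 𝓝[>] 0, β * (t ^ α * weightD α k t ^ p) * f (blowV α k φ ξ t) <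
      blowFluxDeriv p α f k φ ξ t := by
  have h1 := (tendsto_blowBracket hp hσ hf hmono hrv hK hφ hδ).const_mul (ξ ^ (p - 1))
  have h2 := ((hrv.lim ξ hξ).comp ((tendsto_profile hp hσ hf hmono hrv hδ hφ).comp
    hK.tendsto_weightK)).const_mul β
  filter_upwards [h2.eventually_lt h1 hβ, hK.eventually_mem,
    hK.tendsto_weightK.eventually (Ioo_mem_nhdsGT hδ)] with t ht htν htδ
  have hfp := hrv.pos _ (hφ _ htδ).1
  have hB : 0 < f (φ (weightK α k t)) * (t ^ α * weightD α k t ^ p) :=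
    mul_pos hfp (mul_pos (rpow_pos_of_pos htν.1 _) (rpow_pos_of_pos (hK.weightD_pos t htν) _))
  have h3 := mul_lt_mul_of_pos_right ht hB
  refine lt_of_eq_of_lt ?_ (h3.trans_eq ?_)
  · simp only [Function.comp, blowV]
    have e4 := hfp.ne'
    field_simp
  · simp only [blowFluxDeriv]
    ring

end BlowUpProfile

/-! ### Comparison of a large solution with shifted profiles -/

section Comparison

theorem nonneg_of_pos_Ioi {f : ℝ → ℝ} (hf : ContinuousOn f (Ici 0))
    (hpos : ∀ u, 0 < u → 0 < f u) {u : ℝ} (hu : 0 ≤ u) : 0 ≤ f u := by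
  rcases hu.eq_or_lt with rfl | h
  · have h1 : Tendsto f (𝓝[>] 0) (𝓝 (f 0)) :=
      (hf 0 self_mem_Ici).mono_left (nhdsWithin_mono _ Ioi_subset_Ici_self)
    exact ge_of_tendsto h1 (by filter_upwards [self_mem_nhdsWithin] with t ht using (hpos t ht).le)
  · exact (hpos u h).le

variable {N : ℕ} (hN : 2 ≤ N) {x₀ : EuclideanSpace ℝ (Fin N)} {p α β μ δ : ℝ} (hp : 1 < p)
  {b : EuclideanSpace ℝ (Fin N) → ℝ} (hb : ContinuousOn b (Metric.ball x₀ 1))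
  (hb0 : ∀ x ∈ Metric.ball x₀ 1, 0 < b x)
  {f : ℝ → ℝ} (hf : ContinuousOn f (Ici 0)) (hmono : MonotoneOn f (Ici 0))
  (hpos : ∀ u, 0 < u → 0 < f u) {u : EuclideanSpace ℝ (Fin N) → ℝ}
  (hu : IsLargeSolution x₀ p α b f u) (hδ : 0 < δ) (hδ1 : δ ≤ 1 / 2)
  {V V' P P' D : ℝ → ℝ} (hV : RadialProfileOn p α δ V V' P P')
  (hμ : 0 < μ) (hμ1 : μ ≤ 1) (he : 0 ≤ (1 - μ) * (p - 1) - α)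
  (hD : ∀ t ∈ Ioo 0 δ, 0 < D t) (hDmono : MonotoneOn (fun t => t ^ (1 - μ) * D t) (Ioo 0 δ))
  (hβ : 0 < β)

include hN hp hb hb0 hf hmono hpos hu hδ hδ1 hV hμ hμ1 he hD hDmono hβ

/-- For s > 0 the shifted profile is infinite on the inner sphere d = s^{1/μ}, near which u is
bounded, and C₀ dominates u on d ≥ δ/2. Both edges of the annulus are thus controlled. -/
theorem IsLargeSolution.le_shifted
    (hineq : ∀ t ∈ Ioo 0 δ, P' t + 2 * N * t ^ (μ - 1) * (-P t) < β * (t ^ α * D t ^ p) * f (V t))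
    (hbβ : ∀ x ∈ Metric.ball x₀ 1, bdist x₀ x < δ →
      β * (bdist x₀ x ^ α * D (bdist x₀ x) ^ p) ≤ b x)
    {C₀ : ℝ} (hC₀ : 0 ≤ C₀) (hC : ∀ x ∈ Metric.ball x₀ 1, δ / 2 ≤ bdist x₀ x → u x ≤ C₀)
    {s : ℝ} (hs : 0 < s) {x : EuclideanSpace ℝ (Fin N)} (hx : x ∈ Metric.ball x₀ 1)
    (hxδ : bdist x₀ x < δ) (hsx : s < bdist x₀ x ^ μ) :
    u x ≤ V (powShift μ s (bdist x₀ x)) + C₀ := by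
  set a := s ^ (1 / μ) with ha
  have ha0 : 0 < a := rpow_pos_of_pos hs _
  have haμ : a ^ μ = s := by rw [ha, ← rpow_mul hs.le, one_div_mul_cancel hμ.ne', rpow_one]
  have hat : ∀ t, 0 ≤ t → (a < t ↔ s < t ^ μ) := fun t ht => by
    rw [← rpow_lt_rpow_iff ha0.le ht hμ, haμ]
  have hd0 : ∀ y, 0 ≤ bdist x₀ y := fun y => Metric.infDist_nonneg
  have hmem : ∀ t ∈ Ioo a δ, 0 < t ∧ s < t ^ μ := fun t ht =>
    ⟨ha0.trans ht.1, (hat t (ha0.trans ht.1).le).1 ht.1⟩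
  have hmap : MapsTo (powShift μ s) (Ioo a δ) (Ioo 0 δ) := fun t ht =>
    ⟨powShift_pos (hmem t ht).2,
      (powShift_le_self hμ (hmem t ht).1 hs.le (hmem t ht).2).trans_lt ht.2⟩
  have hTc : ContinuousOn (powShift μ s) (Ioo a δ) := continuousOn_powShift hμ hmem
  have hPc : ContinuousOn P (Ioo 0 δ) := fun t ht =>
    (hV.hasDerivAt_flux t ht).continuousAt.continuousWithinAt
  -- near the inner boundary
  obtain ⟨M, hM⟩ : ∃ M, ∀ y ∈ Metric.closedBall x₀ (1 - a), ‖u y‖ ≤ M :=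
    (isCompact_closedBall x₀ (1 - a)).exists_bound_of_continuousOn
      (hu.sol.1.mono (Metric.closedBall_subset_ball (by linarith)))
  obtain ⟨η, hη, hηV⟩ := mem_nhdsGT_iff_exists_Ioo_subset.1 (hV.tendsto.eventually_ge_atTop M)
  have hη0 : 0 < η := hη
  -- Chosen so that t < lo means T < η, where V(T) already exceeds the bound M for u.
  set lo := (s + η ^ μ) ^ (1 / μ) with hlo
  have hsη : 0 < s + η ^ μ := add_pos hs (rpow_pos_of_pos hη0 _)
  have halo : a < lo := rpow_lt_rpow hs.le (by linarith [rpow_pos_of_pos hη0 μ]) (by positivity)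
  have hmain := radial_comparison (ε := 1) (a := a) (lo := lo) (hi := δ / 2) (c := δ)
    (W := fun t => V (powShift μ s t) + C₀)
    (W' := fun t => V' (powShift μ s t) * (powShift μ s t / t) ^ (1 - μ))
    (P := shiftFlux μ s ((1 - μ) * (p - 1) - α) P)
    (P' := shiftFluxDeriv μ s ((1 - μ) * (p - 1) - α) P P')
    hN hp hb hf hu.sol hu.nonneg ha0.le halo (by linarith) (by linarith)
    (fun t ht => ((hV.hasDerivAt _ (hmap ht)).comp t
      (hasDerivAt_powShift hμ (hmem t ht).1 (hmem t ht).2)).add_const C₀)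
    ((hV.continuousOn_deriv.comp hTc hmap).mul (continuousOn_powShift_div hμ hmem _))
    (fun t ht => shiftFlux_eq (hmem t ht).1 (hmem t ht).2 (hV.flux_eq _ (hmap ht)))
    (fun t ht => hasDerivAt_shiftFlux hμ (hmem t ht).1 (hmem t ht).2
      (hV.hasDerivAt_flux _ (hmap ht)))
    (continuousOn_shiftFluxDeriv hμ hmem hmap hPc hV.continuousOn_flux_deriv)
    (one_mul 1) ?_ ?_ x hx ⟨(hat _ (hd0 x)).2 hsx, hxδ⟩
  · linarith
  · intro y hy hyd hyK
    have hT := hmap hyd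
    rw [one_mul, sub_nonpos]
    rcases lt_or_ge (bdist x₀ y) lo with h | h
    · have hTη : powShift μ s (bdist x₀ y) < η := by
        rw [← rpow_lt_rpow_iff hT.1.le hη0.le hμ, powShift_rpow hμ (hmem _ hyd).2]
        have := rpow_lt_rpow (hd0 y) h hμ
        rw [hlo, ← rpow_mul hsη.le, one_div_mul_cancel hμ.ne', rpow_one] at this
        linarith
      have h1 : M ≤ V (powShift μ s (bdist x₀ y)) := hηV ⟨hT.1, hTη⟩
      have h2 := hM y (by
        rw [mem_closedBall_iff_norm]
        have := hyd.1
        rw [bdist_eq hN hy] at this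
        linarith)
      linarith [le_abs_self (u y), Real.norm_eq_abs (u y)]
    · have h1 : δ / 2 ≤ bdist x₀ y := by
        by_contra hcon
        exact hyK ⟨h, (not_le.1 hcon).le⟩
      linarith [hC y hy h1, hV.pos _ hT]
  · intro y hy hyd hyp
    have hT := hmap hyd
    have ht := hmem _ hyd
    rw [one_mul] at hyp ⊢
    have hle := powShift_le_self hμ ht.1 hs.le ht.2
    have hd1 : bdist x₀ y ≤ 1 := by linarith [hyd.2]
    have hN1 : (1 : ℝ) ≤ N := by exact_mod_cast (by omega : 1 ≤ N)
    -- As d < δ ≤ 1/2, the denominator exceeds 1/2.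
    have hc : ((N : ℝ) - 1) / (1 - bdist x₀ y) ≤ 2 * N := by
      rw [div_le_iff₀ (by linarith [hyd.2])]
      nlinarith [hyd.2]
    have h1 := shiftFluxDeriv_lt (P := P) (P' := P') (D := D) (C := 2 * N) (p := p) (α := α)
      (β := β) (Y := f (V (powShift μ s (bdist x₀ y)))) hμ hμ1 he
      (by linarith) ht.1 hd1 hs.le ht.2
      (by rintro r (rfl | rfl)
          · exact (hD _ ⟨ht.1, hyd.2⟩).le
          · exact (hD _ hT).le)
      (hDmono hT ⟨ht.1, hyd.2⟩ hle) hβ.le (hpos _ (hV.pos _ hT)).le hc (by positivity)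
      (hV.flux_nonpos _ hT) (hineq _ hT)
    -- Where u exceeds V(T) + C₀ with C₀ ≥ 0 it exceeds V(T), so the added constant does no harm.
    have h2 : f (V (powShift μ s (bdist x₀ y))) ≤ f (u y) :=
      hmono (hV.pos _ hT).le (hu.nonneg y hy) (by linarith)
    have h3 := mul_le_mul (hbβ y hy hyd.2) h2 (hpos _ (hV.pos _ hT)).le (hb0 y hy).le
    linarith

/-- The constant in `IsLargeSolution.le_shifted` does not depend on s, so s may tend to 0+. -/
theorem IsLargeSolution.exists_le_add
    (hineq : ∀ t ∈ Ioo 0 δ, P' t + 2 * N * t ^ (μ - 1) * (-P t) < β * (t ^ α * D t ^ p) * f (V t))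
    (hbβ : ∀ x ∈ Metric.ball x₀ 1, bdist x₀ x < δ →
      β * (bdist x₀ x ^ α * D (bdist x₀ x) ^ p) ≤ b x) :
    ∃ C₀, ∀ x ∈ Metric.ball x₀ 1, bdist x₀ x < δ → u x ≤ V (bdist x₀ x) + C₀ := by
  obtain ⟨M, hM⟩ : ∃ M, ∀ y ∈ Metric.closedBall x₀ (1 - δ / 2), ‖u y‖ ≤ M :=
    (isCompact_closedBall x₀ (1 - δ / 2)).exists_bound_of_continuousOn
      (hu.sol.1.mono (Metric.closedBall_subset_ball (by linarith)))
  refine ⟨max M 0, fun x hx hxδ => ?_⟩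
  have hd : 0 < bdist x₀ x := by
    rw [bdist_eq hN hx]
    rw [mem_ball_iff_norm] at hx
    linarith
  have hlim : Tendsto (fun s => V (powShift μ s (bdist x₀ x)) + max M 0) (𝓝[>] 0)
      (𝓝 (V (bdist x₀ x) + max M 0)) := by
    have h1 := (tendsto_powShift_zero hμ (bdist x₀ x)).mono_left
      (nhdsWithin_le_nhds (s := Ioi 0))
    rw [powShift_zero hμ hd.le] at h1
    exact ((hV.hasDerivAt _ ⟨hd, hxδ⟩).continuousAt.tendsto.comp h1).add_const _
  refine ge_of_tendsto hlim ?_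
  filter_upwards [Ioo_mem_nhdsGT (rpow_pos_of_pos hd μ)] with s hs
  refine IsLargeSolution.le_shifted hN hp hb hb0 hf hmono hpos hu hδ hδ1 hV hμ hμ1 he hD hDmono hβ
    hineq hbβ (le_max_right _ _) (fun y hy hyd => ?_) hs.1 hx hxδ hs.2
  refine (le_abs_self _).trans ((hM y ?_).trans (le_max_left _ _))
  rw [mem_closedBall_iff_norm]
  rw [bdist_eq hN hy] at hyd
  linarith

omit hδ hμ1 in
-- For s < 0 the shifted profile stays bounded at d = 0, where u → ∞. On d ≥ δ/2 subtracting V(δ/2)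
-- makes it nonpositive, hence at most u.
theorem IsLargeSolution.shifted_le
    (hineq : ∀ t ∈ Ioo 0 δ, β * (t ^ α * D t ^ p) * f (V t) < P' t)
    (hbβ : ∀ x ∈ Metric.ball x₀ 1, bdist x₀ x < δ →
      b x ≤ β * (bdist x₀ x ^ α * D (bdist x₀ x) ^ p))
    {s c : ℝ} (hs : s < 0) (hc : δ / 2 < c) (hcδ : c < δ) (hTc : powShift μ s c < δ)
    {x : EuclideanSpace ℝ (Fin N)} (hx : x ∈ Metric.ball x₀ 1) (hxc : bdist x₀ x < c) :
    V (powShift μ s (bdist x₀ x)) - V (δ / 2) ≤ u x := by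
  have hd0 : ∀ y ∈ Metric.ball x₀ 1, 0 < bdist x₀ y := fun y hy => by
    rw [bdist_eq hN hy]
    rw [mem_ball_iff_norm] at hy
    linarith
  have hmem : ∀ t ∈ Ioo 0 c, 0 < t ∧ s < t ^ μ := fun t ht =>
    ⟨ht.1, hs.trans (rpow_pos_of_pos ht.1 _)⟩
  have hmap : MapsTo (powShift μ s) (Ioo 0 c) (Ioo 0 δ) := fun t ht =>
    ⟨powShift_pos (hmem t ht).2,
      (powShift_mono hμ ht.1.le ht.2.le (hmem t ht).2.le).trans_lt hTc⟩
  have hTcont : ContinuousOn (powShift μ s) (Ioo 0 c) := continuousOn_powShift hμ hmem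
  have hPc : ContinuousOn P (Ioo 0 δ) := fun t ht =>
    (hV.hasDerivAt_flux t ht).continuousAt.continuousWithinAt
  have hδ2 : δ / 2 ∈ Ioo 0 δ := ⟨by linarith, by linarith⟩
  have h00 : s < (0 : ℝ) ^ μ := by rwa [zero_rpow hμ.ne']
  have hT0 : powShift μ s 0 ∈ Ioo 0 δ :=
    ⟨powShift_pos h00, (powShift_mono hμ le_rfl (hδ2.1.trans hc).le h00.le).trans_lt hTc⟩
  -- The finite value at T(0) bounds V(T) by monotonicity; near the boundary u is above it.
  obtain ⟨lo, hlo, hloV⟩ := eventually_toBoundary_iff.1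
    (hu.blowup.eventually_ge_atTop (V (powShift μ s 0)))
  have hmain := radial_comparison (ε := -1) (a := 0) (lo := lo) (hi := δ / 2) (c := c)
    (W := fun t => V (powShift μ s t) - V (δ / 2))
    (W' := fun t => V' (powShift μ s t) * (powShift μ s t / t) ^ (1 - μ))
    (P := shiftFlux μ s ((1 - μ) * (p - 1) - α) P)
    (P' := shiftFluxDeriv μ s ((1 - μ) * (p - 1) - α) P P')
    hN hp hb hf hu.sol hu.nonneg le_rfl hlo hc (by linarith)
    (fun t ht => ((hV.hasDerivAt _ (hmap ht)).comp t
      (hasDerivAt_powShift hμ (hmem t ht).1 (hmem t ht).2)).sub_const _)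
    ((hV.continuousOn_deriv.comp hTcont hmap).mul (continuousOn_powShift_div hμ hmem _))
    (fun t ht => shiftFlux_eq (hmem t ht).1 (hmem t ht).2 (hV.flux_eq _ (hmap ht)))
    (fun t ht => hasDerivAt_shiftFlux hμ (hmem t ht).1 (hmem t ht).2
      (hV.hasDerivAt_flux _ (hmap ht)))
    (continuousOn_shiftFluxDeriv hμ hmem hmap hPc hV.continuousOn_flux_deriv)
    (by norm_num) ?_ ?_ x hx ⟨hd0 x hx, hxc⟩
  · linarith
  · intro y hy hyd hyK
    have hT := hmap hyd
    rcases lt_or_ge (bdist x₀ y) lo with h | h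
    · have h1 : V (powShift μ s (bdist x₀ y)) ≤ V (powShift μ s 0) :=
        hV.anti hT0 hT (powShift_mono hμ le_rfl hyd.1.le h00.le)
      linarith [hloV y hy h, hV.pos _ hδ2]
    · have h1 : δ / 2 ≤ bdist x₀ y := by
        by_contra hcon
        exact hyK ⟨h, (not_le.1 hcon).le⟩
      have h2 := hV.anti hδ2 hT (h1.trans (self_le_powShift hμ hyd.1 hs.le))
      linarith [hu.nonneg y hy]
  · intro y hy hyd hyp
    have hT := hmap hyd
    have hyδ : bdist x₀ y ∈ Ioo 0 δ := ⟨hyd.1, hyd.2.trans hcδ⟩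
    have hle := self_le_powShift hμ hyd.1 hs.le
    have hN1 : (1 : ℝ) ≤ N := by exact_mod_cast (by omega : 1 ≤ N)
    have hc : 0 ≤ ((N : ℝ) - 1) / (1 - bdist x₀ y) :=
      div_nonneg (by linarith) (by linarith [hyδ.2])
    have h1 := lt_shiftFluxDeriv (P := P) (P' := P') (D := D) (p := p) (α := α)
      (β := β) (Y := f (V (powShift μ s (bdist x₀ y)))) hμ he
      (by linarith) hyd.1 hs.le
      (by rintro r (rfl | rfl)
          · exact (hD _ hyδ).le
          · exact (hD _ hT).le)
      (hDmono hyδ hT hle) hβ.le (hpos _ (hV.pos _ hT)).le hc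
      (hV.flux_nonpos _ hT) (hineq _ hT)
    have h2 : f (u y) ≤ f (V (powShift μ s (bdist x₀ y))) :=
      hmono (hu.nonneg y hy) (hV.pos _ hT).le (by linarith [hV.pos _ hδ2])
    have h3 := mul_le_mul (hbβ y hy hyδ.2) h2
      (nonneg_of_pos_Ioi hf hpos (hu.nonneg y hy)) ((hb0 y hy).le.trans (hbβ y hy hyδ.2))
    linarith

omit hδ hμ1 in
theorem IsLargeSolution.exists_sub_le
    (hineq : ∀ t ∈ Ioo 0 δ, β * (t ^ α * D t ^ p) * f (V t) < P' t)
    (hbβ : ∀ x ∈ Metric.ball x₀ 1, bdist x₀ x < δ →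
      b x ≤ β * (bdist x₀ x ^ α * D (bdist x₀ x) ^ p)) :
    ∃ C₀, ∀ x ∈ Metric.ball x₀ 1, bdist x₀ x < δ / 2 → V (bdist x₀ x) - C₀ ≤ u x := by
  refine ⟨V (δ / 2), fun x hx hxδ => ?_⟩
  have hd : 0 < bdist x₀ x := by
    rw [bdist_eq hN hx]
    rw [mem_ball_iff_norm] at hx
    linarith
  have hlim : Tendsto (fun s => V (powShift μ s (bdist x₀ x)) - V (δ / 2)) (𝓝[<] 0)
      (𝓝 (V (bdist x₀ x) - V (δ / 2))) := by
    have h1 := (tendsto_powShift_zero hμ (bdist x₀ x)).mono_left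
      (nhdsWithin_le_nhds (s := Iio 0))
    rw [powShift_zero hμ hd.le] at h1
    exact ((hV.hasDerivAt _ ⟨hd, by linarith⟩).continuousAt.tendsto.comp h1).sub_const _
  refine le_of_tendsto hlim ?_
  -- Any c strictly between δ/2 and δ works once |s| is small enough that the shift of c stays below
  -- δ.
  have hc := (tendsto_powShift_zero hμ (3 * δ / 4)).mono_left (nhdsWithin_le_nhds (s := Iio 0))
  rw [powShift_zero hμ (by linarith)] at hc
  filter_upwards [self_mem_nhdsWithin, hc.eventually (gt_mem_nhds (show 3 * δ / 4 < δ by linarith))]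
    with s hs hsδ
  exact IsLargeSolution.shifted_le hN hp hb hb0 hf hmono hpos hu hδ1 hV hμ he hD hDmono hβ
    hineq hbβ hs (c := 3 * δ / 4) (by linarith) (by linarith) hsδ hx (by linarith)

end Comparison

/-! ### Choice of constants and the blow-up rate -/

section BlowUpRate

theorem RadialProfileOn.mono {p α δ δ' : ℝ} {V V' P P' : ℝ → ℝ}
    (h : RadialProfileOn p α δ V V' P P') (hle : δ' ≤ δ) : RadialProfileOn p α δ' V V' P P' := by
  have hs : Ioo 0 δ' ⊆ Ioo 0 δ := Ioo_subset_Ioo_right hle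
  exact ⟨fun t ht => h.pos t (hs ht), h.anti.mono hs, h.tendsto,
    fun t ht => h.hasDerivAt t (hs ht), h.continuousOn_deriv.mono hs,
    fun t ht => h.flux_eq t (hs ht), fun t ht => h.flux_nonpos t (hs ht),
    fun t ht => h.hasDerivAt_flux t (hs ht), h.continuousOn_flux_deriv.mono hs⟩

/-- There is an exponent `μ` for which shifts in the variable `t ^ μ` preserve the monotonicity
of the weights. -/
theorem exists_shift_exponent {p α l₁ : ℝ} (hp : 1 < p) (hαp : α < p - 1) (hl : 0 ≤ l₁) :
    ∃ μ : ℝ, 0 < μ ∧ μ ≤ 1 ∧ 0 ≤ (1 - μ) * (p - 1) - α ∧ μ * l₁ < 1 := by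
  have hp1 : 0 < p - 1 := by linarith
  have h1 : 0 < 1 - α / (p - 1) := by rw [sub_pos, div_lt_one hp1]; exact hαp
  have h2 : 0 < 1 / (l₁ + 1) := by positivity
  -- The bound 1 - α/(p-1) makes the flux exponent nonnegative, and 1/(l₁+1) gives μ l₁ ≤ l₁/(l₁+1)
  -- < 1.
  refine ⟨min (min 1 (1 - α / (p - 1))) (1 / (l₁ + 1)), lt_min (lt_min one_pos h1) h2,
    (min_le_left _ _).trans (min_le_left _ _), ?_, ?_⟩
  · have h3 := mul_le_mul_of_nonneg_right ((min_le_left _ (1 / (l₁ + 1))).trans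
      (min_le_right 1 (1 - α / (p - 1)))) hp1.le
    have h4 : α / (p - 1) * (p - 1) = α := div_mul_cancel₀ _ hp1.ne'
    linarith
  · have h3 := mul_le_mul_of_nonneg_right (min_le_right (min 1 (1 - α / (p - 1))) (1 / (l₁ + 1))) hl
    refine h3.trans_lt ?_
    rw [one_div_mul_eq_div, div_lt_one (by linarith)]
    linarith

theorem rpow_mul_weightD_rpow {α p t : ℝ} {k : ℝ → ℝ} (ht : 0 < t) (hk : 0 ≤ k t) :
    t ^ α * weightD α k t ^ p = t ^ (α - α * p / 2) * k t ^ p := by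
  rw [weightD, mul_rpow (rpow_nonneg ht.le _) hk, ← rpow_mul ht.le, ← mul_assoc, ← rpow_add ht]
  ring_nf

variable {N : ℕ} (hN : 2 ≤ N) {x₀ : EuclideanSpace ℝ (Fin N)} {p α σ : ℝ} (hp : 1 < p)
  (hαp : α < p - 1) (hσ : p - 2 < σ) {f : ℝ → ℝ} (hf : ContinuousOn f (Ici 0))
  (hmono : MonotoneOn f (Ici 0)) (hrv : IsRegularlyVarying f (σ + 1))
  {k : ℝ → ℝ} {l₁ ν : ℝ} (hK : ClassKOn α k l₁ ν)
  {b : EuclideanSpace ℝ (Fin N) → ℝ}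

include hN hK in
theorem ClassKOn.eventually_mul_le {β b₁ : ℝ}
    (h : (b₁ : EReal) ≤ liminf (quotB x₀ p α k b) (toBoundary x₀)) (hβ : β < b₁) :
    ∀ᶠ x in toBoundary x₀, β * (bdist x₀ x ^ α * weightD α k (bdist x₀ x) ^ p) ≤ b x := by
  filter_upwards [eventually_lt_of_lt_liminf ((EReal.coe_lt_coe_iff.2 hβ).trans_le h),
    (tendsto_bdist hN x₀).eventually hK.eventually_mem] with x hx hd
  rw [quotB, EReal.coe_lt_coe_iff] at hx
  rw [rpow_mul_weightD_rpow hd.1 (hK.k_pos _ hd).le]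
  exact ((lt_div_iff₀ (mul_pos (rpow_pos_of_pos hd.1 _)
    (rpow_pos_of_pos (hK.k_pos _ hd) _))).1 hx).le

include hN hK in
theorem ClassKOn.eventually_le_mul {β b₂ : ℝ}
    (h : limsup (quotB x₀ p α k b) (toBoundary x₀) ≤ b₂) (hβ : b₂ < β) :
    ∀ᶠ x in toBoundary x₀, b x ≤ β * (bdist x₀ x ^ α * weightD α k (bdist x₀ x) ^ p) := by
  filter_upwards [eventually_lt_of_limsup_lt (h.trans_lt (EReal.coe_lt_coe_iff.2 hβ)),
    (tendsto_bdist hN x₀).eventually hK.eventually_mem] with x hx hd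
  rw [quotB, EReal.coe_lt_coe_iff] at hx
  rw [rpow_mul_weightD_rpow hd.1 (hK.k_pos _ hd).le]
  exact ((div_lt_iff₀ (mul_pos (rpow_pos_of_pos hd.1 _)
    (rpow_pos_of_pos (hK.k_pos _ hd) _))).1 hx).le

variable (hb : ContinuousOn b (Metric.ball x₀ 1)) (hb0 : ∀ x ∈ Metric.ball x₀ 1, 0 < b x)
  {φ : ℝ → ℝ} {ε : ℝ} (hε : 0 < ε)
  (hφ : ∀ t ∈ Ioo 0 ε, 0 < φ t ∧ profileIntegral p f (φ t) = t)
  {u : EuclideanSpace ℝ (Fin N) → ℝ} (hu : IsLargeSolution x₀ p α b f u)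
  {β ξ : ℝ} (hβ : 0 < β) (hξ : 0 < ξ)

include hN hp hσ hf hmono hrv hK hε hφ in
theorem tendsto_profile_boundary :
    Tendsto (fun x => φ (weightK α k (bdist x₀ x))) (toBoundary x₀) atTop :=
  (tendsto_profile hp hσ hf hmono hrv hε hφ).comp (hK.tendsto_weightK.comp (tendsto_bdist hN x₀))

include hN hp hαp hσ hf hmono hrv hK hb hb0 hε hφ hu hβ hξ

theorem IsLargeSolution.eventually_le_add
    (hβξ : ξ ^ (p - 1) * ((p + l₁ * (1 - α / (p - 1)) * (2 + σ - p)) / (2 + σ)) <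
      β * ξ ^ (σ + 1))
    (hbβ : ∀ᶠ x in toBoundary x₀,
      β * (bdist x₀ x ^ α * weightD α k (bdist x₀ x) ^ p) ≤ b x) :
    ∃ C₀, ∀ᶠ x in toBoundary x₀, u x ≤ ξ * φ (weightK α k (bdist x₀ x)) + C₀ := by
  obtain ⟨μ, hμ, hμ1, he, hμl⟩ := exists_shift_exponent hp hαp hK.l₁_nonneg
  obtain ⟨δ₁, hδ₁, hδν, hV⟩ := exists_radialProfileOn hp hσ hf hmono hrv hK hφ hε hξ
  obtain ⟨δ₂, hδ₂, -, hM⟩ := hK.exists_monotoneOn hμl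
  obtain ⟨δ₃, hδ₃, hI⟩ := mem_nhdsGT_iff_exists_Ioo_subset.1
    (eventually_blowFluxDeriv_lt hp hσ hf hmono hrv hK hφ hε hξ hμ (2 * N) hβξ)
  obtain ⟨δ₄, hδ₄, hB⟩ := eventually_toBoundary_iff.1 hbβ
  obtain ⟨δ, hδ, h0, h1, h2, h3, h4⟩ : ∃ δ : ℝ, 0 < δ ∧ δ ≤ 1 / 2 ∧ δ ≤ δ₁ ∧ δ ≤ δ₂ ∧ δ ≤ δ₃ ∧
      δ ≤ δ₄ := by
    refine ⟨min (1 / 2) (min δ₁ (min δ₂ (min δ₃ δ₄))), ?_, ?_⟩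
    · exact lt_min (by norm_num) (lt_min hδ₁ (lt_min hδ₂ (lt_min hδ₃ hδ₄)))
    · simp
  obtain ⟨C₀, hC⟩ := IsLargeSolution.exists_le_add hN hp hb hb0 hf hmono hrv.pos hu hδ h0
    (hV.mono h1) hμ hμ1 he
    (fun t ht => hK.weightD_pos t ⟨ht.1, ht.2.trans_le (h1.trans hδν)⟩)
    (hM.mono (Ioo_subset_Ioo_right h2)) hβ (fun t ht => hI ⟨ht.1, ht.2.trans_le h3⟩)
    (fun x hx hxd => hB x hx (hxd.trans_le h4))
  exact ⟨C₀, eventually_toBoundary_iff.2 ⟨δ, hδ, hC⟩⟩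

theorem IsLargeSolution.eventually_sub_le
    (hβξ : β * ξ ^ (σ + 1) <
      ξ ^ (p - 1) * ((p + l₁ * (1 - α / (p - 1)) * (2 + σ - p)) / (2 + σ)))
    (hbβ : ∀ᶠ x in toBoundary x₀,
      b x ≤ β * (bdist x₀ x ^ α * weightD α k (bdist x₀ x) ^ p)) :
    ∃ C₀, ∀ᶠ x in toBoundary x₀, ξ * φ (weightK α k (bdist x₀ x)) - C₀ ≤ u x := by
  obtain ⟨μ, hμ, -, he, hμl⟩ := exists_shift_exponent hp hαp hK.l₁_nonneg
  obtain ⟨δ₁, hδ₁, hδν, hV⟩ := exists_radialProfileOn hp hσ hf hmono hrv hK hφ hε hξ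
  obtain ⟨δ₂, hδ₂, -, hM⟩ := hK.exists_monotoneOn hμl
  obtain ⟨δ₃, hδ₃, hI⟩ := mem_nhdsGT_iff_exists_Ioo_subset.1
    (eventually_lt_blowFluxDeriv hp hσ hf hmono hrv hK hφ hε hξ hβξ)
  obtain ⟨δ₄, hδ₄, hB⟩ := eventually_toBoundary_iff.1 hbβ
  obtain ⟨δ, hδ, h0, h1, h2, h3, h4⟩ : ∃ δ : ℝ, 0 < δ ∧ δ ≤ 1 / 2 ∧ δ ≤ δ₁ ∧ δ ≤ δ₂ ∧ δ ≤ δ₃ ∧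
      δ ≤ δ₄ := by
    refine ⟨min (1 / 2) (min δ₁ (min δ₂ (min δ₃ δ₄))), ?_, ?_⟩
    · exact lt_min (by norm_num) (lt_min hδ₁ (lt_min hδ₂ (lt_min hδ₃ hδ₄)))
    · simp
  obtain ⟨C₀, hC⟩ := IsLargeSolution.exists_sub_le hN hp hb hb0 hf hmono hrv.pos hu h0
    (hV.mono h1) hμ he
    (fun t ht => hK.weightD_pos t ⟨ht.1, ht.2.trans_le (h1.trans hδν)⟩)
    (hM.mono (Ioo_subset_Ioo_right h2)) hβ (fun t ht => hI ⟨ht.1, ht.2.trans_le h3⟩)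
    (fun x hx hxd => hB x hx (hxd.trans_le h4))
  exact ⟨C₀, eventually_toBoundary_iff.2 ⟨δ / 2, by linarith, hC⟩⟩

omit hN hp hαp hσ hf hmono hrv hK hb hb0 hε hφ hu hβ hξ

theorem eventually_div_lt_of_le_add {ι : Type*} {l : Filter ι} {u w : ι → ℝ} {ξ ξ' C : ℝ}
    (hw : Tendsto w l atTop) (hξ : ξ < ξ') (h : ∀ᶠ x in l, u x ≤ ξ * w x + C) :
    ∀ᶠ x in l, u x / w x < ξ' := by
  filter_upwards [h, hw.eventually_gt_atTop 0,
    hw.eventually_gt_atTop (C / (ξ' - ξ))] with x h1 h2 h3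
  rw [div_lt_iff₀ (by linarith)] at h3
  rw [div_lt_iff₀ h2]
  linarith

theorem eventually_lt_div_of_sub_le {ι : Type*} {l : Filter ι} {u w : ι → ℝ} {ξ ξ' C : ℝ}
    (hw : Tendsto w l atTop) (hξ : ξ' < ξ) (h : ∀ᶠ x in l, ξ * w x - C ≤ u x) :
    ∀ᶠ x in l, ξ' < u x / w x := by
  filter_upwards [h, hw.eventually_gt_atTop 0,
    hw.eventually_gt_atTop (C / (ξ - ξ'))] with x h1 h2 h3
  rw [div_lt_iff₀ (by linarith)] at h3
  rw [lt_div_iff₀ h2]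
  linarith

/-- The numerator of the blow-up constant is positive. -/
theorem xiNum_pos {p α σ l₁ : ℝ} (hp : 1 < p) (hαp : α < p - 1) (hσ : p - 2 < σ) (hl : 0 ≤ l₁) :
    0 < (p + l₁ * (1 - α / (p - 1)) * (2 + σ - p)) / (2 + σ) := by
  have h1 : 0 < 1 - α / (p - 1) := by rw [sub_pos, div_lt_one (by linarith)]; exact hαp
  exact div_pos (add_pos_of_pos_of_nonneg (by linarith)
    (mul_nonneg (mul_nonneg hl h1.le) (by linarith))) (by linarith)

theorem xiConst_pos {p α σ l₁ c : ℝ} (hp : 1 < p) (hαp : α < p - 1) (hσ : p - 2 < σ)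
    (hl : 0 ≤ l₁) (hc : 0 < c) : 0 < xiConst p α σ l₁ c := by
  rw [xiConst, mul_comm c, ← div_div]
  exact rpow_pos_of_pos (div_pos (xiNum_pos hp hαp hσ hl) hc) _

theorem xiConst_rpow {p α σ l₁ c : ℝ} (hp : 1 < p) (hαp : α < p - 1) (hσ : p - 2 < σ)
    (hl : 0 ≤ l₁) (hc : 0 < c) : c * xiConst p α σ l₁ c ^ (2 + σ - p) =
      (p + l₁ * (1 - α / (p - 1)) * (2 + σ - p)) / (2 + σ) := by
  rw [xiConst, mul_comm c (2 + σ), ← div_div, ← rpow_mul (div_pos (xiNum_pos hp hαp hσ hl) hc).le,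
    one_div_mul_cancel (by linarith), rpow_one, mul_div_cancel₀ _ hc.ne']

/-- Divided by ξ^{p-1}, the inequality says that β ξ^{2+σ-p} exceeds the quantity equal to c
`xiConst`^{2+σ-p}. As 2+σ-p > 0, a larger ξ leaves room for β < c. -/
theorem rpow_mul_xiNum_lt {p α σ l₁ c ξ : ℝ} (hp : 1 < p) (hαp : α < p - 1) (hσ : p - 2 < σ)
    (hl : 0 ≤ l₁) (hc : 0 < c) (hξ : xiConst p α σ l₁ c < ξ) :
    ∃ β, 0 < β ∧ β < c ∧ ξ ^ (p - 1) * ((p + l₁ * (1 - α / (p - 1)) * (2 + σ - p)) / (2 + σ)) <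
      β * ξ ^ (σ + 1) := by
  have h0 := xiConst_pos hp hαp hσ hl hc
  have hξ0 := h0.trans hξ
  have h1 := rpow_lt_rpow h0.le hξ (show 0 < 2 + σ - p by linarith)
  have h2 := rpow_pos_of_pos hξ0 (2 + σ - p)
  have h3 : (p + l₁ * (1 - α / (p - 1)) * (2 + σ - p)) / (2 + σ) / ξ ^ (2 + σ - p) < c := by
    rw [div_lt_iff₀ h2, ← xiConst_rpow hp hαp hσ hl hc]
    exact mul_lt_mul_of_pos_left h1 hc
  obtain ⟨β, hβ1, hβ2⟩ := exists_between h3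
  refine ⟨β, (div_pos (xiNum_pos hp hαp hσ hl) h2).trans hβ1, hβ2, ?_⟩
  rw [div_lt_iff₀ h2] at hβ1
  rw [show σ + 1 = (p - 1) + (2 + σ - p) by ring, rpow_add hξ0, mul_left_comm]
  exact mul_lt_mul_of_pos_left hβ1 (rpow_pos_of_pos hξ0 _)

theorem lt_rpow_mul_xiNum {p α σ l₁ c ξ : ℝ} (hp : 1 < p) (hαp : α < p - 1) (hσ : p - 2 < σ)
    (hl : 0 ≤ l₁) (hc : 0 < c) (hξ0 : 0 < ξ) (hξ : ξ < xiConst p α σ l₁ c) :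
    ∃ β, c < β ∧ β * ξ ^ (σ + 1) <
      ξ ^ (p - 1) * ((p + l₁ * (1 - α / (p - 1)) * (2 + σ - p)) / (2 + σ)) := by
  have h1 := rpow_lt_rpow hξ0.le hξ (show 0 < 2 + σ - p by linarith)
  have h2 := rpow_pos_of_pos hξ0 (2 + σ - p)
  have h3 : c < (p + l₁ * (1 - α / (p - 1)) * (2 + σ - p)) / (2 + σ) / ξ ^ (2 + σ - p) := by
    rw [lt_div_iff₀ h2, ← xiConst_rpow hp hαp hσ hl hc]
    exact mul_lt_mul_of_pos_left h1 hc
  obtain ⟨β, hβ1, hβ2⟩ := exists_between h3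
  refine ⟨β, hβ1, ?_⟩
  rw [lt_div_iff₀ h2] at hβ2
  rw [show σ + 1 = (p - 1) + (2 + σ - p) by ring, rpow_add hξ0, mul_left_comm]
  exact mul_lt_mul_of_pos_left hβ2 (rpow_pos_of_pos hξ0 _)

include hN hp hαp hσ hf hmono hrv hK hb hb0 hε hφ hu

theorem IsLargeSolution.eventually_div_lt {b₁ : ℝ} (hb₁ : 0 < b₁)
    (h : (b₁ : EReal) ≤ liminf (quotB x₀ p α k b) (toBoundary x₀))
    (hξ : xiConst p α σ l₁ b₁ < ξ) :
    ∀ᶠ x in toBoundary x₀, u x / φ (weightK α k (bdist x₀ x)) < ξ := by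
  obtain ⟨ξ', h1, h2⟩ := exists_between hξ
  obtain ⟨β, hβ, hβb, hβξ⟩ := rpow_mul_xiNum_lt hp hαp hσ hK.l₁_nonneg hb₁ h1
  obtain ⟨C, hC⟩ := IsLargeSolution.eventually_le_add hN hp hαp hσ hf hmono hrv hK hb hb0 hε hφ hu
    hβ ((xiConst_pos hp hαp hσ hK.l₁_nonneg hb₁).trans h1) hβξ (hK.eventually_mul_le hN h hβb)
  exact eventually_div_lt_of_le_add
    (tendsto_profile_boundary hN hp hσ hf hmono hrv hK hε hφ) h2 hC

theorem IsLargeSolution.eventually_lt_div {b₂ : ℝ} (hb₂ : 0 < b₂)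
    (h : limsup (quotB x₀ p α k b) (toBoundary x₀) ≤ b₂)
    (hξ : ξ < xiConst p α σ l₁ b₂) :
    ∀ᶠ x in toBoundary x₀, ξ < u x / φ (weightK α k (bdist x₀ x)) := by
  -- ξ may be nonpositive here, while the subsolution needs a positive factor; hence the maximum
  -- with 0.
  obtain ⟨ξ', h1, h2⟩ := exists_between
    (max_lt hξ (xiConst_pos hp hαp hσ hK.l₁_nonneg hb₂))
  have hξ0 : 0 < ξ' := (le_max_right _ _).trans_lt h1
  obtain ⟨β, hβb, hβξ⟩ := lt_rpow_mul_xiNum hp hαp hσ hK.l₁_nonneg hb₂ hξ0 h2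
  obtain ⟨C, hC⟩ := IsLargeSolution.eventually_sub_le hN hp hαp hσ hf hmono hrv hK hb hb0 hε hφ hu
    (hb₂.trans hβb) hξ0 hβξ (hK.eventually_le_mul hN h hβb)
  exact eventually_lt_div_of_sub_le
    (tendsto_profile_boundary hN hp hσ hf hmono hrv hK hε hφ) ((le_max_left _ _).trans_lt h1) hC

end BlowUpRate

theorem mainTheorem1 {N : ℕ} (hN : 2 ≤ N) (x₀ : EuclideanSpace ℝ (Fin N))
    (p α σ : ℝ) (hp : 1 < p) (hα : -1 < α) (hαp : α < p - 1) (hσ : p - 2 < σ)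
    (f : ℝ → ℝ) (hf_diff : ContDiffOn ℝ 1 f (Ici 0)) (hf_mono : MonotoneOn f (Ici 0))
    (hf_rv : IsRegularlyVarying f (σ + 1))
    (k : ℝ → ℝ) (l₁ : ℝ) (hk : MemClassK α k l₁)
    (b : EuclideanSpace ℝ (Fin N) → ℝ) (hb_cont : ContinuousOn b (Metric.ball x₀ 1))
    (hb_pos : ∀ x ∈ Metric.ball x₀ 1, 0 < b x)
    (b₁ b₂ : ℝ) (hb₁ : 0 < b₁) (hb₂ : 0 < b₂)
    (hb_liminf : liminf (quotB x₀ p α k b) (toBoundary x₀) = (b₁ : EReal))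
    (hb_limsup : limsup (quotB x₀ p α k b) (toBoundary x₀) = (b₂ : EReal)) :
    (∃ φ : ℝ → ℝ, IsProfile p f φ) ∧
    ∀ φ : ℝ → ℝ, IsProfile p f φ →
    ∀ u : EuclideanSpace ℝ (Fin N) → ℝ, IsLargeSolution x₀ p α b f u →
      ((xiConst p α σ l₁ b₂ : EReal) ≤
          liminf (fun x => ((u x / φ (weightK α k (bdist x₀ x)) : ℝ) : EReal)) (toBoundary x₀) ∧
        liminf (fun x => ((u x / φ (weightK α k (bdist x₀ x)) : ℝ) : EReal)) (toBoundary x₀) ≤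
          limsup (fun x => ((u x / φ (weightK α k (bdist x₀ x)) : ℝ) : EReal)) (toBoundary x₀) ∧
        limsup (fun x => ((u x / φ (weightK α k (bdist x₀ x)) : ℝ) : EReal)) (toBoundary x₀) ≤
          (xiConst p α σ l₁ b₁ : EReal)) ∧
      ∀ c : ℝ, b₁ = c → b₂ = c →
        Tendsto (fun x => u x / φ (weightK α k (bdist x₀ x))) (toBoundary x₀)
          (𝓝 (xiConst p α σ l₁ c)) := by
  have hf := hf_diff.continuousOn
  refine ⟨exists_isProfile hp hσ hf hf_mono hf_rv, fun φ hφ u hu => ?_⟩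
  obtain ⟨ν, hK⟩ := hk.exists_classKOn
  obtain ⟨ε, hε, hφε⟩ := hφ.exists_spec
  have hne := toBoundary_neBot hN x₀
  have hup : ∀ ξ, xiConst p α σ l₁ b₁ < ξ →
      ∀ᶠ x in toBoundary x₀, u x / φ (weightK α k (bdist x₀ x)) < ξ := fun ξ hξ =>
    IsLargeSolution.eventually_div_lt hN hp hαp hσ hf hf_mono hf_rv hK hb_cont hb_pos hε hφε hu
      hb₁ hb_liminf.ge hξ
  have hlo : ∀ ξ, ξ < xiConst p α σ l₁ b₂ →
      ∀ᶠ x in toBoundary x₀, ξ < u x / φ (weightK α k (bdist x₀ x)) := fun ξ hξ =>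
    IsLargeSolution.eventually_lt_div hN hp hαp hσ hf hf_mono hf_rv hK hb_cont hb_pos hε hφε hu
      hb₂ hb_limsup.le hξ
  refine ⟨⟨?_, liminf_le_limsup, ?_⟩, ?_⟩
  · refine EReal.ge_of_forall_gt_iff_ge.1 fun ξ hξ => ?_
    refine le_liminf_of_le (by isBoundedDefault) ?_
    filter_upwards [hlo ξ (EReal.coe_lt_coe_iff.1 hξ)] with x hx
    exact EReal.coe_le_coe_iff.2 hx.le
  · refine EReal.le_of_forall_lt_iff_le.1 fun ξ hξ => ?_
    refine limsup_le_of_le (by isBoundedDefault) ?_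
    filter_upwards [hup ξ (EReal.coe_lt_coe_iff.1 hξ)] with x hx
    exact EReal.coe_le_coe_iff.2 hx.le
  · rintro c rfl h
    subst h
    -- With b₁ = b₂ the two one-sided estimates are the order characterization of convergence.
    exact tendsto_order.2 ⟨hlo, hup⟩
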